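/- **Setting.** Let $a<b$, $T>0$, let $m\ge 0$ be an integer, and let $\phi,\gamma$ be real continuous functions on $[a,b]$ with $\phi(a)=\phi(b)$, $\gamma(a)=\gamma(b)$. Put $\mu_l=2\pi l/(b-a)$, $\delta_l=\sqrt{1+\mu_l^2}$ and $\widehat u_l=\frac1{b-a}\int_a^b u(x)e^{-i\mu_l(x-a)}\,dx$ for $l\in\mathbb Z$. For an integer $s\ge0$, $H^s$ is the space of $u\in L^2(a,b)$ with finite norm $\|u\|_{H^s}^2=\sum_{l\in\mathbb Z}(1+\mu_l^2)^s|\widehat u_l|^2$, and $\|\cdot\|_{L^2}=\|\cdot\|_{H^0}$. For $0<\varepsilon\le1$ consider the sine–Gordon equation with periodic boundary conditions $$\partial_{tt}w-\partial_{xx}w+\tfrac1\varepsilon\sin(\varepsilon w)=0,\qquad w(\cdot,0)=\phi,\quad \partial_tw(\cdot,0)=\gamma,\qquad x\in(a,b),\ 0\le t\le T/\varepsilon^2 .$$ Solutions are understood as finite energy weak solutions: $w(t)\in H^1$, $\partial_tw(t)\in L^2$ for all $t\in[0,T/\varepsilon^2]$, and for every smooth $(b-a)$-periodic $\chi$ one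 has $\frac{d}{dt}\int_a^b w\chi=\int_a^b \partial_tw\,\chi$ and $\frac{d}{dt}\int_a^b\partial_tw\,\chi=\int_a^b w\chi''-\int_a^b\frac1\varepsilon\sin(\varepsilon w)\chi$. For $K>0$ and an integer $r\ge0$, assumption $(\mathrm A_{r,K})$ on a solution is $$\sup_{0\le t\le T/\varepsilon^2}\|w(t)\|_{H^{r+1}}\le K,\qquad \sup_{0\le t\le T/\varepsilon^2}\|\partial_tw(t)\|_{H^{r}}\le K .$$ **Scheme (LEI-FP).** Let $M$ be an even positive integer, $h=(b-a)/M$, $x_j=a+jh$ $(0\le j\le M)$, $\mathcal T_M=\{-M/2,\dots,M/2-1\}$, $\tau>0$ and $t_n=n\tau$. For a grid function $u=(u_0,\dots,u_M)$ put $\widetilde u_l=\frac1M\sum_{j=0}^{M-1}u_je^{-i\mu_l(x_j-a)}$ and $(I_Mu)(x)=\sum_{l\in\mathcal T_M}\widetilde u_le^{i\mu_l(x-a)}$. Let $g(\psi)=f\big(\tfrac12(\psi+\overline\psi)\big)$ with $f(y)=\frac1\varepsilon\sin(\varepsilon y)-y$. Define $$\psi^0_j=\phi(x_j)-i\sum_{l\in\mathcal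 T_M}\frac{\widetilde\gamma_l}{\delta_l}e^{i\mu_l(x_j-a)},\qquad \psi^{n+1}_j=\sum_{l\in\mathcal T_M}\Big[e^{i\tau\delta_l}\,\widetilde{(\psi^n)}_l+\tau e^{i\tau\delta_l}\tfrac{i}{\delta_l}\,\widetilde{(g(\psi^n))}_l\Big]e^{i\mu_l(x_j-a)} ,$$ $w^0_j=\phi(x_j)$, $z^0_j=\gamma(x_j)$, and for $n\ge0$ $$w^{n+1}_j=\tfrac12\big(\psi^{n+1}_j+\overline{\psi^{n+1}_j}\big),\qquad z^{n+1}_j=\tfrac i2\sum_{l\in\mathcal T_M}\delta_l\Big[\widetilde{(\psi^{n+1})}_l-\widetilde{(\overline{\psi^{n+1}})}_l\Big]e^{i\mu_l(x_j-a)} .$$ **Theorem 3.2.** 1. For every $K$ there is $h_0>0$ such that for every $\beta>0$ there are $\tau_*\in(0,1)$ and $C>0$ with the following property: for all $0<\varepsilon\le1$, every solution $w$ satisfying $(\mathrm A_{m,K})$, all $0<\tau_0\le\tau_*$, all even $M>0$ with $h\le h_0$, and all $0<\tau<\beta\tau_0$, $$\|w(\cdot,t_n)-I_Mw^n\|_{H^1}+\|\partial_tw(\cdot,t_n)-I_Mz^n\|_{L^2}\le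 C\big(h^m+\varepsilon^2\tau+\tau_0^{m+1}\big),\qquad 0\le n\le\frac{T/\varepsilon^2}{\tau}.$$ Here $h_0,\tau_*,C$ depend only on $a,b,T,m,\phi,\gamma,K$ and, for $\tau_*$ and $C$, on $\beta$; in particular they are independent of $\varepsilon,h,\tau,\tau_0,n$. 2. For smooth solutions the last term can be dropped for sufficiently small $\tau$: for every sequence $(K_r)_{r\ge0}$ and every $\sigma>0$ there are $h_0,\tau_1,C>0$, depending only on $a,b,T,m,\phi,\gamma,(K_r)_{r\ge0},\sigma$, such that for all $0<\varepsilon\le1$, every solution $w$ satisfying $(\mathrm A_{r,K_r})$ for all $r\ge0$, all even $M>0$ with $h\le h_0$, and all $0<\tau<\tau_1\varepsilon^\sigma$, $$\|w(\cdot,t_n)-I_Mw^n\|_{H^1}+\|\partial_tw(\cdot,t_n)-I_Mz^n\|_{L^2}\le C\big(h^m+\varepsilon^2\tau\big),\qquad 0\le n\le\frac{T/\varepsilon^2}{\tau}.$$ -/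

import Mathlib

open scoped ContDiff

namespace SineGordon

/-- The wave number `μ_l = 2πl/(b-a)` of the `(b-a)`-periodic Fourier mode `l`. -/
noncomputable def mu (a b : ℝ) (l : ℤ) : ℝ := 2 * Real.pi * l / (b - a)

/-- The symbol `δ_l = √(1 + μ_l²)` of the operator `⟨∇⟩ = √(1 - Δ)`. -/
noncomputable def delta (a b : ℝ) (l : ℤ) : ℝ := Real.sqrt (1 + mu a b l ^ 2)

/-- The Fourier mode `e^{iμ_l(x-a)}`. -/
noncomputable def mode (a b : ℝ) (l : ℤ) (x : ℝ) : ℂ :=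
  Complex.exp (Complex.I * ((mu a b l * (x - a) : ℝ) : ℂ))

/-- The Fourier coefficient `û_l = (b-a)⁻¹ ∫_a^b u(x) e^{-iμ_l(x-a)} dx`. -/
noncomputable def fourierCoef (a b : ℝ) (u : ℝ → ℂ) (l : ℤ) : ℂ :=
  (1 / ((b - a : ℝ) : ℂ)) *
    ∫ x in a..b, u x * Complex.exp (-(Complex.I * ((mu a b l * (x - a) : ℝ) : ℂ)))

/-- Membership in the periodic Sobolev space `H^s(a,b)`: `u ∈ L²(a,b)` and
`∑_l (1+μ_l²)^s |û_l|² < ∞`. -/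
def MemSobolev (a b : ℝ) (s : ℕ) (u : ℝ → ℂ) : Prop :=
  MeasureTheory.MemLp u 2 (MeasureTheory.volume.restrict (Set.Ioc a b)) ∧
    Summable fun l : ℤ => (1 + mu a b l ^ 2) ^ s * ‖fourierCoef a b u l‖ ^ 2

/-- The norm of `H^s(a,b)`: `‖u‖² = ∑_l (1+μ_l²)^s |û_l|²` (meaningful for `MemSobolev a b s u`).
For `s = 0` this is the (normalized) `L²`-norm. -/
noncomputable def sobolevNorm (a b : ℝ) (s : ℕ) (u : ℝ → ℂ) : ℝ :=
  Real.sqrt (∑' l : ℤ, (1 + mu a b l ^ 2) ^ s * ‖fourierCoef a b u l‖ ^ 2)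

/-- The space `C_p` of continuous functions on `[a,b]` with `u(a) = u(b)`. -/
def PeriodicContinuous (a b : ℝ) (u : ℝ → ℝ) : Prop :=
  ContinuousOn u (Set.Icc a b) ∧ u a = u b

/-- `w` (with time derivative `v = ∂_t w`) solves on the time interval `[0,S]` the periodic problem
`∂_tt w - ∂_xx w + ε⁻¹ sin(ε w) = 0`, `w(0) = φ`, `∂_t w(0) = γ` on `(a,b)`, in the sense of finite
energy weak solutions: `w(t) ∈ H¹`, `v(t) ∈ L²`, and both equations `∂_t w = v` and
`∂_t v = ∂_xx w - ε⁻¹ sin(ε w)` hold after integration against smooth `(b-a)`-periodic functions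
of `x`.  The periodic boundary conditions are carried by the periodic space `H¹` and by the
periodic test functions. -/
structure IsSolution (a b ε S : ℝ) (φ γ : ℝ → ℝ) (w v : ℝ → ℝ → ℝ) : Prop where
  memH1 : ∀ t ∈ Set.Icc 0 S, MemSobolev a b 1 fun x => (w t x : ℂ)
  memL2 : ∀ t ∈ Set.Icc 0 S, MemSobolev a b 0 fun x => (v t x : ℂ)
  deriv_w : ∀ χ : ℝ → ℝ, ContDiff ℝ ∞ χ → Function.Periodic χ (b - a) → ∀ t ∈ Set.Icc 0 S,
    HasDerivWithinAt (fun s => ∫ x in a..b, w s x * χ x) (∫ x in a..b, v t x * χ x)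
      (Set.Icc 0 S) t
  deriv_v : ∀ χ : ℝ → ℝ, ContDiff ℝ ∞ χ → Function.Periodic χ (b - a) → ∀ t ∈ Set.Icc 0 S,
    HasDerivWithinAt (fun s => ∫ x in a..b, v s x * χ x)
      ((∫ x in a..b, w t x * deriv (deriv χ) x) -
        ∫ x in a..b, 1 / ε * Real.sin (ε * w t x) * χ x)
      (Set.Icc 0 S) t
  init_w : ∀ᵐ x ∂(MeasureTheory.volume.restrict (Set.Ioc a b)), w 0 x = φ x
  init_v : ∀ᵐ x ∂(MeasureTheory.volume.restrict (Set.Ioc a b)), v 0 x = γ x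

/-- The bounds `‖w‖_{L^∞([0,S];H^{m+1})} ≤ K` and `‖∂_t w‖_{L^∞([0,S];H^m)} ≤ K`. -/
def SobolevBound (a b S : ℝ) (m : ℕ) (K : ℝ) (w v : ℝ → ℝ → ℝ) : Prop :=
  ∀ t ∈ Set.Icc 0 S,
    (MemSobolev a b (m + 1) (fun x => (w t x : ℂ)) ∧
      sobolevNorm a b (m + 1) (fun x => (w t x : ℂ)) ≤ K) ∧
    (MemSobolev a b m (fun x => (v t x : ℂ)) ∧
      sobolevNorm a b m (fun x => (v t x : ℂ)) ≤ K)

/-- The index set `T_M = {-M/2, …, M/2 - 1}` (`M` even). -/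
noncomputable def freq (M : ℕ) : Finset ℤ := Finset.Ico (-((M : ℤ) / 2)) ((M : ℤ) / 2)

/-- The mesh size `h = (b-a)/M`. -/
noncomputable def mesh (a b : ℝ) (M : ℕ) : ℝ := (b - a) / M

/-- The grid points `x_j = a + jh`, `j = 0, …, M`. -/
noncomputable def grid (a b : ℝ) (M : ℕ) (j : Fin (M + 1)) : ℝ := a + (j : ℕ) * mesh a b M

/-- The discrete Fourier coefficient `ũ_l = M⁻¹ ∑_{j=0}^{M-1} u_j e^{-iμ_l(x_j-a)}` of a grid
function `u = (u_0, …, u_M)`. -/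
noncomputable def dft (a b : ℝ) (M : ℕ) (u : Fin (M + 1) → ℂ) (l : ℤ) : ℂ :=
  (1 / (M : ℂ)) * ∑ j : Fin M, u j.castSucc *
    Complex.exp (-(Complex.I * ((mu a b l * (grid a b M j.castSucc - a) : ℝ) : ℂ)))

/-- The trigonometric interpolation `(I_M u)(x) = ∑_{l ∈ T_M} ũ_l e^{iμ_l(x-a)}`. -/
noncomputable def interp (a b : ℝ) (M : ℕ) (u : Fin (M + 1) → ℂ) (x : ℝ) : ℂ :=
  ∑ l ∈ freq M, dft a b M u l * mode a b l x

/-- The nonlinearity `f(y) = ε⁻¹ sin(εy) - y`. -/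
noncomputable def nonlin (ε y : ℝ) : ℝ := 1 / ε * Real.sin (ε * y) - y

/-- The Lawson exponential integrator Fourier pseudospectral iterates `ψ^n` with step `τ`:
`ψ^{n+1}_j = ∑_{l ∈ T_M} (e^{iτδ_l} ψ̃^n_l + τ e^{iτδ_l} (i/δ_l) (g(ψ^n))~_l) e^{iμ_l(x_j-a)}`, where
`g(ψ) = f((ψ + ψ̄)/2) = f(Re ψ)`. -/
noncomputable def psi (a b ε τ : ℝ) (φ γ : ℝ → ℝ) (M : ℕ) : ℕ → Fin (M + 1) → ℂ
  | 0 => fun j => (φ (grid a b M j) : ℂ) - Complex.I *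
      ∑ l ∈ freq M, dft a b M (fun k => (γ (grid a b M k) : ℂ)) l / (delta a b l : ℂ) *
        mode a b l (grid a b M j)
  | n + 1 => fun j => ∑ l ∈ freq M,
      (Complex.exp (Complex.I * ((τ * delta a b l : ℝ) : ℂ)) *
          dft a b M (psi a b ε τ φ γ M n) l +
        (τ : ℂ) * Complex.exp (Complex.I * ((τ * delta a b l : ℝ) : ℂ)) *
          (Complex.I / (delta a b l : ℂ) *
            dft a b M (fun k => (nonlin ε (psi a b ε τ φ γ M n k).re : ℂ)) l)) *
      mode a b l (grid a b M j)

/-- The approximations `w^n_j` of `w(x_j,t_n)`: `w^0_j = φ(x_j)` and, for `n ≥ 1`,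
`w^n_j = (ψ^n_j + conj ψ^n_j)/2`. -/
noncomputable def wNum (a b ε τ : ℝ) (φ γ : ℝ → ℝ) (M : ℕ) : ℕ → Fin (M + 1) → ℂ
  | 0 => fun j => (φ (grid a b M j) : ℂ)
  | n + 1 => fun j => (1 / 2 : ℂ) *
      (psi a b ε τ φ γ M (n + 1) j + (starRingEnd ℂ) (psi a b ε τ φ γ M (n + 1) j))

/-- The approximations `z^n_j` of `∂_t w(x_j,t_n)`: `z^0_j = γ(x_j)` and, for `n ≥ 1`,
`z^n_j = (i/2) ∑_{l ∈ T_M} δ_l ((ψ^n)~_l - (conj ψ^n)~_l) e^{iμ_l(x_j-a)}`. -/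
noncomputable def zNum (a b ε τ : ℝ) (φ γ : ℝ → ℝ) (M : ℕ) : ℕ → Fin (M + 1) → ℂ
  | 0 => fun j => (γ (grid a b M j) : ℂ)
  | n + 1 => fun j => Complex.I / 2 * ∑ l ∈ freq M, (delta a b l : ℂ) *
      (dft a b M (psi a b ε τ φ γ M (n + 1)) l -
        dft a b M (fun k => (starRingEnd ℂ) (psi a b ε τ φ γ M (n + 1) k)) l) *
      mode a b l (grid a b M j)

/-- `‖w(t_n) - I_M w^n‖_{H¹} + ‖∂_t w(t_n) - I_M z^n‖_{L²} ≤ B` at `t_n = nτ`, where both error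
functions lie in the respective spaces. -/
def ErrorLE (a b ε τ : ℝ) (φ γ : ℝ → ℝ) (M : ℕ) (w v : ℝ → ℝ → ℝ) (n : ℕ) (B : ℝ) : Prop :=
  MemSobolev a b 1 (fun x => (w (n * τ) x : ℂ) - interp a b M (wNum a b ε τ φ γ M n) x) ∧
  MemSobolev a b 0 (fun x => (v (n * τ) x : ℂ) - interp a b M (zNum a b ε τ φ γ M n) x) ∧
  sobolevNorm a b 1 (fun x => (w (n * τ) x : ℂ) - interp a b M (wNum a b ε τ φ γ M n) x) +
    sobolevNorm a b 0 (fun x => (v (n * τ) x : ℂ) - interp a b M (zNum a b ε τ φ γ M n) x) ≤ B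

end SineGordon

/-! Everything is estimated on Fourier coefficients in `ℓ²`. With `ψ = w - i⟨∇⟩⁻¹∂_t w` the equation
becomes first order, and the twisted variable `Ψ(t) = e^{-it⟨∇⟩}ψ(t)` satisfies `⟨∇⟩∂_tΨ = i
e^{-it⟨∇⟩} f(w)`. The right-hand side has size `ε²`, because `f(y) = -ε²y³/6 + O(ε⁴)`. One step of
the scheme replaces the time integral of this right-hand side by the left-endpoint rule. Adding the
sizes of the quadrature errors, about `ε²τ²` per step, over `T/(ε²τ)` steps gives only `O(τ)`; the
bound `ε²τ` comes from cancellation between steps.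

To see the cancellation, split `f` into its cubic part and a quintic remainder. The remainder costs
`ε⁴τ²` per step, which is harmless. In the cubic part, `w` is replaced on each step by the free wave
whose twisted variable is frozen at the start of the step and cut to frequencies `δ ≤ Λ`. Freezing
gains another `ε²τ`, the cut costs `Λ^{-(m+1)}`, and together these add up to `ε²τ + Λ^{-(m+1)}`
over the whole time interval (`nrm_local_error_le`). What is left is explicit: for each triple of
waves a sum over `k` of slowly varying amplitudes times `e^{iθkτ}κ(θ,τ)`, where `κ(θ,τ) = ∫₀^τ
(e^{iθr} - 1) dr`. This is summed by parts in `k`. For `|θ|τ ≤ 1/2` one has `|κ| ≤ |θ|τ²` and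
`|e^{iθτ} - 1| ≥ |θ|τ/2`, so their quotient is at most `2τ` whatever `θ` is: there is no small
divisor (`norm_sum_kap_le`). The amplitudes move at speed `ε²`, so their total variation up to time
`T/ε²` is bounded, the sum is `O(τ)`, and the prefactor `ε²` gives `ε²τ` (`nrm_sum_corr_le`,
`nrm_sum_local_error_le`).

In space, the algebra property of `H^{m+1}` bounds the nonlinearity, and aliasing costs `h^{m+1}`
(`nrm_alias_le`, `nrm_nonlinErr_le`). The nonlinearity is Lipschitz with constant `O(ε²)` as long as
the numerical solution stays bounded, so a discrete Gronwall inequality with a bootstrap closes the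
estimate up to time `T/ε²` (`gronwall_bootstrap`).

All relevant `|θ|` are at most `6Λ`. The choice `Λ = 1/(12βτ₀)` therefore admits every `τ < βτ₀` and
turns `Λ^{-(m+1)}` into a multiple of `τ₀^{m+1}` (`exists_error_bound`). For smooth solutions the
same bound is used with a larger index `r` and `τ₀ = 2τ`: if `τ ≤ ε^σ` and `σr ≥ 2`, then `τ^{r+1} ≤
ε²τ`. -/

namespace SineGordon

open MeasureTheory Filter Topology
open scoped ENNReal NNReal

/-! ### The `ℓ²` norm of a sequence of Fourier coefficients -/

/-- The `ℓ²` norm of a complex sequence indexed by `ℤ`, with values in `[0, ∞]`. -/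
noncomputable def nrm (c : ℤ → ℂ) : ℝ≥0∞ := eLpNorm c 2 Measure.count

lemma aesm_int (c : ℤ → ℂ) : AEStronglyMeasurable c (Measure.count : Measure ℤ) :=
  (measurable_of_countable c).aestronglyMeasurable

lemma nrm_add_le (c d : ℤ → ℂ) : nrm (fun l => c l + d l) ≤ nrm c + nrm d :=
  eLpNorm_add_le (aesm_int c) (aesm_int d) (by norm_num)

lemma nrm_sub_le (c d : ℤ → ℂ) : nrm (fun l => c l - d l) ≤ nrm c + nrm d :=
  eLpNorm_sub_le (aesm_int c) (aesm_int d) (by norm_num)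

lemma nrm_sum_le {ι : Type*} (s : Finset ι) (f : ι → ℤ → ℂ) :
    nrm (fun l => ∑ i ∈ s, f i l) ≤ ∑ i ∈ s, nrm (f i) := by
  have := eLpNorm_sum_le (s := s) (f := f) (p := 2) (μ := Measure.count)
    (fun i _ => aesm_int (f i)) (by norm_num)
  refine le_trans (le_of_eq ?_) this
  unfold nrm
  congr 1
  ext l
  simp

lemma nrm_mono {c d : ℤ → ℂ} (h : ∀ l, ‖c l‖ ≤ ‖d l‖) : nrm c ≤ nrm d :=
  eLpNorm_mono h

lemma nrm_congr_norm {c d : ℤ → ℂ} (h : ∀ l, ‖c l‖ = ‖d l‖) : nrm c = nrm d :=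
  le_antisymm (nrm_mono fun l => (h l).le) (nrm_mono fun l => (h l).ge)

lemma nrm_const_mul (z : ℂ) (c : ℤ → ℂ) : nrm (fun l => z * c l) = ‖z‖ₑ * nrm c :=
  eLpNorm_const_smul z c 2 Measure.count

lemma nrm_le_mul {B : ℝ} {c d : ℤ → ℂ} (h : ∀ l, ‖c l‖ ≤ B * ‖d l‖) :
    nrm c ≤ ENNReal.ofReal B * nrm d :=
  eLpNorm_le_mul_eLpNorm_of_ae_le_mul (ae_of_all _ h) 2

lemma nrm_sq (c : ℤ → ℂ) : nrm c ^ 2 = ∑' l, ‖c l‖ₑ ^ 2 := by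
  have := eLpNorm_nnreal_pow_eq_lintegral (f := c) (μ := Measure.count) (p := 2) (by norm_num)
  simp only [lintegral_count] at this
  have h2 : ((2 : ℝ≥0) : ℝ) = ((2 : ℕ) : ℝ) := by norm_num
  rw [h2] at this
  simp only [ENNReal.rpow_natCast] at this
  exact this

lemma nrm_comp_equiv (e : ℤ ≃ ℤ) (c : ℤ → ℂ) : nrm (fun l => c (e l)) = nrm c := by
  have h : nrm (fun l => c (e l)) ^ 2 = nrm c ^ 2 := by
    rw [nrm_sq, nrm_sq]
    exact e.tsum_eq (fun l => ‖c l‖ₑ ^ 2)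
  exact (ENNReal.pow_right_strictMono two_ne_zero).injective h

lemma enorm_sq_eq (z : ℂ) : ‖z‖ₑ ^ 2 = ENNReal.ofReal (‖z‖ ^ 2) := by
  rw [ENNReal.ofReal_pow (norm_nonneg _), ofReal_norm]

/-- Reduction to finitely many coordinates: the right-hand side passes to coordinatewise limits and
can be attacked with scalar calculus. -/
lemma nrm_le_ofReal_iff {B : ℝ} (hB : 0 ≤ B) (c : ℤ → ℂ) :
    nrm c ≤ ENNReal.ofReal B ↔ ∀ s : Finset ℤ, ∑ l ∈ s, ‖c l‖ ^ 2 ≤ B ^ 2 := by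
  rw [← ENNReal.pow_le_pow_left_iff two_ne_zero, nrm_sq, ENNReal.tsum_eq_iSup_sum, iSup_le_iff]
  refine forall_congr' fun s => ?_
  simp only [enorm_sq_eq]
  rw [← ENNReal.ofReal_sum_of_nonneg (fun _ _ => by positivity), ← ENNReal.ofReal_pow hB,
    ENNReal.ofReal_le_ofReal_iff (by positivity)]

lemma nrm_eq_of_summable {c : ℤ → ℂ} (h : Summable fun l => ‖c l‖ ^ 2) :
    nrm c = ENNReal.ofReal (Real.sqrt (∑' l, ‖c l‖ ^ 2)) := by
  apply (ENNReal.pow_right_strictMono two_ne_zero).injective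
  show nrm c ^ 2 = _ ^ 2
  rw [nrm_sq, ← ENNReal.ofReal_pow (Real.sqrt_nonneg _),
    Real.sq_sqrt (tsum_nonneg fun _ => by positivity), ENNReal.ofReal_tsum_of_nonneg
      (fun _ => by positivity) h]
  exact tsum_congr fun l => enorm_sq_eq _

lemma summable_of_nrm_lt_top {c : ℤ → ℂ} (h : nrm c < ⊤) : Summable fun l => ‖c l‖ ^ 2 := by
  have h2 : ∑' l, ‖c l‖ₑ ^ 2 ≠ ⊤ := by
    rw [← nrm_sq]; exact ENNReal.pow_ne_top h.ne
  have := ENNReal.summable_toReal h2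
  refine this.congr fun l => ?_
  rw [enorm_sq_eq, ENNReal.toReal_ofReal (by positivity)]

lemma sqrt_tsum_le_of_nrm_le {c : ℤ → ℂ} {B : ℝ} (hB : 0 ≤ B) (h : nrm c ≤ ENNReal.ofReal B) :
    Real.sqrt (∑' l, ‖c l‖ ^ 2) ≤ B := by
  have hs := summable_of_nrm_lt_top (h.trans_lt ENNReal.ofReal_lt_top)
  rw [nrm_eq_of_summable hs] at h
  exact (ENNReal.ofReal_le_ofReal_iff hB).1 h

/-- The Cauchy–Schwarz inequality for series in `[0, ∞]`. -/
lemma tsum_mul_sq_le {ι : Type*} (f g : ι → ℝ≥0∞) :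
    (∑' i, f i * g i) ^ 2 ≤ (∑' i, f i ^ 2) * ∑' i, g i ^ 2 := by
  -- With the discrete `σ`-algebra, Hölder for the counting measure is the inequality for series.
  let _ : MeasurableSpace ι := ⊤
  have := ENNReal.lintegral_mul_le_Lp_mul_Lq (Measure.count : Measure ι)
    Real.HolderConjugate.two_two (f := f) (g := g)
    measurable_from_top.aemeasurable measurable_from_top.aemeasurable
  simp only [lintegral_count, Pi.mul_apply] at this
  have h2 : (2 : ℝ) = ((2 : ℕ) : ℝ) := by norm_num
  calc (∑' i, f i * g i) ^ 2 ≤ ((∑' i, f i ^ (2 : ℝ)) ^ (1 / 2 : ℝ) *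
        (∑' i, g i ^ (2 : ℝ)) ^ (1 / 2 : ℝ)) ^ 2 := by gcongr
    _ = _ := by
      rw [mul_pow]
      simp only [← ENNReal.rpow_natCast, ← ENNReal.rpow_mul]
      norm_num

/-! ### The symbols `μ_l` and `δ_l` -/

variable {a b : ℝ}

lemma mu_neg (l : ℤ) : mu a b (-l) = -mu a b l := by
  simp only [mu]; push_cast; ring

lemma mu_add (k l : ℤ) : mu a b (k + l) = mu a b k + mu a b l := by
  simp only [mu]; push_cast; ring

lemma delta_sq (l : ℤ) : delta a b l ^ 2 = 1 + mu a b l ^ 2 :=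
  Real.sq_sqrt (by positivity)

lemma one_le_delta (l : ℤ) : 1 ≤ delta a b l := by
  rw [delta, Real.one_le_sqrt]; nlinarith [sq_nonneg (mu a b l)]

lemma delta_pos (l : ℤ) : 0 < delta a b l := one_pos.trans_le (one_le_delta l)

lemma delta_ne (l : ℤ) : (delta a b l : ℂ) ≠ 0 := by
  exact_mod_cast (delta_pos l).ne'

lemma norm_delta (l : ℤ) : ‖(delta a b l : ℂ)‖ = delta a b l := by
  rw [Complex.norm_real, Real.norm_of_nonneg (delta_pos l).le]

lemma delta_neg (l : ℤ) : delta a b (-l) = delta a b l := by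
  rw [delta, delta, mu_neg, neg_sq]

lemma abs_mu_le_delta (l : ℤ) : |mu a b l| ≤ delta a b l := by
  rw [delta]; apply Real.le_sqrt_of_sq_le; rw [sq_abs]; linarith

lemma delta_le (l : ℤ) : delta a b l ≤ 1 + |mu a b l| := by
  rw [delta, Real.sqrt_le_left (by positivity)]
  nlinarith [abs_nonneg (mu a b l), sq_abs (mu a b l)]

/-- After squaring this is `μ_k μ_l ≤ δ_k δ_l`. Subadditivity is used both for the algebra property
and to bound the frequency of a triple interaction. -/
lemma delta_add_le (k l : ℤ) : delta a b (k + l) ≤ delta a b k + delta a b l := by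
  have hk := delta_pos (a := a) (b := b) k
  have hl := delta_pos (a := a) (b := b) l
  rw [delta, Real.sqrt_le_left (by positivity), mu_add]
  have h := mul_le_mul (abs_mu_le_delta (a := a) (b := b) k) (abs_mu_le_delta (a := a) (b := b) l)
    (abs_nonneg _) hk.le
  rw [← abs_mul] at h
  nlinarith [delta_sq (a := a) (b := b) k, delta_sq (a := a) (b := b) l, le_abs_self
    (mu a b k * mu a b l)]

lemma abs_mu (hab : a < b) (l : ℤ) : |mu a b l| = 2 * Real.pi / (b - a) * |(l : ℝ)| := by
  have : 0 < b - a := sub_pos.2 hab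
  rw [mu, abs_div, abs_mul, abs_mul, abs_of_pos this, abs_of_pos Real.pi_pos, abs_two]; ring

lemma finite_delta_le (hab : a < b) (R : ℝ) : {l : ℤ | delta a b l ≤ R}.Finite := by
  have hL : 0 < b - a := sub_pos.2 hab
  have hc : 0 < 2 * Real.pi / (b - a) := by positivity
  refine (Set.finite_Icc (-⌈R / (2 * Real.pi / (b - a))⌉) ⌈R / (2 * Real.pi / (b - a))⌉).subset
    fun l hl => ?_
  have h := (abs_mu_le_delta l).trans hl
  rw [abs_mu hab, ← le_div_iff₀' hc] at h
  rw [Set.mem_Icc, ← abs_le]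
  have : ((|l| : ℤ) : ℝ) ≤ (⌈R / (2 * Real.pi / (b - a))⌉ : ℝ) := by
    push_cast; exact h.trans (Int.le_ceil _)
  exact_mod_cast this

lemma summable_delta (hab : a < b) : Summable fun l : ℤ => 1 / delta a b l ^ 2 := by
  have hL : 0 < b - a := sub_pos.2 hab
  have h1 : Summable fun l : ℤ => ((b - a) / (2 * Real.pi)) ^ 2 * (1 / (l : ℝ) ^ 2) :=
    (Real.summable_one_div_int_pow.2 one_lt_two).mul_left _
  -- The index `l = 0` is majorised separately, since `1 / l ^ 2` has the default value `0` there.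
  refine (h1.add (summable_of_ne_finset_zero (s := {0})
    (f := fun l : ℤ => if l = 0 then (1 : ℝ) else 0) ?_)).of_nonneg_of_le
    (fun l => by have := delta_pos (a := a) (b := b) l; positivity) fun l => ?_
  · intro l hl; simp at hl; simp [hl]
  · by_cases hl : l = 0
    · subst hl; simp [delta_sq, mu]
    · have hl' : (l : ℝ) ≠ 0 := by exact_mod_cast hl
      simp only [hl, if_false, add_zero]
      rw [delta_sq, mu]
      calc 1 / (1 + (2 * Real.pi * l / (b - a)) ^ 2) ≤ 1 / ((2 * Real.pi * l / (b - a)) ^ 2) := by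
            apply one_div_le_one_div_of_le
            · have := Real.pi_ne_zero
              have := hL.ne'
              positivity
            · linarith
        _ = _ := by
            have := Real.pi_ne_zero
            field_simp

/-- The constant of the embedding of `H¹` into the absolutely convergent Fourier series. -/
noncomputable def embConst (a b : ℝ) : ℝ := Real.sqrt (∑' l : ℤ, 1 / delta a b l ^ 2)

lemma embConst_nonneg : 0 ≤ embConst a b := Real.sqrt_nonneg _

lemma tsum_ofReal_inv_delta (hab : a < b) :
    ∑' l : ℤ, ENNReal.ofReal (1 / delta a b l) ^ 2 = ENNReal.ofReal (embConst a b) ^ 2 := by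
  rw [← ENNReal.ofReal_pow embConst_nonneg, embConst,
    Real.sq_sqrt (tsum_nonneg fun _ => by positivity),
    ENNReal.ofReal_tsum_of_nonneg (fun _ => by positivity) (summable_delta hab)]
  refine tsum_congr fun l => ?_
  rw [← ENNReal.ofReal_pow (by have := delta_pos (a := a) (b := b) l; positivity), div_pow, one_pow]

/-- Cauchy–Schwarz for `c = δ⁻¹ · (δ c)`: in one dimension `δ⁻¹` is square summable, so `H¹` embeds
into the absolutely convergent Fourier series. -/
lemma tsum_enorm_le (hab : a < b) (c : ℤ → ℂ) :
    ∑' l, ‖c l‖ₑ ≤ ENNReal.ofReal (embConst a b) * nrm (fun l => (delta a b l : ℂ) * c l) := by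
  rw [← ENNReal.pow_le_pow_left_iff two_ne_zero, mul_pow, nrm_sq, ← tsum_ofReal_inv_delta hab]
  refine le_trans (le_of_eq ?_) (tsum_mul_sq_le _ _)
  congr 1
  refine tsum_congr fun l => ?_
  rw [← ofReal_norm, ← ofReal_norm, ← ENNReal.ofReal_mul
    (by have := delta_pos (a := a) (b := b) l; positivity), norm_mul, norm_delta]
  have := (delta_pos (a := a) (b := b) l).ne'
  congr 1; field_simp

lemma summable_norm_of_nrm (hab : a < b) {c : ℤ → ℂ} {K : ℝ}
    (h : nrm (fun l => (delta a b l : ℂ) * c l) ≤ ENNReal.ofReal K) :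
    Summable fun l => ‖c l‖ := by
  rw [← tsum_enorm_ne_top_iff_summable_norm]
  exact ((tsum_enorm_le hab c).trans_lt (ENNReal.mul_lt_top ENNReal.ofReal_lt_top
    (h.trans_lt ENNReal.ofReal_lt_top))).ne

lemma tsum_norm_le_of_nrm (hab : a < b) {c : ℤ → ℂ} {K : ℝ} (hK : 0 ≤ K)
    (h : nrm (fun l => (delta a b l : ℂ) * c l) ≤ ENNReal.ofReal K) :
    ∑' l, ‖c l‖ ≤ embConst a b * K := by
  have hs := summable_norm_of_nrm hab h
  have h1 := tsum_enorm_le hab c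
  have h2 : ∑' l, ‖c l‖ₑ = ENNReal.ofReal (∑' l, ‖c l‖) := by
    rw [ENNReal.ofReal_tsum_of_nonneg (fun _ => norm_nonneg _) hs]
    exact tsum_congr fun l => (ofReal_norm _).symm
  rw [h2] at h1
  have h3 := h1.trans (mul_le_mul_right h _)
  rw [← ENNReal.ofReal_mul embConst_nonneg] at h3
  exact (ENNReal.ofReal_le_ofReal_iff (mul_nonneg embConst_nonneg hK)).1 h3

end SineGordon

/-! ### Fourier analysis on a period. -/

namespace SineGordon

open MeasureTheory Filter Topology
open scoped ENNReal NNReal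

variable {a b : ℝ}

/-! ### Fourier modes and Fourier coefficients -/

lemma norm_mode (l : ℤ) (x : ℝ) : ‖mode a b l x‖ = 1 := by
  rw [mode, mul_comm, Complex.norm_exp_ofReal_mul_I]

lemma mode_zero (x : ℝ) : mode a b 0 x = 1 := by simp [mode, mu]

lemma mode_add (k l : ℤ) (x : ℝ) : mode a b (k + l) x = mode a b k x * mode a b l x := by
  rw [mode, mode, mode, ← Complex.exp_add, mu_add]; congr 1; push_cast; ring

lemma mode_neg (l : ℤ) (x : ℝ) :
    mode a b (-l) x = Complex.exp (-(Complex.I * ((mu a b l * (x - a) : ℝ) : ℂ))) := by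
  rw [mode, mu_neg]; congr 1; push_cast; ring

lemma conj_mode (l : ℤ) (x : ℝ) : (starRingEnd ℂ) (mode a b l x) = mode a b (-l) x := by
  rw [mode_neg, mode, ← Complex.exp_conj]; simp

@[fun_prop]
lemma continuous_mode (l : ℤ) : Continuous (mode a b l) := by
  unfold mode; fun_prop

lemma fourierCoef_eq (u : ℝ → ℂ) (l : ℤ) :
    fourierCoef a b u l = (1 / ((b - a : ℝ) : ℂ)) * ∫ x in a..b, u x * mode a b (-l) x := by
  simp only [fourierCoef, mode_neg]

lemma integral_mode (hab : a < b) (l : ℤ) :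
    ∫ x in a..b, mode a b l x = if l = 0 then ((b - a : ℝ) : ℂ) else 0 := by
  split_ifs with h
  · subst h; simp [mode_zero]
  · have hL : (b : ℂ) - a ≠ 0 := by
      rw [← Complex.ofReal_sub]; exact_mod_cast (sub_pos.2 hab).ne'
    have hl : (l : ℂ) ≠ 0 := by exact_mod_cast h
    have hc : Complex.I * (mu a b l : ℂ) ≠ 0 := by
      simp only [mu]; push_cast
      exact mul_ne_zero Complex.I_ne_zero (div_ne_zero (mul_ne_zero (mul_ne_zero two_ne_zero
        (Complex.ofReal_ne_zero.2 Real.pi_ne_zero)) hl) hL)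
    have hm : ∀ x : ℝ, mode a b l x = Complex.exp (-(Complex.I * (mu a b l) * a)) *
        Complex.exp (Complex.I * (mu a b l) * x) := by
      intro x; rw [mode, ← Complex.exp_add]; congr 1; push_cast; ring
    simp only [hm]
    rw [intervalIntegral.integral_const_mul, integral_exp_mul_complex hc]
    have : Complex.exp (Complex.I * (mu a b l) * b) = Complex.exp (Complex.I * (mu a b l) * a) := by
      rw [Complex.exp_eq_exp_iff_exists_int]
      refine ⟨l, ?_⟩
      simp only [mu]; push_cast; field_simp; ring
    rw [this]; simp

lemma fourierCoef_mode (hab : a < b) (k l : ℤ) :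
    fourierCoef a b (mode a b k) l = if k = l then 1 else 0 := by
  rw [fourierCoef_eq]
  simp only [← mode_add]
  rw [integral_mode hab]
  have hL : ((b - a : ℝ) : ℂ) ≠ 0 := by exact_mod_cast (sub_pos.2 hab).ne'
  by_cases h : k = l
  · subst h; simp only [add_neg_cancel, if_true]; field_simp
  · rw [if_neg h, if_neg (by omega)]; simp

lemma fourierCoef_congr_ae (hab : a < b) {u v : ℝ → ℂ}
    (h : u =ᵐ[volume.restrict (Set.Ioc a b)] v) : fourierCoef a b u = fourierCoef a b v := by
  funext l
  rw [fourierCoef_eq, fourierCoef_eq]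
  congr 1
  apply intervalIntegral.integral_congr_ae_restrict
  rw [Set.uIoc_of_le hab.le]
  filter_upwards [h] with x hx
  rw [hx]

lemma MemLp.intervalIntegrable_two (hab : a < b) {u : ℝ → ℂ}
    (hu : MemLp u 2 (volume.restrict (Set.Ioc a b))) : IntervalIntegrable u volume a b := by
  rw [intervalIntegrable_iff_integrableOn_Ioc_of_le hab.le]
  exact hu.integrable (by norm_num)

lemma IntervalIntegrable.mul_mode {u : ℝ → ℂ} (hu : IntervalIntegrable u volume a b) (l : ℤ) :
    IntervalIntegrable (fun x => u x * mode a b l x) volume a b :=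
  hu.mul_continuousOn (continuous_mode l).continuousOn

lemma fourierCoef_sub {u v : ℝ → ℂ} (hu : IntervalIntegrable u volume a b)
    (hv : IntervalIntegrable v volume a b) (l : ℤ) :
    fourierCoef a b (fun x => u x - v x) l = fourierCoef a b u l - fourierCoef a b v l := by
  simp only [fourierCoef_eq, sub_mul]
  rw [intervalIntegral.integral_sub (IntervalIntegrable.mul_mode hu _)
    (IntervalIntegrable.mul_mode hv _), mul_sub]

lemma fourierCoef_const_mul (z : ℂ) (u : ℝ → ℂ) (l : ℤ) :
    fourierCoef a b (fun x => z * u x) l = z * fourierCoef a b u l := by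
  simp only [fourierCoef_eq, mul_assoc]
  rw [intervalIntegral.integral_const_mul]; ring

lemma fourierCoef_sum {ι : Type*} (s : Finset ι) {u : ι → ℝ → ℂ}
    (hu : ∀ i ∈ s, IntervalIntegrable (u i) volume a b) (l : ℤ) :
    fourierCoef a b (fun x => ∑ i ∈ s, u i x) l = ∑ i ∈ s, fourierCoef a b (u i) l := by
  simp only [fourierCoef_eq, Finset.sum_mul]
  rw [intervalIntegral.integral_finsetSum fun i hi => IntervalIntegrable.mul_mode (hu i hi) _,
    Finset.mul_sum]

lemma fourierCoef_conj (u : ℝ → ℂ) (l : ℤ) :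
    fourierCoef a b (fun x => (starRingEnd ℂ) (u x)) l =
      (starRingEnd ℂ) (fourierCoef a b u (-l)) := by
  simp only [fourierCoef_eq, map_mul, map_div₀, map_one, Complex.conj_ofReal, neg_neg]
  rw [intervalIntegral.intervalIntegral_eq_integral_uIoc,
    intervalIntegral.intervalIntegral_eq_integral_uIoc]
  have : ∀ x, (starRingEnd ℂ) (u x) * mode a b (-l) x =
      (starRingEnd ℂ) (u x * mode a b l x) := by
    intro x; rw [map_mul, conj_mode]
  simp only [this]
  rw [integral_conj]
  split_ifs <;> simp

lemma fourierCoef_ofReal_neg (u : ℝ → ℝ) (l : ℤ) :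
    fourierCoef a b (fun x => (u x : ℂ)) (-l) =
      (starRingEnd ℂ) (fourierCoef a b (fun x => (u x : ℂ)) l) := by
  have := fourierCoef_conj (a := a) (b := b) (fun x => (u x : ℂ)) (-l)
  simpa using this

/-- Modes based at `a` differ from those of `fourierCoeffOn` by a constant of modulus one, so
Parseval's identity carries over. -/
lemma norm_fourierCoef (hab : a < b) (u : ℝ → ℂ) (l : ℤ) :
    ‖fourierCoef a b u l‖ = ‖fourierCoeffOn hab u l‖ := by
  have hL : (b : ℂ) - a ≠ 0 := by
    rw [← Complex.ofReal_sub]; exact_mod_cast (sub_pos.2 hab).ne'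
  have h : ∀ x : ℝ, u x * mode a b (-l) x =
      mode a b (-l) 0 * (fourier (-l) (x : AddCircle (b - a)) • u x) := by
    intro x
    rw [fourier_coe_apply, smul_eq_mul, mode, mode, mul_comm (u x), ← mul_assoc,
      ← Complex.exp_add]
    congr 2
    simp only [mu]; push_cast; field_simp; ring
  rw [fourierCoef_eq, fourierCoeffOn_eq_integral]
  simp only [h]
  rw [intervalIntegral.integral_const_mul, norm_mul, norm_mul, norm_mode, one_mul, norm_smul]
  congr 1
  rw [norm_div, norm_div, Complex.norm_real, norm_one, norm_one]

lemma hasSum_sq_fourierCoef (hab : a < b) {u : ℝ → ℂ}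
    (hu : MemLp u 2 (volume.restrict (Set.Ioc a b))) :
    HasSum (fun l => ‖fourierCoef a b u l‖ ^ 2) ((b - a)⁻¹ * ∫ x in a..b, ‖u x‖ ^ 2) := by
  simpa only [norm_fourierCoef hab, smul_eq_mul] using hasSum_sq_fourierCoeffOn hab hu

lemma nrm_fourierCoef (hab : a < b) {u : ℝ → ℂ}
    (hu : MemLp u 2 (volume.restrict (Set.Ioc a b))) :
    nrm (fourierCoef a b u) =
      ENNReal.ofReal (Real.sqrt ((b - a)⁻¹ * ∫ x in a..b, ‖u x‖ ^ 2)) := by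
  have h := hasSum_sq_fourierCoef hab hu
  rw [nrm_eq_of_summable h.summable, h.tsum_eq]

lemma memLp_of_continuousOn {u : ℝ → ℂ} (hu : ContinuousOn u (Set.Icc a b)) :
    MemLp u 2 (volume.restrict (Set.Ioc a b)) := by
  obtain ⟨C, hC⟩ := isCompact_Icc.exists_bound_of_continuousOn hu
  refine MemLp.of_bound ((hu.mono Set.Ioc_subset_Icc_self).aestronglyMeasurable
    measurableSet_Ioc) C ?_
  exact (ae_restrict_mem measurableSet_Ioc).mono fun x hx => hC x (Set.Ioc_subset_Icc_self hx)

/-- Comparison of the `L²` norms of two functions through their Fourier coefficients. -/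
lemma nrm_fourierCoef_le (hab : a < b) {u v : ℝ → ℂ} {B : ℝ} (hB : 0 ≤ B)
    (hu : MemLp u 2 (volume.restrict (Set.Ioc a b)))
    (hv : MemLp v 2 (volume.restrict (Set.Ioc a b)))
    (h : ∀ x ∈ Set.Icc a b, ‖u x‖ ≤ B * ‖v x‖) :
    nrm (fourierCoef a b u) ≤ ENNReal.ofReal B * nrm (fourierCoef a b v) := by
  have hL : 0 < b - a := sub_pos.2 hab
  rw [nrm_fourierCoef hab hu, nrm_fourierCoef hab hv, ← ENNReal.ofReal_mul hB]
  apply ENNReal.ofReal_le_ofReal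
  have hi : ∀ {f : ℝ → ℂ}, MemLp f 2 (volume.restrict (Set.Ioc a b)) →
      IntervalIntegrable (fun x => ‖f x‖ ^ 2) volume a b := fun hf => by
    rw [intervalIntegrable_iff_integrableOn_Ioc_of_le hab.le]
    exact hf.integrable_norm_pow (by norm_num)
  rw [Real.sqrt_le_left (by positivity), mul_pow, Real.sq_sqrt]
  · have : ∫ x in a..b, ‖u x‖ ^ 2 ≤ ∫ x in a..b, B ^ 2 * ‖v x‖ ^ 2 := by
      apply intervalIntegral.integral_mono_on hab.le (hi hu) ((hi hv).const_mul _)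
      intro x hx
      rw [← mul_pow]
      exact pow_le_pow_left₀ (norm_nonneg _) (h x hx) 2
    rw [intervalIntegral.integral_const_mul] at this
    calc _ ≤ (b - a)⁻¹ * (B ^ 2 * ∫ x in a..b, ‖v x‖ ^ 2) := by gcongr
      _ = _ := by ring
  · exact mul_nonneg (by positivity) (intervalIntegral.integral_nonneg hab.le
      fun _ _ => by positivity)

/-- Comparison with the constant function `1`, whose norm is `1` because the coefficients are
averages over the period. -/
lemma nrm_fourierCoef_le_of_bound (hab : a < b) {u : ℝ → ℂ} {B : ℝ} (hB : 0 ≤ B)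
    (hu : MemLp u 2 (volume.restrict (Set.Ioc a b)))
    (h : ∀ x ∈ Set.Icc a b, ‖u x‖ ≤ B) :
    nrm (fourierCoef a b u) ≤ ENNReal.ofReal B := by
  have h1 : MemLp (fun _ : ℝ => (1 : ℂ)) 2 (volume.restrict (Set.Ioc a b)) :=
    memLp_of_continuousOn continuousOn_const
  refine (nrm_fourierCoef_le hab hB hu h1 (by simpa using h)).trans ?_
  rw [nrm_fourierCoef hab h1]
  have hL : b - a ≠ 0 := (sub_pos.2 hab).ne'
  simp [hL]

/-! ### Absolutely convergent Fourier series -/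

/-- The function with Fourier coefficients `c`. -/
noncomputable def series (a b : ℝ) (c : ℤ → ℂ) (x : ℝ) : ℂ := ∑' l, c l * mode a b l x

lemma norm_mul_mode (z : ℂ) (l : ℤ) (x : ℝ) : ‖z * mode a b l x‖ = ‖z‖ := by
  rw [norm_mul, norm_mode, mul_one]

lemma summable_mul_mode {c : ℤ → ℂ} (hc : Summable fun l => ‖c l‖) (x : ℝ) :
    Summable fun l => c l * mode a b l x :=
  Summable.of_norm (by simpa only [norm_mul_mode] using hc)

lemma continuous_series {c : ℤ → ℂ} (hc : Summable fun l => ‖c l‖) :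
    Continuous (series a b c) :=
  continuous_tsum (fun l => continuous_const.mul (continuous_mode l)) hc
    fun _ _ => (norm_mul_mode _ _ _).le

lemma norm_series_le {c : ℤ → ℂ} (hc : Summable fun l => ‖c l‖) (x : ℝ) :
    ‖series a b c x‖ ≤ ∑' l, ‖c l‖ := by
  refine (norm_tsum_le_tsum_norm (by simpa only [norm_mul_mode] using hc)).trans (le_of_eq ?_)
  simp only [norm_mul_mode]

lemma hasSum_fourierCoef {f : ℕ → ℝ → ℂ} (hf : ∀ k, Continuous (f k)) {B : ℕ → ℝ}
    (hB : Summable B) (hfB : ∀ k x, ‖f k x‖ ≤ B k) (l : ℤ) :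
    HasSum (fun k => fourierCoef a b (f k) l) (fourierCoef a b (fun x => ∑' k, f k x) l) := by
  simp only [fourierCoef_eq]
  apply HasSum.mul_left
  have h1 : ∀ k x, ‖f k x * mode a b (-l) x‖ ≤ B k := fun k x => by
    rw [norm_mul_mode]; exact hfB k x
  refine intervalIntegral.hasSum_integral_of_dominated_convergence (fun k _ => B k)
    (fun k => ((hf k).mul (continuous_mode _)).aestronglyMeasurable)
    (fun k => ae_of_all _ fun x _ => h1 k x) (ae_of_all _ fun _ _ => hB) (by simp) ?_
  refine ae_of_all _ fun x _ => ?_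
  exact (Summable.of_norm_bounded hB fun k => hfB k x).hasSum.mul_right _

lemma fourierCoef_series (hab : a < b) {c : ℤ → ℂ} (hc : Summable fun l => ‖c l‖) :
    fourierCoef a b (series a b c) = c := by
  funext l
  have h : HasSum (fun k => fourierCoef a b (fun x => c k * mode a b k x) l)
      (fourierCoef a b (series a b c) l) := by
    simp only [fourierCoef_eq]
    apply HasSum.mul_left
    refine intervalIntegral.hasSum_integral_of_dominated_convergence (fun k _ => ‖c k‖)
      (fun k => ((continuous_const.mul (continuous_mode _)).mul
        (continuous_mode _)).aestronglyMeasurable)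
      (fun k => ae_of_all _ fun x _ => by rw [norm_mul_mode, norm_mul_mode])
      (ae_of_all _ fun x _ => hc) (by simp) ?_
    exact ae_of_all _ fun x _ => (summable_mul_mode hc x).hasSum.mul_right _
  simp only [fourierCoef_const_mul, fourierCoef_mode hab] at h
  have h2 : HasSum (fun k => c k * if k = l then 1 else 0) (c l) := by
    convert hasSum_ite_eq l (c l) using 2 with k
    split_ifs with hk <;> simp [hk]
  exact h.unique h2

lemma ae_eq_of_fourierCoef_eq (hab : a < b) {u v : ℝ → ℂ}
    (hu : MemLp u 2 (volume.restrict (Set.Ioc a b)))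
    (hv : MemLp v 2 (volume.restrict (Set.Ioc a b)))
    (h : fourierCoef a b u = fourierCoef a b v) : u =ᵐ[volume.restrict (Set.Ioc a b)] v := by
  have hL : 0 < b - a := sub_pos.2 hab
  have huv := hu.sub hv
  have h1 := hasSum_sq_fourierCoef hab huv
  have h0 : ∀ l, fourierCoef a b (u - v) l = 0 := fun l => by
    have := fourierCoef_sub (MemLp.intervalIntegrable_two hab hu)
      (MemLp.intervalIntegrable_two hab hv) l
    rw [h, sub_self] at this
    exact this
  simp only [h0, norm_zero] at h1
  have hz : HasSum (fun _ : ℤ => (0 : ℝ) ^ 2) 0 := by simp [hasSum_zero]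
  have h2 := h1.unique hz
  have h3 : ∫ x in a..b, ‖(u - v) x‖ ^ 2 = 0 := by
    rcases mul_eq_zero.1 h2 with h | h
    · exact absurd h (inv_ne_zero hL.ne')
    · exact h
  rw [intervalIntegral.integral_of_le hab.le,
    integral_eq_zero_iff_of_nonneg (fun _ => by positivity)
      (huv.integrable_norm_pow (by norm_num))] at h3
  filter_upwards [h3] with x hx
  simpa [sub_eq_zero] using hx

lemma ae_eq_series (hab : a < b) {u : ℝ → ℂ}
    (hu : MemLp u 2 (volume.restrict (Set.Ioc a b)))
    (hs : Summable fun l => ‖fourierCoef a b u l‖) :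
    u =ᵐ[volume.restrict (Set.Ioc a b)] series a b (fourierCoef a b u) :=
  ae_eq_of_fourierCoef_eq hab hu (memLp_of_continuousOn (continuous_series hs).continuousOn)
    (fourierCoef_series hab hs).symm

/-- Equality almost everywhere is not enough for grid values; two continuous functions that agree
almost everywhere agree at every point of the closed interval. -/
lemma eq_series_of_continuousOn (hab : a < b) {u : ℝ → ℂ} (hu : ContinuousOn u (Set.Icc a b))
    (hs : Summable fun l => ‖fourierCoef a b u l‖) :
    ∀ x ∈ Set.Icc a b, u x = series a b (fourierCoef a b u) x := by
  have h := ae_eq_series hab (memLp_of_continuousOn hu) hs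
  rw [Measure.restrict_congr_set Ioc_ae_eq_Icc] at h
  exact Measure.eqOn_Icc_of_ae_eq volume hab.ne h hu (continuous_series hs).continuousOn

/-- The convolution of two sequences. -/
noncomputable def conv (c d : ℤ → ℂ) (l : ℤ) : ℂ := ∑' k, c k * d (l - k)

lemma series_mul {c d : ℤ → ℂ} (hc : Summable fun l => ‖c l‖)
    (hd : Summable fun l => ‖d l‖) :
    (Summable fun l => ‖conv c d l‖) ∧
      ∀ x, series a b c x * series a b d x = series a b (conv c d) x := by
  -- The reindexing `(l, k) ↦ (k, l - k)` groups the double series by total frequency.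
  let e : ℤ × ℤ ≃ ℤ × ℤ :=
    { toFun := fun p => (p.2, p.1 - p.2)
      invFun := fun p => (p.1 + p.2, p.1)
      left_inv := fun p => by simp
      right_inv := fun p => by simp }
  have h1 : Summable fun p : ℤ × ℤ => ‖c p.1 * d p.2‖ := by
    simpa only [norm_mul] using hc.mul_of_nonneg hd (fun _ => norm_nonneg _) fun _ => norm_nonneg _
  have h2 : Summable fun p : ℤ × ℤ => ‖c p.2 * d (p.1 - p.2)‖ := e.summable_iff.2 h1
  refine ⟨?_, fun x => ?_⟩
  · refine (h2.prod).of_nonneg_of_le (fun _ => norm_nonneg _) fun l => ?_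
    exact norm_tsum_le_tsum_norm (h2.prod_factor l)
  · have hc' : Summable fun l => ‖c l * mode a b l x‖ := by simpa only [norm_mul_mode] using hc
    have hd' : Summable fun l => ‖d l * mode a b l x‖ := by simpa only [norm_mul_mode] using hd
    have h3 : Summable fun p : ℤ × ℤ => (c p.2 * d (p.1 - p.2)) * mode a b p.1 x :=
      Summable.of_norm (by simpa only [norm_mul_mode] using h2)
    rw [series, series, tsum_mul_tsum_of_summable_norm hc' hd', ← e.tsum_eq, series]
    have h4 : ∀ p : ℤ × ℤ, c (e p).1 * mode a b (e p).1 x * (d (e p).2 * mode a b (e p).2 x) =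
        (c p.2 * d (p.1 - p.2)) * mode a b p.1 x := fun p => by
      have : mode a b p.1 x = mode a b p.2 x * mode a b (p.1 - p.2) x := by
        rw [← mode_add]; congr 1; ring
      rw [this]
      simp only [e, Equiv.coe_fn_mk]
      ring
    simp only [h4]
    rw [h3.tsum_prod]
    refine tsum_congr fun l => ?_
    simp only [conv]
    rw [tsum_mul_right]

lemma series_conj_symm {c : ℤ → ℂ} (hs : ∀ l, c (-l) = (starRingEnd ℂ) (c l)) (x : ℝ) :
    (starRingEnd ℂ) (series a b c x) = series a b c x := by
  rw [series, Complex.conj_tsum, ← (Equiv.neg ℤ).tsum_eq]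
  refine tsum_congr fun l => ?_
  rw [map_mul, conj_mode, Equiv.neg_apply, neg_neg, hs, Complex.conj_conj]

lemma series_eq_ofReal_re {c : ℤ → ℂ} (hs : ∀ l, c (-l) = (starRingEnd ℂ) (c l)) (x : ℝ) :
    ((series a b c x).re : ℂ) = series a b c x :=
  Complex.conj_eq_iff_re.1 (series_conj_symm hs x)

end SineGordon

/-! ### Nonlinear estimates in `H^s`. -/

namespace SineGordon

open MeasureTheory Filter Topology
open scoped ENNReal NNReal

variable {a b : ℝ}

/-! ### The algebra property of `H^s`, `s ≥ 1`, and the nonlinearity -/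

/-- Since `δ_l` is at most twice the larger of `δ_k` and `δ_{l-k}`, the power of the smaller one is
to spare. Giving away all but one factor of it leaves the weight `1/δ`, square summable in `k`
uniformly in `l`. -/
lemma delta_pow_le {s : ℕ} (hs : 1 ≤ s) (k l : ℤ) :
    delta a b l ^ s ≤ 2 ^ s * (1 / delta a b (l - k) + 1 / delta a b k) *
      (delta a b k ^ s * delta a b (l - k) ^ s) := by
  have hx := one_le_delta (a := a) (b := b) k
  have hy := one_le_delta (a := a) (b := b) (l - k)
  have hl : delta a b l ≤ delta a b k + delta a b (l - k) := by
    have := delta_add_le (a := a) (b := b) k (l - k)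
    rwa [add_sub_cancel] at this
  have hl0 := delta_pos (a := a) (b := b) l
  set x := delta a b k
  set y := delta a b (l - k)
  obtain ⟨r, rfl⟩ : ∃ r, s = r + 1 := ⟨s - 1, by omega⟩
  have hx0 : 0 < x := by linarith
  have hy0 : 0 < y := by linarith
  have h1 : delta a b l ^ (r + 1) ≤ (2 * max x y) ^ (r + 1) := by
    apply pow_le_pow_left₀ hl0.le
    have := le_max_left x y
    have := le_max_right x y
    linarith
  refine h1.trans ?_
  rw [mul_pow, mul_assoc]
  refine mul_le_mul_of_nonneg_left ?_ (by positivity)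
  have e : (1 / y + 1 / x) * (x ^ (r + 1) * y ^ (r + 1)) =
      x ^ (r + 1) * y ^ r + x ^ r * y ^ (r + 1) := by
    field_simp
    ring
  rw [e]
  have hxr : 1 ≤ x ^ r := one_le_pow₀ hx
  have hyr : 1 ≤ y ^ r := one_le_pow₀ hy
  have hx1 : 0 < x ^ (r + 1) := by positivity
  have hy1 : 0 < y ^ (r + 1) := by positivity
  rcases max_cases x y with ⟨h, _⟩ | ⟨h, _⟩ <;> rw [h] <;> nlinarith

/-- The constant of the algebra property of `H^s`. -/
noncomputable def algConst (a b : ℝ) (s : ℕ) : ℝ := 2 ^ (s + 1) * embConst a b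

lemma algConst_nonneg (s : ℕ) : 0 ≤ algConst a b s := mul_nonneg (by positivity) embConst_nonneg

lemma tsum_weight_le (hab : a < b) (s : ℕ) (l : ℤ) :
    ∑' k : ℤ, ENNReal.ofReal (2 ^ s * (1 / delta a b (l - k) + 1 / delta a b k)) ^ 2 ≤
      ENNReal.ofReal (algConst a b s) ^ 2 := by
  have hp : ∀ k : ℤ, 0 < 1 / delta a b k := fun k => one_div_pos.2 (delta_pos k)
  have h : ∀ k : ℤ, ENNReal.ofReal (2 ^ s * (1 / delta a b (l - k) + 1 / delta a b k)) ^ 2 ≤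
      ENNReal.ofReal (2 * (2 ^ s) ^ 2) * (ENNReal.ofReal (1 / delta a b (l - k)) ^ 2 +
        ENNReal.ofReal (1 / delta a b k) ^ 2) := fun k => by
    have h1 := hp k
    have h2 := hp (l - k)
    rw [← ENNReal.ofReal_pow (by positivity), ← ENNReal.ofReal_pow h2.le,
      ← ENNReal.ofReal_pow h1.le, ← ENNReal.ofReal_add (by positivity) (by positivity),
      ← ENNReal.ofReal_mul (by positivity)]
    apply ENNReal.ofReal_le_ofReal
    rw [mul_pow]
    have := add_sq_le (a := 1 / delta a b (l - k)) (b := 1 / delta a b k)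
    have h4 : (0 : ℝ) < (2 ^ s) ^ 2 := by positivity
    nlinarith
  refine (ENNReal.tsum_le_tsum h).trans ?_
  rw [ENNReal.tsum_mul_left, ENNReal.tsum_add, tsum_ofReal_inv_delta hab]
  have e := (Equiv.subLeft l).tsum_eq fun k : ℤ => ENNReal.ofReal (1 / delta a b k) ^ 2
  simp only [Equiv.subLeft_apply] at e
  rw [e, tsum_ofReal_inv_delta hab, ← ENNReal.ofReal_pow embConst_nonneg,
    ← ENNReal.ofReal_add (by positivity) (by positivity), ← ENNReal.ofReal_mul (by positivity),
    ← ENNReal.ofReal_pow (algConst_nonneg s)]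
  apply ENNReal.ofReal_le_ofReal
  rw [algConst]
  apply le_of_eq
  ring

lemma norm_delta_pow (s : ℕ) (l : ℤ) : ‖(delta a b l : ℂ) ^ s‖ = delta a b l ^ s := by
  rw [norm_pow, norm_delta]

/-- Cauchy–Schwarz in `k` against the weight of `delta_pow_le`, then interchange of the sums over
`l` and `k`. -/
lemma nrm_conv_le (hab : a < b) {s : ℕ} (hs : 1 ≤ s) (c d : ℤ → ℂ) :
    nrm (fun l => (delta a b l : ℂ) ^ s * conv c d l) ≤
      ENNReal.ofReal (algConst a b s) * (nrm (fun l => (delta a b l : ℂ) ^ s * c l) *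
        nrm (fun l => (delta a b l : ℂ) ^ s * d l)) := by
  rw [← ENNReal.pow_le_pow_left_iff two_ne_zero, mul_pow, mul_pow, nrm_sq, nrm_sq, nrm_sq]
  set X : ℤ → ℝ≥0∞ := fun l => ‖(delta a b l : ℂ) ^ s * c l‖ₑ with hX
  set Y : ℤ → ℝ≥0∞ := fun l => ‖(delta a b l : ℂ) ^ s * d l‖ₑ with hY
  have hpt : ∀ l : ℤ, ‖(delta a b l : ℂ) ^ s * conv c d l‖ₑ ^ 2 ≤
      ENNReal.ofReal (algConst a b s) ^ 2 * ∑' k, (X k * Y (l - k)) ^ 2 := fun l => by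
    have h1 : ‖(delta a b l : ℂ) ^ s * conv c d l‖ₑ ≤
        ∑' k, ENNReal.ofReal (2 ^ s * (1 / delta a b (l - k) + 1 / delta a b k)) *
          (X k * Y (l - k)) := by
      rw [enorm_mul]
      refine (mul_le_mul_right enorm_tsum_le_tsum_enorm _).trans ?_
      rw [← ENNReal.tsum_mul_left]
      refine ENNReal.tsum_le_tsum fun k => ?_
      have hk := delta_pos (a := a) (b := b) k
      have hlk := delta_pos (a := a) (b := b) (l - k)
      simp only [hX, hY, ← ofReal_norm, norm_mul, norm_delta_pow]
      rw [← ENNReal.ofReal_mul (by have := delta_pos (a := a) (b := b) l; positivity),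
        ← ENNReal.ofReal_mul (by positivity), ← ENNReal.ofReal_mul (by positivity)]
      apply ENNReal.ofReal_le_ofReal
      have := mul_le_mul_of_nonneg_right (delta_pow_le (a := a) (b := b) hs k l)
        (mul_nonneg (norm_nonneg (c k)) (norm_nonneg (d (l - k))))
      refine this.trans (le_of_eq ?_)
      ring
    calc _ ≤ (∑' k, ENNReal.ofReal (2 ^ s * (1 / delta a b (l - k) + 1 / delta a b k)) *
          (X k * Y (l - k))) ^ 2 := by gcongr
      _ ≤ _ := tsum_mul_sq_le _ _
      _ ≤ _ := by gcongr; exact tsum_weight_le hab s l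
  refine (ENNReal.tsum_le_tsum hpt).trans ?_
  rw [ENNReal.tsum_mul_left, ENNReal.tsum_comm]
  refine mul_le_mul_right (le_of_eq ?_) _
  rw [← ENNReal.tsum_mul_right]
  refine tsum_congr fun k => ?_
  simp only [mul_pow]
  rw [ENNReal.tsum_mul_left]
  congr 1
  exact (Equiv.subRight k).tsum_eq fun l => Y l ^ 2

/-- The coefficients of the powers of a Fourier series: `convPow c n` belongs to the power
`n + 1`. -/
noncomputable def convPow (c : ℤ → ℂ) : ℕ → ℤ → ℂ
  | 0 => c
  | n + 1 => conv c (convPow c n)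

lemma series_pow {c : ℤ → ℂ} (hc : Summable fun l => ‖c l‖) (n : ℕ) :
    (Summable fun l => ‖convPow c n l‖) ∧
      ∀ x, series a b c x ^ (n + 1) = series a b (convPow c n) x := by
  induction n with
  | zero => exact ⟨hc, fun x => by simp [convPow]⟩
  | succ n ih =>
    have := series_mul (a := a) (b := b) hc ih.1
    refine ⟨this.1, fun x => ?_⟩
    rw [pow_succ', ih.2, this.2, convPow]

lemma nrm_convPow_le (hab : a < b) {s : ℕ} (hs : 1 ≤ s) {c : ℤ → ℂ} {K : ℝ} (hK : 0 ≤ K)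
    (h : nrm (fun l => (delta a b l : ℂ) ^ s * c l) ≤ ENNReal.ofReal K) (n : ℕ) :
    nrm (fun l => (delta a b l : ℂ) ^ s * convPow c n l) ≤
      ENNReal.ofReal ((algConst a b s * K) ^ n * K) := by
  have hA := algConst_nonneg (a := a) (b := b) s
  induction n with
  | zero => simpa [convPow] using h
  | succ n ih =>
    refine (nrm_conv_le hab hs c (convPow c n)).trans ?_
    refine (mul_le_mul_right (mul_le_mul' h ih) _).trans (le_of_eq ?_)
    rw [← ENNReal.ofReal_mul hK, ← ENNReal.ofReal_mul hA]
    congr 1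
    ring

/-- A Fatou property: bounds on the partial sums survive coordinatewise convergence, so no
convergence in `ℓ²` has to be shown. -/
lemma nrm_le_of_hasSum {f : ℕ → ℤ → ℂ} {c : ℤ → ℂ} (h : ∀ l, HasSum (fun n => f n l) (c l))
    {B : ℝ} (hB : 0 ≤ B) (hf : ∀ N, nrm (fun l => ∑ n ∈ Finset.range N, f n l) ≤
      ENNReal.ofReal B) : nrm c ≤ ENNReal.ofReal B := by
  rw [nrm_le_ofReal_iff hB]
  intro s
  have ht : Tendsto (fun N => ∑ l ∈ s, ‖∑ n ∈ Finset.range N, f n l‖ ^ 2) atTop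
      (𝓝 (∑ l ∈ s, ‖c l‖ ^ 2)) :=
    tendsto_finsetSum _ fun l _ => ((h l).tendsto_sum_nat.norm).pow 2
  exact le_of_tendsto' ht fun N => (nrm_le_ofReal_iff hB _).1 (hf N) s

lemma delta_mul_le_pow {s : ℕ} (hs : 1 ≤ s) {c : ℤ → ℂ} {K : ℝ≥0∞}
    (h : nrm (fun l => (delta a b l : ℂ) ^ s * c l) ≤ K) :
    nrm (fun l => (delta a b l : ℂ) * c l) ≤ K := by
  refine (nrm_mono fun l => ?_).trans h
  rw [norm_mul, norm_mul, norm_delta, norm_delta_pow]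
  exact mul_le_mul_of_nonneg_right (le_self_pow₀ (one_le_delta l) (by omega)) (norm_nonneg _)

lemma nrm_le_of_pow {s : ℕ} {c : ℤ → ℂ} {K : ℝ≥0∞}
    (h : nrm (fun l => (delta a b l : ℂ) ^ s * c l) ≤ K) : nrm c ≤ K := by
  refine (nrm_mono fun l => ?_).trans h
  rw [norm_mul, norm_delta_pow]
  exact le_mul_of_one_le_left (norm_nonneg _) (one_le_pow₀ (one_le_delta l))

/-- The constant in the composition estimate for odd power series. -/
noncomputable def compConst (a b : ℝ) (s : ℕ) (K : ℝ) : ℝ :=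
  Real.exp ((algConst a b s * K) ^ 2) * K

lemma compConst_nonneg {s : ℕ} {K : ℝ} (hK : 0 ≤ K) : 0 ≤ compConst a b s K :=
  mul_nonneg (Real.exp_pos _).le hK

/-- Composition of an odd power series with an `H^s` function. -/
lemma nrm_comp_le (hab : a < b) {s : ℕ} (hs : 1 ≤ s) {c : ℤ → ℂ}
    (hc : ∀ l, c (-l) = (starRingEnd ℂ) (c l)) {K : ℝ} (hK : 0 ≤ K)
    (h : nrm (fun l => (delta a b l : ℂ) ^ s * c l) ≤ ENNReal.ofReal K)
    {G : ℝ → ℝ} {r : ℕ → ℝ} {η : ℝ} (hη : 0 ≤ η) (hr : ∀ j, |r j| ≤ η / (j.factorial : ℝ))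
    (hG : ∀ y, HasSum (fun j => r j * y ^ (2 * j + 1)) (G y)) :
    nrm (fun l => (delta a b l : ℂ) ^ s *
      fourierCoef a b (fun x => (G (series a b c x).re : ℂ)) l) ≤
      ENNReal.ofReal (η * compConst a b s K) := by
  have hA := algConst_nonneg (a := a) (b := b) s
  have hsum := summable_norm_of_nrm hab (delta_mul_le_pow hs h)
  set S := ∑' l, ‖c l‖ with hS
  have hS0 : 0 ≤ S := tsum_nonneg fun _ => norm_nonneg _
  have hexp : ∀ y : ℝ, HasSum (fun j : ℕ => y ^ j / (j.factorial : ℝ)) (Real.exp y) := fun y => by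
    rw [Real.exp_eq_exp_ℝ]; exact NormedSpace.expSeries_div_hasSum_exp y
  -- The power series is expanded in the complex-valued `series`. It is real by the symmetry `hc`,
  -- so it can stand in for its real part.
  let f : ℕ → ℝ → ℂ := fun j x => (r j : ℂ) * series a b c x ^ (2 * j + 1)
  have hfc : ∀ j, Continuous (f j) := fun j =>
    continuous_const.mul ((continuous_series hsum).pow _)
  have hfB : ∀ j x, ‖f j x‖ ≤ η * S * ((S ^ 2) ^ j / (j.factorial : ℝ)) := fun j x => by
    simp only [f]
    rw [norm_mul, norm_pow, Complex.norm_real, Real.norm_eq_abs]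
    calc _ ≤ η / (j.factorial : ℝ) * S ^ (2 * j + 1) := by
          gcongr
          · exact hr j
          · exact norm_series_le hsum x
      _ = _ := by rw [pow_succ, pow_mul]; ring
  have hcoef : ∀ j, fourierCoef a b (f j) = fun l => (r j : ℂ) * convPow c (2 * j) l := fun j => by
    funext l
    have hp := series_pow (a := a) (b := b) hsum (2 * j)
    simp only [f, fourierCoef_const_mul]
    congr 1
    have : (fun x => series a b c x ^ (2 * j + 1)) = series a b (convPow c (2 * j)) :=
      funext hp.2
    rw [this, fourierCoef_series hab hp.1]
  have htot : ∀ x, ∑' j, f j x = (G (series a b c x).re : ℂ) := fun x => by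
    have h1 := Complex.hasSum_ofReal.2 (hG (series a b c x).re)
    rw [← h1.tsum_eq]
    refine tsum_congr fun j => ?_
    simp only [f]; push_cast
    rw [series_eq_ofReal_re hc]
  have hHS : ∀ l, HasSum (fun j => (delta a b l : ℂ) ^ s * ((r j : ℂ) * convPow c (2 * j) l))
      ((delta a b l : ℂ) ^ s * fourierCoef a b (fun x => (G (series a b c x).re : ℂ)) l) :=
    fun l => by
      have := hasSum_fourierCoef (a := a) (b := b) hfc ((hexp (S ^ 2)).summable.mul_left (η * S))
        hfB l
      simp only [hcoef, htot] at this
      exact this.mul_left _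
  refine nrm_le_of_hasSum hHS (mul_nonneg hη (compConst_nonneg hK)) fun N => ?_
  refine (nrm_sum_le _ _).trans ?_
  have hterm : ∀ j, nrm (fun l => (delta a b l : ℂ) ^ s * ((r j : ℂ) * convPow c (2 * j) l)) ≤
      ENNReal.ofReal (η * K * (((algConst a b s * K) ^ 2) ^ j / (j.factorial : ℝ))) := fun j => by
    have e : (fun l => (delta a b l : ℂ) ^ s * ((r j : ℂ) * convPow c (2 * j) l)) =
        fun l => (r j : ℂ) * ((delta a b l : ℂ) ^ s * convPow c (2 * j) l) := by
      funext l; ring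
    rw [e, nrm_const_mul]
    refine (mul_le_mul_right (nrm_convPow_le hab hs hK h (2 * j)) _).trans ?_
    rw [← ofReal_norm, ← ENNReal.ofReal_mul (norm_nonneg _), Complex.norm_real, Real.norm_eq_abs]
    apply ENNReal.ofReal_le_ofReal
    calc _ ≤ η / (j.factorial : ℝ) * ((algConst a b s * K) ^ (2 * j) * K) := by
          gcongr; exact hr j
      _ = _ := by rw [pow_mul]; ring
  refine (Finset.sum_le_sum fun j _ => hterm j).trans ?_
  rw [← ENNReal.ofReal_sum_of_nonneg fun j _ => by positivity]
  apply ENNReal.ofReal_le_ofReal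
  rw [← Finset.mul_sum, compConst, mul_comm (Real.exp _), ← mul_assoc]
  gcongr
  exact sum_le_hasSum _ (fun _ _ => by positivity) (hexp _)

/-- The remainder of the nonlinearity after its cubic term. -/
noncomputable def quint (ε y : ℝ) : ℝ := nonlin ε y + ε ^ 2 / 6 * y ^ 3

/-- The coefficients of the Taylor series of `sin(εy)/ε`. -/
noncomputable def sinCoef (ε : ℝ) (j : ℕ) : ℝ := (-1) ^ j * ε ^ (2 * j) / ((2 * j + 1).factorial : ℝ)

lemma hasSum_sinCoef {ε : ℝ} (hε : 0 < ε) (y : ℝ) :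
    HasSum (fun j => sinCoef ε j * y ^ (2 * j + 1)) (1 / ε * Real.sin (ε * y)) := by
  refine ((Real.hasSum_sin (ε * y)).mul_left (1 / ε)).congr_fun fun j => ?_
  rw [sinCoef]
  field_simp
  ring

/-- Powers of `ε ≤ 1` beyond `2i` are discarded and `(2j + 1)!` is weakened to `j!`, the form in
which the composition estimate sums to an exponential. -/
lemma abs_sinCoef_le {ε : ℝ} (hε : 0 < ε) (hε1 : ε ≤ 1) {i j : ℕ} (hij : i ≤ j) :
    |sinCoef ε j| ≤ ε ^ (2 * i) / (j.factorial : ℝ) := by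
  rw [sinCoef, abs_div, abs_mul, abs_pow, abs_neg, abs_one, one_pow, one_mul,
    abs_of_pos (by positivity), Nat.abs_cast]
  apply div_le_div₀ (by positivity) (pow_le_pow_of_le_one hε.le hε1 (by omega)) (by positivity)
  exact_mod_cast Nat.factorial_le (by omega)

/-- Subtracting `y` removes the term `j = 0` of the sine series, and all others carry at least `ε²`.
-/
lemma nrm_nonlin_le (hab : a < b) {s : ℕ} (hs : 1 ≤ s) {c : ℤ → ℂ}
    (hc : ∀ l, c (-l) = (starRingEnd ℂ) (c l)) {K : ℝ} (hK : 0 ≤ K)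
    (h : nrm (fun l => (delta a b l : ℂ) ^ s * c l) ≤ ENNReal.ofReal K)
    {ε : ℝ} (hε : 0 < ε) (hε1 : ε ≤ 1) :
    nrm (fun l => (delta a b l : ℂ) ^ s *
      fourierCoef a b (fun x => (nonlin ε (series a b c x).re : ℂ)) l) ≤
      ENNReal.ofReal (ε ^ 2 * compConst a b s K) := by
  refine nrm_comp_le hab hs hc hK h (r := fun j => if j < 1 then 0 else sinCoef ε j)
    (by positivity) (fun j => ?_) fun y => ?_
  · split_ifs with hj
    · rw [abs_zero]; positivity
    · exact abs_sinCoef_le hε hε1 (i := 1) (by omega)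
  · have h1 := hasSum_sinCoef hε y
    rw [← hasSum_nat_add_iff' 1] at h1 ⊢
    convert h1 using 1
    · simp
    · simp [nonlin, sinCoef]

/-- Here the terms `j = 0, 1` are both removed, which leaves at least `ε⁴`. -/
lemma nrm_quint_le (hab : a < b) {s : ℕ} (hs : 1 ≤ s) {c : ℤ → ℂ}
    (hc : ∀ l, c (-l) = (starRingEnd ℂ) (c l)) {K : ℝ} (hK : 0 ≤ K)
    (h : nrm (fun l => (delta a b l : ℂ) ^ s * c l) ≤ ENNReal.ofReal K)
    {ε : ℝ} (hε : 0 < ε) (hε1 : ε ≤ 1) :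
    nrm (fun l => (delta a b l : ℂ) ^ s *
      fourierCoef a b (fun x => (quint ε (series a b c x).re : ℂ)) l) ≤
      ENNReal.ofReal (ε ^ 4 * compConst a b s K) := by
  refine nrm_comp_le hab hs hc hK h (r := fun j => if j < 2 then 0 else sinCoef ε j)
    (by positivity) (fun j => ?_) fun y => ?_
  · split_ifs with hj
    · rw [abs_zero]; positivity
    · exact abs_sinCoef_le hε hε1 (i := 2) (by omega)
  · have h1 := hasSum_sinCoef hε y
    rw [← hasSum_nat_add_iff' 2] at h1 ⊢
    convert h1 using 1
    · simp
    · simp [nonlin, quint, sinCoef, Finset.sum_range_succ, Nat.factorial]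
      ring

/-! ### Pointwise bounds for the nonlinearity -/

lemma hasDerivAt_nonlin {ε : ℝ} (hε : 0 < ε) (y : ℝ) :
    HasDerivAt (nonlin ε) (Real.cos (ε * y) - 1) y := by
  have h := ((((hasDerivAt_id y).const_mul ε).sin).const_mul (1 / ε)).sub (hasDerivAt_id y)
  refine h.congr_deriv ?_
  simp only [id]
  field_simp

lemma abs_nonlin_sub_le {ε : ℝ} (hε : 0 < ε) {B x y : ℝ} (hx : |x| ≤ B) (hy : |y| ≤ B) :
    |nonlin ε x - nonlin ε y| ≤ ε ^ 2 * B ^ 2 * |x - y| := by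
  have := Convex.norm_image_sub_le_of_norm_hasDerivWithin_le (f := nonlin ε)
    (f' := fun y => Real.cos (ε * y) - 1) (s := Set.Icc (-B) B) (C := ε ^ 2 * B ^ 2)
    (fun z _ => (hasDerivAt_nonlin hε z).hasDerivWithinAt) (fun z hz => ?_)
    (convex_Icc _ _) (Set.mem_Icc.2 (abs_le.1 hy)) (Set.mem_Icc.2 (abs_le.1 hx))
  · simpa only [Real.norm_eq_abs] using this
  · have h1 := Real.one_sub_sq_div_two_le_cos (x := ε * z)
    have h2 := Real.cos_le_one (ε * z)
    have h3 : z ^ 2 ≤ B ^ 2 := sq_le_sq' hz.1 hz.2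
    rw [Real.norm_eq_abs, abs_of_nonpos (by linarith)]
    nlinarith [mul_le_mul_of_nonneg_left h3 (sq_nonneg ε), mul_nonneg (sq_nonneg ε) (sq_nonneg z)]

lemma continuous_nonlin (ε : ℝ) : Continuous (nonlin ε) := by
  unfold nonlin; fun_prop

lemma continuous_quint (ε : ℝ) : Continuous (quint ε) := by
  unfold quint; have := continuous_nonlin ε; fun_prop

lemma abs_quint_sub_le {ε : ℝ} (hε : 0 < ε) {B x y : ℝ} (hx : |x| ≤ B) (hy : |y| ≤ B) :
    |quint ε x - quint ε y| ≤ ε ^ 4 * B ^ 4 * |x - y| := by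
  have hd : ∀ z, HasDerivAt (quint ε) (Real.cos (ε * z) - 1 + ε ^ 2 / 2 * z ^ 2) z := fun z => by
    have h := (hasDerivAt_nonlin hε z).add (((hasDerivAt_id z).pow 3).const_mul (ε ^ 2 / 6))
    refine h.congr_deriv ?_
    simp only [id]; ring
  have := Convex.norm_image_sub_le_of_norm_hasDerivWithin_le (f := quint ε)
    (f' := fun z => Real.cos (ε * z) - 1 + ε ^ 2 / 2 * z ^ 2) (s := Set.Icc (-B) B)
    (C := ε ^ 4 * B ^ 4)
    (fun z _ => (hd z).hasDerivWithinAt) (fun z hz => ?_)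
    (convex_Icc _ _) (Set.mem_Icc.2 (abs_le.1 hy)) (Set.mem_Icc.2 (abs_le.1 hx))
  · simpa only [Real.norm_eq_abs] using this
  · have h1 := Real.one_sub_sq_div_two_le_cos (x := ε * z)
    -- Taylor's bound is available only for `|εz| ≤ 1`; otherwise the quartic term dominates the
    -- quadratic one and `cos ≤ 1` suffices.
    have h2 : Real.cos (ε * z) ≤ 1 - (ε * z) ^ 2 / 2 + (ε * z) ^ 4 := by
      rcases le_total |ε * z| 1 with h | h
      · have h5 := (abs_le.1 (Real.cos_bound h)).2
        have h6 : |ε * z| ^ 4 = (ε * z) ^ 4 := by rw [← abs_pow, abs_of_nonneg (by positivity)]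
        have h7 : 0 ≤ (ε * z) ^ 4 := by positivity
        rw [h6] at h5
        linarith
      · have h5 : 1 ≤ (ε * z) ^ 2 := by rw [← sq_abs]; exact one_le_pow₀ h
        nlinarith [Real.cos_le_one (ε * z)]
    have h3 : z ^ 2 ≤ B ^ 2 := sq_le_sq' hz.1 hz.2
    have h4 : z ^ 4 ≤ B ^ 4 := by nlinarith [sq_nonneg z, sq_nonneg B]
    rw [Real.norm_eq_abs, abs_of_nonneg (by nlinarith)]
    nlinarith [mul_le_mul_of_nonneg_left h4 (by positivity : 0 ≤ ε ^ 4)]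

end SineGordon

/-! ### Grid functions and trigonometric interpolation. -/

namespace SineGordon

open MeasureTheory Filter Topology
open scoped ENNReal NNReal

variable {a b : ℝ} {M : ℕ}

/-! ### The discrete Fourier transform -/

/-- The `n`-th power of the primitive root of unity `e^{2πi/M}`. -/
noncomputable def root (M : ℕ) (n : ℤ) : ℂ := Complex.exp (2 * Real.pi * Complex.I * n / M)

lemma mode_grid (hab : a < b) (hM : 0 < M) (l : ℤ) (j : Fin (M + 1)) :
    mode a b l (grid a b M j) = root M (l * (j : ℕ)) := by
  have hL : (b : ℂ) - a ≠ 0 := by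
    rw [← Complex.ofReal_sub]; exact_mod_cast (sub_pos.2 hab).ne'
  have hM' : (M : ℂ) ≠ 0 := by exact_mod_cast hM.ne'
  rw [mode, root]
  congr 1
  simp only [mu, grid, mesh]; push_cast; field_simp; ring

lemma root_add (m n : ℤ) : root M (m + n) = root M m * root M n := by
  rw [root, root, root, ← Complex.exp_add]; congr 1; push_cast; ring

lemma root_mul (m : ℤ) (n : ℕ) : root M (m * n) = root M m ^ n := by
  rw [root, root, ← Complex.exp_nat_mul]; congr 1; push_cast; ring

lemma root_eq_one_iff (hM : 0 < M) (n : ℤ) : root M n = 1 ↔ (M : ℤ) ∣ n := by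
  have hM' : (M : ℂ) ≠ 0 := by exact_mod_cast hM.ne'
  have h2 : (2 * Real.pi * Complex.I : ℂ) ≠ 0 := Complex.two_pi_I_ne_zero
  rw [root, Complex.exp_eq_one_iff]
  constructor
  · rintro ⟨k, hk⟩
    refine ⟨k, ?_⟩
    have : (n : ℂ) = M * k := by
      field_simp at hk
      linear_combination hk
    exact_mod_cast this
  · rintro ⟨k, rfl⟩
    exact ⟨k, by push_cast; field_simp⟩

lemma sum_root (hM : 0 < M) (n : ℤ) :
    ∑ j : Fin M, root M (n * (j : ℕ)) = if (M : ℤ) ∣ n then (M : ℂ) else 0 := by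
  simp only [root_mul]
  rw [Fin.sum_univ_eq_sum_range fun j => root M n ^ j]
  split_ifs with h
  · rw [(root_eq_one_iff hM n).2 h]; simp
  · have h1 : root M n ≠ 1 := fun h1 => h ((root_eq_one_iff hM n).1 h1)
    rw [geom_sum_eq h1, ← root_mul, (root_eq_one_iff hM _).2 (dvd_mul_left _ _)]
    simp

/-- `T_M` is `{0, …, M - 1}` shifted by `-M/2`. The shift multiplies the sum by a root of unity,
which equals `1` when the sum is not zero. -/
lemma sum_freq_root (hM : 0 < M) (hE : Even M) (n : ℤ) :
    ∑ l ∈ freq M, root M (l * n) = if (M : ℤ) ∣ n then (M : ℂ) else 0 := by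
  obtain ⟨k, rfl⟩ := hE
  have h1 : freq (k + k) = (Finset.range (k + k)).image fun i : ℕ => (i : ℤ) - k := by
    ext l
    simp only [freq, Finset.mem_Ico, Finset.mem_image, Finset.mem_range]
    constructor
    · intro h; exact ⟨(l + k).toNat, by omega, by omega⟩
    · rintro ⟨i, hi, rfl⟩; omega
  rw [h1, Finset.sum_image (by intro x _ y _ h; simpa using h)]
  have h2 : ∀ i : ℕ, root (k + k) (((i : ℤ) - k) * n) =
      root (k + k) (-k * n) * root (k + k) (n * i) := fun i => by
    rw [← root_add]; congr 1; ring
  simp only [h2]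
  rw [← Finset.mul_sum, ← Fin.sum_univ_eq_sum_range (fun i : ℕ => root (k + k) (n * i)),
    sum_root hM]
  split_ifs with h
  · rw [(root_eq_one_iff hM _).2 (h.mul_left _), one_mul]
  · simp

lemma dft_eq (u : Fin (M + 1) → ℂ) (l : ℤ) :
    dft a b M u l = (1 / (M : ℂ)) * ∑ j : Fin M, u j.castSucc *
      mode a b (-l) (grid a b M j.castSucc) := by
  simp only [dft, mode_neg]

lemma dft_add (u v : Fin (M + 1) → ℂ) (l : ℤ) :
    dft a b M (fun j => u j + v j) l = dft a b M u l + dft a b M v l := by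
  simp only [dft_eq, add_mul, Finset.sum_add_distrib, mul_add]

lemma dft_sub (u v : Fin (M + 1) → ℂ) (l : ℤ) :
    dft a b M (fun j => u j - v j) l = dft a b M u l - dft a b M v l := by
  simp only [dft_eq, sub_mul, Finset.sum_sub_distrib, mul_sub]

lemma dft_const_mul (z : ℂ) (u : Fin (M + 1) → ℂ) (l : ℤ) :
    dft a b M (fun j => z * u j) l = z * dft a b M u l := by
  simp only [dft_eq, mul_assoc, ← Finset.mul_sum]
  ring

lemma dft_congr {u v : Fin (M + 1) → ℂ} (h : ∀ j : Fin M, u j.castSucc = v j.castSucc) (l : ℤ) :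
    dft a b M u l = dft a b M v l := by
  simp only [dft_eq, h]

lemma dft_conj (u : Fin (M + 1) → ℂ) (l : ℤ) :
    dft a b M (fun j => (starRingEnd ℂ) (u j)) l = (starRingEnd ℂ) (dft a b M u (-l)) := by
  simp only [dft_eq, map_mul, map_sum, map_div₀, map_one, conj_mode, map_natCast, neg_neg]

lemma dft_period (hab : a < b) (hM : 0 < M) (u : Fin (M + 1) → ℂ) (l : ℤ) :
    dft a b M u (l + M) = dft a b M u l := by
  simp only [dft_eq, mode_grid hab hM]
  congr 1
  refine Finset.sum_congr rfl fun j _ => ?_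
  congr 1
  rw [show -(l + (M : ℤ)) * ((j.castSucc : Fin (M + 1)) : ℕ) =
    -l * ((j.castSucc : Fin (M + 1)) : ℕ) + M * (-((j.castSucc : Fin (M + 1)) : ℕ) : ℤ) by ring,
    root_add, (root_eq_one_iff hM _).2 (dvd_mul_right _ _), mul_one]

lemma dft_mode (hab : a < b) (hM : 0 < M) (k l : ℤ) :
    dft a b M (fun j => mode a b k (grid a b M j)) l = if (M : ℤ) ∣ k - l then 1 else 0 := by
  have hM' : (M : ℂ) ≠ 0 := by exact_mod_cast hM.ne'
  simp only [dft_eq, ← mode_add]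
  simp only [mode_grid hab hM, Fin.val_castSucc]
  rw [sum_root hM, ← sub_eq_add_neg]
  split_ifs
  · field_simp
  · simp

lemma dft_sum {ι : Type*} (s : Finset ι) (u : ι → Fin (M + 1) → ℂ) (l : ℤ) :
    dft a b M (fun j => ∑ i ∈ s, u i j) l = ∑ i ∈ s, dft a b M (u i) l := by
  simp only [dft_eq, Finset.sum_mul, ← Finset.mul_sum]
  rw [Finset.sum_comm]

lemma mem_freq_iff (hE : Even M) {l : ℤ} : l ∈ freq M ↔ -(M : ℤ) ≤ 2 * l ∧ 2 * l < M := by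
  obtain ⟨k, rfl⟩ := hE
  simp only [freq, Finset.mem_Ico]
  omega

lemma eq_of_mem_freq (hE : Even M) {k l : ℤ} (hk : k ∈ freq M) (hl : l ∈ freq M)
    (h : (M : ℤ) ∣ k - l) : k = l := by
  rw [mem_freq_iff hE] at hk hl
  have := Int.eq_zero_of_abs_lt_dvd h (by rw [abs_lt]; omega)
  omega

lemma dft_sum_mode (hab : a < b) (hM : 0 < M) (hE : Even M) (c : ℤ → ℂ) {l : ℤ}
    (hl : l ∈ freq M) :
    dft a b M (fun j => ∑ k ∈ freq M, c k * mode a b k (grid a b M j)) l = c l := by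
  rw [dft_sum]
  simp only [dft_const_mul, dft_mode hab hM]
  rw [Finset.sum_eq_single l]
  · simp
  · intro k hk hkl
    rw [if_neg fun h => hkl (eq_of_mem_freq hE hk hl h), mul_zero]
  · exact fun h => absurd hl h

lemma sum_dft_mode (hab : a < b) (hM : 0 < M) (hE : Even M) (u : Fin (M + 1) → ℂ) (j : Fin M) :
    ∑ l ∈ freq M, dft a b M u l * mode a b l (grid a b M j.castSucc) = u j.castSucc := by
  have hM' : (M : ℂ) ≠ 0 := by exact_mod_cast hM.ne'
  simp only [dft_eq, mode_grid hab hM, Finset.mul_sum, Finset.sum_mul, Fin.val_castSucc]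
  rw [Finset.sum_comm]
  have h : ∀ i : Fin M, ∑ l ∈ freq M, 1 / (M : ℂ) * (u i.castSucc * root M (-l * (i : ℕ))) *
      root M (l * (j : ℕ)) = if i = j then u i.castSucc else 0 := fun i => by
    have h1 : ∀ l : ℤ, 1 / (M : ℂ) * (u i.castSucc * root M (-l * (i : ℕ))) *
        root M (l * (j : ℕ)) = 1 / (M : ℂ) * u i.castSucc * root M (l * ((j : ℕ) - (i : ℕ) : ℤ)) :=
      fun l => by
        rw [show l * ((j : ℕ) - (i : ℕ) : ℤ) = -l * (i : ℕ) + l * (j : ℕ) by ring, root_add]; ring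
    simp only [h1]
    rw [← Finset.mul_sum, sum_freq_root hM hE]
    by_cases hij : i = j
    · subst hij; simp; field_simp
    · rw [if_neg hij, if_neg, mul_zero]
      intro hd
      have h2 := Int.eq_zero_of_abs_lt_dvd hd (by rw [abs_lt]; omega)
      exact hij (Fin.ext (by omega))
  simp only [h, Finset.sum_ite_eq', Finset.mem_univ, if_true]

lemma sum_sq_dft (hab : a < b) (hM : 0 < M) (hE : Even M) (u : Fin (M + 1) → ℂ) :
    ∑ l ∈ freq M, ‖dft a b M u l‖ ^ 2 = (1 / (M : ℝ)) * ∑ j : Fin M, ‖u j.castSucc‖ ^ 2 := by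
  have h : ∑ l ∈ freq M, dft a b M u l * (starRingEnd ℂ) (dft a b M u l) =
      (1 / (M : ℂ)) * ∑ j : Fin M, u j.castSucc * (starRingEnd ℂ) (u j.castSucc) := by
    have h1 : ∀ l, (starRingEnd ℂ) (dft a b M u l) = (1 / (M : ℂ)) * ∑ j : Fin M,
        (starRingEnd ℂ) (u j.castSucc) * mode a b l (grid a b M j.castSucc) := fun l => by
      simp only [dft_eq, map_mul, map_sum, map_div₀, map_one, conj_mode, map_natCast, neg_neg]
    simp only [h1, Finset.mul_sum]
    rw [Finset.sum_comm]
    refine Finset.sum_congr rfl fun j _ => ?_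
    nth_rewrite 2 [← sum_dft_mode hab hM hE u j]
    rw [Finset.sum_mul, Finset.mul_sum]
    refine Finset.sum_congr rfl fun l _ => ?_
    ring
  simp only [Complex.mul_conj, Complex.normSq_eq_norm_sq] at h
  apply Complex.ofReal_injective
  push_cast at h ⊢
  exact h

/-- Restriction of a sequence to the frequencies `T_M`. -/
noncomputable def onFreq (M : ℕ) (c : ℤ → ℂ) (l : ℤ) : ℂ := if l ∈ freq M then c l else 0

/-- Projection of a sequence to the frequencies `|l| < M/2`. -/
noncomputable def lowPass (M : ℕ) (c : ℤ → ℂ) (l : ℤ) : ℂ := if 2 * |l| < M then c l else 0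

lemma nrm_onFreq_sq (c : ℤ → ℂ) :
    nrm (onFreq M c) ^ 2 = ENNReal.ofReal (∑ l ∈ freq M, ‖c l‖ ^ 2) := by
  rw [nrm_sq, tsum_eq_sum (s := freq M) (fun l hl => by simp [onFreq, hl]),
    ENNReal.ofReal_sum_of_nonneg fun _ _ => by positivity]
  refine Finset.sum_congr rfl fun l hl => ?_
  rw [onFreq, if_pos hl, enorm_sq_eq]

/-- Discrete Parseval; through it a pointwise Lipschitz bound on the grid becomes an `ℓ²` bound on
the coefficients. -/
lemma nrm_dft_le_mul (hab : a < b) (hM : 0 < M) (hE : Even M) {u v : Fin (M + 1) → ℂ} {B : ℝ}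
    (hB : 0 ≤ B) (h : ∀ j : Fin M, ‖u j.castSucc‖ ≤ B * ‖v j.castSucc‖) :
    nrm (onFreq M (dft a b M u)) ≤ ENNReal.ofReal B * nrm (onFreq M (dft a b M v)) := by
  rw [← ENNReal.pow_le_pow_left_iff two_ne_zero, mul_pow, nrm_onFreq_sq, nrm_onFreq_sq,
    sum_sq_dft hab hM hE, sum_sq_dft hab hM hE, ← ENNReal.ofReal_pow hB,
    ← ENNReal.ofReal_mul (by positivity)]
  apply ENNReal.ofReal_le_ofReal
  rw [mul_left_comm]
  refine mul_le_mul_of_nonneg_left ?_ (by positivity)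
  rw [Finset.mul_sum]
  refine Finset.sum_le_sum fun j _ => ?_
  rw [← mul_pow]
  exact pow_le_pow_left₀ (norm_nonneg _) (h j) 2

lemma nrm_dft_le (hab : a < b) (hM : 0 < M) (hE : Even M) {u : Fin (M + 1) → ℂ} {B : ℝ}
    (hB : 0 ≤ B) (h : ∀ j : Fin M, ‖u j.castSucc‖ ≤ B) :
    nrm (onFreq M (dft a b M u)) ≤ ENNReal.ofReal B := by
  rw [← ENNReal.pow_le_pow_left_iff two_ne_zero, nrm_onFreq_sq, sum_sq_dft hab hM hE,
    ← ENNReal.ofReal_pow hB]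
  apply ENNReal.ofReal_le_ofReal
  have hM' : (0 : ℝ) < M := by exact_mod_cast hM
  calc _ ≤ (1 / (M : ℝ)) * ∑ j : Fin M, B ^ 2 := by
        gcongr with j; exact h j
    _ = B ^ 2 := by simp; field_simp

lemma mesh_pos (hab : a < b) (hM : 0 < M) : 0 < mesh a b M :=
  div_pos (sub_pos.2 hab) (by exact_mod_cast hM)

lemma mesh_le (hab : a < b) (hM : 0 < M) : mesh a b M ≤ b - a :=
  div_le_self (sub_pos.2 hab).le (by exact_mod_cast hM)

lemma grid_mem (hab : a < b) (hM : 0 < M) (j : Fin (M + 1)) : grid a b M j ∈ Set.Icc a b := by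
  have hh := mesh_pos hab hM
  have hM' : (0 : ℝ) < M := by exact_mod_cast hM
  have hj : ((j : ℕ) : ℝ) ≤ M := by exact_mod_cast Nat.lt_succ_iff.1 j.2
  rw [grid]
  constructor
  · have := mul_nonneg (Nat.cast_nonneg (α := ℝ) (j : ℕ)) hh.le
    linarith
  · have h1 : ((j : ℕ) : ℝ) * mesh a b M ≤ M * mesh a b M := by gcongr
    have h2 : (M : ℝ) * mesh a b M = b - a := by rw [mesh]; field_simp
    linarith

/-- Frequencies outside of the range of `lowPass` have large symbols. -/
lemma div_mesh_le_delta (hab : a < b) (hM : 0 < M) {l : ℤ} {t : ℝ} (h : t * M ≤ 2 * |(l : ℝ)|) :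
    t / mesh a b M ≤ delta a b l := by
  have hL : 0 < b - a := sub_pos.2 hab
  have hM' : (0 : ℝ) < M := by exact_mod_cast hM
  refine le_trans ?_ (abs_mu_le_delta l)
  rw [abs_mu hab, mesh, div_div_eq_mul_div, div_mul_eq_mul_div]
  refine div_le_div_of_nonneg_right (h.trans ?_) hL.le
  have := Real.pi_gt_three
  nlinarith [abs_nonneg (l : ℝ)]

lemma one_le_mesh_mul_delta (hab : a < b) (hM : 0 < M) {l : ℤ} (h : ¬ 2 * |l| < M) :
    1 ≤ mesh a b M * delta a b l := by
  have h1 : (1 : ℝ) * M ≤ 2 * |(l : ℝ)| := by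
    rw [one_mul]; exact_mod_cast not_lt.1 h
  have := div_mesh_le_delta hab hM h1
  rwa [div_le_iff₀' (mesh_pos hab hM)] at this

/-- On the discarded frequencies `hδ ≥ 1`, so a factor `(hδ)^s` may be inserted. -/
lemma nrm_sub_lowPass_le (hab : a < b) (hM : 0 < M) (r s : ℕ) (c : ℤ → ℂ) :
    nrm (fun l => (delta a b l : ℂ) ^ r * (c l - lowPass M c l)) ≤
      ENNReal.ofReal (mesh a b M ^ s) * nrm (fun l => (delta a b l : ℂ) ^ (r + s) * c l) := by
  have hh := mesh_pos hab hM
  refine nrm_le_mul fun l => ?_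
  have hd := delta_pos (a := a) (b := b) l
  rw [norm_mul, norm_mul, norm_delta_pow, norm_delta_pow, lowPass]
  split_ifs with h
  · simp; positivity
  · rw [sub_zero, ← mul_assoc]
    gcongr
    have := one_le_pow₀ (n := s) (one_le_mesh_mul_delta hab hM h)
    rw [mul_pow] at this
    calc delta a b l ^ r = 1 * delta a b l ^ r := (one_mul _).symm
      _ ≤ (mesh a b M ^ s * delta a b l ^ s) * delta a b l ^ r := by gcongr
      _ = _ := by ring

/-! ### Aliasing -/

/-- The aliasing formula: on the grid, mode `n` cannot be told from mode `l` exactly when `M ∣ n -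
l`. -/
lemma dft_series (hab : a < b) (hM : 0 < M) {c : ℤ → ℂ} (hc : Summable fun l => ‖c l‖) (l : ℤ) :
    dft a b M (fun j => series a b c (grid a b M j)) l = ∑' k : ℤ, c (l + k * M) := by
  have hM' : (M : ℤ) ≠ 0 := by exact_mod_cast hM.ne'
  have h1 : HasSum (fun n => c n * dft a b M (fun j => mode a b n (grid a b M j)) l)
      (dft a b M (fun j => series a b c (grid a b M j)) l) := by
    simp only [dft_eq, Finset.mul_sum]
    refine hasSum_sum fun j _ => ?_
    have := ((summable_mul_mode (a := a) (b := b) hc (grid a b M j.castSucc)).hasSum.mul_right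
      (mode a b (-l) (grid a b M j.castSucc))).mul_left (1 / (M : ℂ))
    refine this.congr_fun fun n => ?_
    ring
  rw [← h1.tsum_eq]
  have hinj : Function.Injective fun k : ℤ => l + k * M := fun x y h => by
    simpa [hM.ne'] using h
  rw [← hinj.tsum_eq]
  · refine tsum_congr fun k => ?_
    rw [dft_mode hab hM, if_pos ⟨k, by ring⟩, mul_one]
  · intro n hn
    rw [Function.mem_support, dft_mode hab hM] at hn
    split_ifs at hn with h
    · obtain ⟨k, hk⟩ := h
      exact ⟨k, by simp only; linarith⟩
    · simp at hn

lemma summable_inv_max : Summable fun k : ℤ => (1 / max 1 |(k : ℝ)|) ^ 2 := by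
  refine ((Real.summable_one_div_int_pow.2 one_lt_two).add
    (summable_of_ne_finset_zero (s := {0}) (f := fun l : ℤ => if l = 0 then (1 : ℝ) else 0)
      ?_)).of_nonneg_of_le (fun l => by positivity) fun l => ?_
  · intro l hl; simp at hl; simp [hl]
  · by_cases hl : l = 0
    · subst hl; simp
    · have h1 : (0 : ℝ) < |(l : ℝ)| := abs_pos.2 (by exact_mod_cast hl)
      simp only [hl, if_false, add_zero]
      rw [← sq_abs (l : ℝ), ← one_div_pow]
      gcongr
      exact le_max_right _ _

/-- The constant in the aliasing estimate. -/
noncomputable def aliasConst : ℝ := Real.sqrt (∑' k : ℤ, (1 / max 1 |(k : ℝ)|) ^ 2)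

lemma aliasConst_nonneg : 0 ≤ aliasConst := Real.sqrt_nonneg _

/-- Every alias `l + kM` that contributes satisfies `hδ ≥ max(1, |k|)`, so its coefficient is at
most `h^s / max(1, |k|)` times the weighted one. These weights are square summable in `k`, and the
classes `l + Mℤ` with `l ∈ T_M` are disjoint, so nothing is counted twice. -/
lemma nrm_alias_le (hab : a < b) (hM : 0 < M) (hE : Even M) {s : ℕ} (hs : 1 ≤ s) {c : ℤ → ℂ}
    (hc : Summable fun l => ‖c l‖) :
    nrm (onFreq M fun l => dft a b M (fun j => series a b c (grid a b M j)) l - lowPass M c l) ≤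
      ENNReal.ofReal (aliasConst * mesh a b M ^ s) *
        nrm (fun l => (delta a b l : ℂ) ^ s * c l) := by
  have hh := mesh_pos hab hM
  have hMZ : (M : ℤ) ≠ 0 := by exact_mod_cast hM.ne'
  set X : ℤ → ℝ≥0∞ := fun l => ‖(delta a b l : ℂ) ^ s * c l‖ₑ with hX
  have hinj : ∀ l : ℤ, Function.Injective fun k : ℤ => l + k * M := fun l x y h => by
    simpa [hM.ne'] using h
  have hpt : ∀ l ∈ freq M, ‖dft a b M (fun j => series a b c (grid a b M j)) l -
      lowPass M c l‖ₑ ^ 2 ≤ ENNReal.ofReal (aliasConst * mesh a b M ^ s) ^ 2 *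
        ∑' k : ℤ, X (l + k * M) ^ 2 := fun l hl => by
    have hl' := (mem_freq_iff hE).1 hl
    have hsum : Summable fun k : ℤ => c (l + k * M) :=
      (Summable.of_norm hc).comp_injective (hinj l)
    have hsum2 : Summable fun k : ℤ => if k = 0 then lowPass M c l else 0 :=
      summable_of_ne_finset_zero (s := {0}) fun k hk => by simp at hk; simp [hk]
    have e1 : dft a b M (fun j => series a b c (grid a b M j)) l - lowPass M c l =
        ∑' k : ℤ, (c (l + k * M) - if k = 0 then lowPass M c l else 0) := by
      rw [dft_series hab hM hc, hsum.tsum_sub hsum2, tsum_ite_eq]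
    have hk : ∀ k : ℤ, ‖c (l + k * M) - if k = 0 then lowPass M c l else 0‖ₑ ≤
        ENNReal.ofReal (mesh a b M ^ s * (1 / max 1 |(k : ℝ)|)) * X (l + k * M) := fun k => by
      simp only [hX]
      rw [← ofReal_norm, ← ofReal_norm, ← ENNReal.ofReal_mul (by positivity)]
      apply ENNReal.ofReal_le_ofReal
      rw [norm_mul, norm_delta_pow]
      have key : max 1 |(k : ℝ)| * M ≤ 2 * |((l + k * M : ℤ) : ℝ)| →
          ‖c (l + k * M)‖ ≤ mesh a b M ^ s * (1 / max 1 |(k : ℝ)|) *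
            (delta a b (l + k * M) ^ s * ‖c (l + k * M)‖) := fun h => by
        have h1 := div_mesh_le_delta hab hM h
        rw [div_le_iff₀' hh] at h1
        have h2 : max 1 |(k : ℝ)| ≤ (mesh a b M * delta a b (l + k * M)) ^ s :=
          h1.trans (le_self_pow₀ ((le_max_left _ _).trans h1) (by omega))
        rw [mul_pow] at h2
        have h3 : 0 < max 1 |(k : ℝ)| := by positivity
        have h4 : 1 ≤ mesh a b M ^ s * (1 / max 1 |(k : ℝ)|) * delta a b (l + k * M) ^ s := by
          rw [mul_one_div, div_mul_eq_mul_div, le_div_iff₀ h3, one_mul]; exact h2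
        calc ‖c (l + k * M)‖ = 1 * ‖c (l + k * M)‖ := (one_mul _).symm
          _ ≤ _ := by
            rw [← mul_assoc]; gcongr
      -- The term `k = 0` cancels against `lowPass`, except at `l = -M/2`: this frequency lies in
      -- `T_M` but is cut off, and is large enough to be treated like an alias.
      by_cases hk0 : k = 0
      · subst hk0
        simp only [if_true, zero_mul, add_zero, lowPass] at key ⊢
        split_ifs with h
        · rw [sub_self, norm_zero]
          have := delta_pos (a := a) (b := b) l
          positivity
        · rw [sub_zero]
          refine key ?_
          have h1 : (M : ℝ) ≤ 2 * |(l : ℝ)| := by exact_mod_cast not_lt.1 h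
          simpa using h1
      · rw [if_neg hk0, sub_zero]
        refine key ?_
        have h1 : (1 : ℝ) ≤ |(k : ℝ)| := by exact_mod_cast Int.one_le_abs hk0
        rw [max_eq_right h1]
        -- From `|kM| ≤ |l + kM| + |l|` and `2|l| ≤ M ≤ |k|M`.
        have h2 : |k| * M ≤ 2 * |l + k * M| := by
          have e : |k * (M : ℤ)| = |k| * M := by rw [abs_mul, Nat.abs_cast]
          have h3 : |k * (M : ℤ)| ≤ |l + k * M| + |l| := by
            have := abs_sub (l + k * M) l
            rwa [add_sub_cancel_left] at this
          have h4 : 2 * |l| ≤ M := by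
            have : |l| ≤ max l (-l) := le_rfl
            rcases abs_cases l with h | h <;> omega
          have h5 : (M : ℤ) ≤ |k| * M := le_mul_of_one_le_left (by positivity)
            (Int.one_le_abs hk0)
          linarith
        exact_mod_cast h2
    rw [e1]
    calc _ ≤ (∑' k : ℤ, ENNReal.ofReal (mesh a b M ^ s * (1 / max 1 |(k : ℝ)|)) *
          X (l + k * M)) ^ 2 := by
          gcongr
          exact enorm_tsum_le_tsum_enorm.trans (ENNReal.tsum_le_tsum hk)
      _ ≤ _ := tsum_mul_sq_le _ _
      _ = _ := by
        congr 1
        rw [← ENNReal.ofReal_pow (mul_nonneg aliasConst_nonneg (by positivity)), mul_pow,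
          aliasConst, Real.sq_sqrt (tsum_nonneg fun _ => by positivity), ← tsum_mul_right,
          ENNReal.ofReal_tsum_of_nonneg (fun _ => by positivity) (summable_inv_max.mul_right _)]
        refine tsum_congr fun k => ?_
        rw [← ENNReal.ofReal_pow (by positivity), mul_pow, mul_comm]
  rw [← ENNReal.pow_le_pow_left_iff two_ne_zero, mul_pow, nrm_sq, nrm_sq,
    tsum_eq_sum (s := freq M) (fun l hl => by simp [onFreq, hl])]
  calc _ ≤ ∑ l ∈ freq M, ENNReal.ofReal (aliasConst * mesh a b M ^ s) ^ 2 *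
        ∑' k : ℤ, X (l + k * M) ^ 2 := Finset.sum_le_sum fun l hl => by
        rw [onFreq, if_pos hl]; exact hpt l hl
    _ = ENNReal.ofReal (aliasConst * mesh a b M ^ s) ^ 2 *
        ∑' p : freq M × ℤ, X (p.1 + p.2 * M) ^ 2 := by
        rw [← Finset.mul_sum, ENNReal.tsum_prod' (f := fun p : freq M × ℤ => X (p.1 + p.2 * M) ^ 2),
          tsum_fintype, ← Finset.sum_coe_sort (freq M)]
    _ ≤ _ := by
        gcongr
        refine ENNReal.tsum_comp_le_tsum_of_injective (f := fun p : freq M × ℤ =>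
          (p.1 : ℤ) + p.2 * M) ?_ fun l => X l ^ 2
        rintro ⟨⟨l, hl⟩, k⟩ ⟨⟨l', hl'⟩, k'⟩ h
        simp only at h
        have e : l = l' := eq_of_mem_freq hE hl hl' ⟨k' - k, by linarith⟩
        subst e
        have : k = k' := hinj l h
        subst this
        rfl

end SineGordon

/-! ### From weak solutions to ordinary differential equations in `ℓ²`. -/

namespace SineGordon

open MeasureTheory Filter Topology
open scoped ENNReal NNReal

variable {a b : ℝ}

/-! ### A mean value inequality in `ℓ²` -/

/-- Only coordinatewise derivatives are known. On a finite set of frequencies the curve is paired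
with its own increment `z`; the scalar mean value inequality then gives `Z² ≤ Z B (t₁ - t₀)` for the
norm `Z` of `z` there. -/
lemma nrm_sub_le_of_hasDeriv {y y' : ℝ → ℤ → ℂ} {t₀ t₁ B : ℝ} (ht : t₀ ≤ t₁) (hB : 0 ≤ B)
    (hy : ∀ t ∈ Set.Icc t₀ t₁, ∀ l,
      HasDerivWithinAt (fun s => y s l) (y' t l) (Set.Icc t₀ t₁) t)
    (hy' : ∀ t ∈ Set.Icc t₀ t₁, nrm (y' t) ≤ ENNReal.ofReal B) :
    nrm (fun l => y t₁ l - y t₀ l) ≤ ENNReal.ofReal (B * (t₁ - t₀)) := by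
  have hst : 0 ≤ t₁ - t₀ := sub_nonneg.2 ht
  rw [nrm_le_ofReal_iff (mul_nonneg hB hst)]
  intro s
  set z : ℤ → ℂ := fun l => y t₁ l - y t₀ l with hz
  set Z := Real.sqrt (∑ l ∈ s, ‖z l‖ ^ 2) with hZ
  have hZ2 : Z ^ 2 = ∑ l ∈ s, ‖z l‖ ^ 2 := Real.sq_sqrt (Finset.sum_nonneg fun _ _ => by positivity)
  have hZ0 : 0 ≤ Z := Real.sqrt_nonneg _
  have hg : ∀ t ∈ Set.Icc t₀ t₁, HasDerivWithinAt
      (fun r => ∑ l ∈ s, (starRingEnd ℂ) (z l) * y r l)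
      (∑ l ∈ s, (starRingEnd ℂ) (z l) * y' t l) (Set.Icc t₀ t₁) t := fun t ht' =>
    HasDerivWithinAt.fun_sum fun l _ => (hy t ht' l).const_mul _
  have hbd : ∀ t ∈ Set.Icc t₀ t₁, ‖∑ l ∈ s, (starRingEnd ℂ) (z l) * y' t l‖ ≤ Z * B := by
    intro t ht'
    have h1 := (nrm_le_ofReal_iff hB _).1 (hy' t ht') s
    calc ‖∑ l ∈ s, (starRingEnd ℂ) (z l) * y' t l‖ ≤ ∑ l ∈ s, ‖z l‖ * ‖y' t l‖ := by
          refine (norm_sum_le _ _).trans (le_of_eq ?_)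
          simp only [norm_mul, RCLike.norm_conj]
      _ ≤ Z * B := by
          rw [← pow_le_pow_iff_left₀ (Finset.sum_nonneg fun _ _ => by positivity)
            (mul_nonneg hZ0 hB) two_ne_zero]
          rw [mul_pow, hZ2]
          exact (Finset.sum_mul_sq_le_sq_mul_sq _ _ _).trans (by gcongr)
  have hmv := (convex_Icc t₀ t₁).norm_image_sub_le_of_norm_hasDerivWithin_le hg hbd
    (Set.left_mem_Icc.2 ht) (Set.right_mem_Icc.2 ht)
  have e : ∑ l ∈ s, (starRingEnd ℂ) (z l) * y t₁ l - ∑ l ∈ s, (starRingEnd ℂ) (z l) * y t₀ l =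
      ((Z ^ 2 : ℝ) : ℂ) := by
    rw [← Finset.sum_sub_distrib, hZ2]
    push_cast
    refine Finset.sum_congr rfl fun l _ => ?_
    rw [← mul_sub, ← Complex.ofReal_pow, ← Complex.normSq_eq_norm_sq, ← Complex.mul_conj, mul_comm]
  rw [e, Complex.norm_real, Real.norm_of_nonneg (sq_nonneg Z), Real.norm_of_nonneg hst] at hmv
  rw [← hZ2]
  apply pow_le_pow_left₀ hZ0
  rcases hZ0.eq_or_lt with h | h
  · rw [← h]; positivity
  · nlinarith

/-! ### Solutions in Fourier variables -/

/-- The Fourier coefficients of `f(u)` for the function `u` with Fourier coefficients `c`. -/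
noncomputable def nonlinCoef (a b ε : ℝ) (c : ℤ → ℂ) : ℤ → ℂ :=
  fourierCoef a b fun x => (nonlin ε (series a b c x).re : ℂ)

/-- The Fourier coefficients `c`, `d` of a solution and of its time derivative. -/
structure FourierSolution (a b ε S : ℝ) (m : ℕ) (K : ℝ) (c d : ℝ → ℤ → ℂ) : Prop where
  conj_c : ∀ t l, c t (-l) = (starRingEnd ℂ) (c t l)
  conj_d : ∀ t l, d t (-l) = (starRingEnd ℂ) (d t l)
  bound_c : ∀ t ∈ Set.Icc 0 S,
    nrm (fun l => (delta a b l : ℂ) ^ (m + 1) * c t l) ≤ ENNReal.ofReal K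
  bound_d : ∀ t ∈ Set.Icc 0 S, nrm (fun l => (delta a b l : ℂ) ^ m * d t l) ≤ ENNReal.ofReal K
  deriv_c : ∀ l, ∀ t ∈ Set.Icc 0 S,
    HasDerivWithinAt (fun s => c s l) (d t l) (Set.Icc 0 S) t
  deriv_d : ∀ l, ∀ t ∈ Set.Icc 0 S, HasDerivWithinAt (fun s => d s l)
    (-(delta a b l : ℂ) ^ 2 * c t l - nonlinCoef a b ε (c t) l) (Set.Icc 0 S) t

lemma nrm_delta_pow_of_sobolevNorm_le {s : ℕ} {u : ℝ → ℂ} {K : ℝ} (hu : MemSobolev a b s u)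
    (h : sobolevNorm a b s u ≤ K) :
    nrm (fun l => (delta a b l : ℂ) ^ s * fourierCoef a b u l) ≤ ENNReal.ofReal K := by
  have e : ∀ l, ‖(delta a b l : ℂ) ^ s * fourierCoef a b u l‖ ^ 2 =
      (1 + mu a b l ^ 2) ^ s * ‖fourierCoef a b u l‖ ^ 2 := fun l => by
    rw [norm_mul, norm_delta_pow, mul_pow, ← delta_sq, ← pow_mul, ← pow_mul, mul_comm s]
  rw [nrm_eq_of_summable (by simpa only [e] using hu.2)]
  simp only [e]
  exact ENNReal.ofReal_le_ofReal h

lemma memSobolev_and_norm_le {s : ℕ} {u : ℝ → ℂ} {K : ℝ} (hK : 0 ≤ K)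
    (hu : MemLp u 2 (volume.restrict (Set.Ioc a b)))
    (h : nrm (fun l => (delta a b l : ℂ) ^ s * fourierCoef a b u l) ≤ ENNReal.ofReal K) :
    MemSobolev a b s u ∧ sobolevNorm a b s u ≤ K := by
  have e : ∀ l, ‖(delta a b l : ℂ) ^ s * fourierCoef a b u l‖ ^ 2 =
      (1 + mu a b l ^ 2) ^ s * ‖fourierCoef a b u l‖ ^ 2 := fun l => by
    rw [norm_mul, norm_delta_pow, mul_pow, ← delta_sq, ← pow_mul, ← pow_mul, mul_comm s]
  have h1 := summable_of_nrm_lt_top (h.trans_lt ENNReal.ofReal_lt_top)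
  have h2 := sqrt_tsum_le_of_nrm_le hK h
  simp only [e] at h1 h2
  exact ⟨⟨hu, h1⟩, h2⟩

/-- The real and imaginary parts of a Fourier mode. -/
noncomputable def cosMode (a b : ℝ) (l : ℤ) (x : ℝ) : ℝ := Real.cos (mu a b l * (x - a))

/-- The imaginary part of a Fourier mode. -/
noncomputable def sinMode (a b : ℝ) (l : ℤ) (x : ℝ) : ℝ := Real.sin (mu a b l * (x - a))

lemma mode_neg_eq (l : ℤ) (x : ℝ) :
    mode a b (-l) x = (cosMode a b l x : ℂ) - Complex.I * (sinMode a b l x : ℂ) := by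
  rw [mode_neg, cosMode, sinMode, ← mul_neg, mul_comm, ← Complex.ofReal_neg, Complex.exp_mul_I,
    ← Complex.ofReal_cos, ← Complex.ofReal_sin, Real.cos_neg, Real.sin_neg]
  push_cast; ring

lemma contDiff_cosMode (l : ℤ) : ContDiff ℝ ∞ (cosMode a b l) := by
  unfold cosMode; fun_prop

lemma contDiff_sinMode (l : ℤ) : ContDiff ℝ ∞ (sinMode a b l) := by
  unfold sinMode; fun_prop

lemma mu_mul_add_period (hab : a < b) (l : ℤ) (x : ℝ) :
    mu a b l * (x + (b - a) - a) = mu a b l * (x - a) + l * (2 * Real.pi) := by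
  have := (sub_pos.2 hab).ne'
  simp only [mu]; field_simp; ring

lemma periodic_cosMode (hab : a < b) (l : ℤ) : Function.Periodic (cosMode a b l) (b - a) :=
  fun x => by rw [cosMode, mu_mul_add_period hab, Real.cos_add_int_mul_two_pi, cosMode]

lemma periodic_sinMode (hab : a < b) (l : ℤ) : Function.Periodic (sinMode a b l) (b - a) :=
  fun x => by rw [sinMode, mu_mul_add_period hab, Real.sin_add_int_mul_two_pi, sinMode]

lemma deriv_cosMode (l : ℤ) :
    deriv (cosMode a b l) = fun x => -mu a b l * sinMode a b l x := by
  funext x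
  have h := ((((hasDerivAt_id x).sub_const a).const_mul (mu a b l)).cos).deriv
  simp only [id, mul_one] at h
  unfold cosMode sinMode
  rw [h]; ring

lemma deriv_sinMode (l : ℤ) :
    deriv (sinMode a b l) = fun x => mu a b l * cosMode a b l x := by
  funext x
  have h := ((((hasDerivAt_id x).sub_const a).const_mul (mu a b l)).sin).deriv
  simp only [id, mul_one] at h
  unfold cosMode sinMode
  rw [h]; ring

lemma deriv_deriv_cosMode (l : ℤ) (x : ℝ) :
    deriv (deriv (cosMode a b l)) x = -mu a b l ^ 2 * cosMode a b l x := by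
  rw [deriv_cosMode, deriv_const_mul_field, deriv_sinMode]; ring

lemma deriv_deriv_sinMode (l : ℤ) (x : ℝ) :
    deriv (deriv (sinMode a b l)) x = -mu a b l ^ 2 * sinMode a b l x := by
  rw [deriv_sinMode, deriv_const_mul_field, deriv_cosMode]; ring

lemma intervalIntegrable_ofReal {u : ℝ → ℝ} (hu : IntervalIntegrable u volume a b) :
    IntervalIntegrable (fun x => (u x : ℂ)) volume a b := ⟨hu.1.ofReal, hu.2.ofReal⟩

lemma fourierCoef_ofReal {u : ℝ → ℝ} (hu : IntervalIntegrable u volume a b) (l : ℤ) :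
    fourierCoef a b (fun x => (u x : ℂ)) l = (1 / ((b - a : ℝ) : ℂ)) *
      (((∫ x in a..b, u x * cosMode a b l x : ℝ) : ℂ) -
        Complex.I * ((∫ x in a..b, u x * sinMode a b l x : ℝ) : ℂ)) := by
  have hc : IntervalIntegrable (fun x => ((u x * cosMode a b l x : ℝ) : ℂ)) volume a b :=
    intervalIntegrable_ofReal (hu.mul_continuousOn (contDiff_cosMode l).continuous.continuousOn)
  have hs : IntervalIntegrable (fun x => ((u x * sinMode a b l x : ℝ) : ℂ)) volume a b :=
    intervalIntegrable_ofReal (hu.mul_continuousOn (contDiff_sinMode l).continuous.continuousOn)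
  rw [fourierCoef_eq, ← intervalIntegral.integral_ofReal, ← intervalIntegral.integral_ofReal,
    ← intervalIntegral.integral_const_mul Complex.I,
    ← intervalIntegral.integral_sub hc (hs.const_mul _)]
  congr 1
  refine intervalIntegral.integral_congr fun x _ => ?_
  simp only [mode_neg_eq]; push_cast; ring

lemma intervalIntegrable_of_memLp_ofReal (hab : a < b) {u : ℝ → ℝ}
    (hu : MemLp (fun x => (u x : ℂ)) 2 (volume.restrict (Set.Ioc a b))) :
    IntervalIntegrable u volume a b := by
  have h := (MemLp.intervalIntegrable_two hab hu)
  rw [intervalIntegrable_iff_integrableOn_Ioc_of_le hab.le] at h ⊢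
  exact (h.re).congr (ae_of_all _ fun x => by simp)

variable {ε S K : ℝ} {m : ℕ} {φ γ : ℝ → ℝ} {w v : ℝ → ℝ → ℝ}

lemma memSobolev_one_summable (hab : a < b) {u : ℝ → ℂ} (h : MemSobolev a b 1 u) :
    Summable fun l => ‖fourierCoef a b u l‖ :=
  summable_norm_of_nrm hab (K := sobolevNorm a b 1 u)
    (delta_mul_le_pow le_rfl (nrm_delta_pow_of_sobolevNorm_le h le_rfl))

/-- The Fourier coefficients of a weak solution solve a system of ordinary differential
equations. -/
lemma IsSolution.fourierSolution (hab : a < b) (h : IsSolution a b ε S φ γ w v)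
    (hb : SobolevBound a b S m K w v) :
    FourierSolution a b ε S m K (fun t => fourierCoef a b fun x => (w t x : ℂ))
      (fun t => fourierCoef a b fun x => (v t x : ℂ)) where
  conj_c t l := fourierCoef_ofReal_neg _ l
  conj_d t l := fourierCoef_ofReal_neg _ l
  bound_c t ht := nrm_delta_pow_of_sobolevNorm_le (hb t ht).1.1 (hb t ht).1.2
  bound_d t ht := nrm_delta_pow_of_sobolevNorm_le (hb t ht).2.1 (hb t ht).2.2
  deriv_c l t ht := by
    have hw := fun s hs => intervalIntegrable_of_memLp_ofReal hab (h.memH1 s hs).1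
    have hv := intervalIntegrable_of_memLp_ofReal hab (h.memL2 t ht).1
    -- The test functions are real, so a complex mode is tested through its cosine and sine parts.
    have h1 := (h.deriv_w _ (contDiff_cosMode l) (periodic_cosMode hab l) t ht).ofReal_comp
    have h2 := (h.deriv_w _ (contDiff_sinMode l) (periodic_sinMode hab l) t ht).ofReal_comp
    have h3 := (h1.sub (h2.const_mul Complex.I)).const_mul (1 / ((b - a : ℝ) : ℂ))
    rw [fourierCoef_ofReal hv]
    refine h3.congr (fun s hs => ?_) ?_
    · rw [fourierCoef_ofReal (hw s hs)]; rfl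
    · rw [fourierCoef_ofReal (hw t ht)]; rfl
  deriv_d l t ht := by
    have hv := fun s hs => intervalIntegrable_of_memLp_ofReal hab (h.memL2 s hs).1
    have hw := intervalIntegrable_of_memLp_ofReal hab (h.memH1 t ht).1
    have h1 := (h.deriv_v _ (contDiff_cosMode l) (periodic_cosMode hab l) t ht).ofReal_comp
    have h2 := (h.deriv_v _ (contDiff_sinMode l) (periodic_sinMode hab l) t ht).ofReal_comp
    have h3 := (h1.sub (h2.const_mul Complex.I)).const_mul (1 / ((b - a : ℝ) : ℂ))
    have hsum := memSobolev_one_summable hab (h.memH1 t ht)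
    have hs : IntervalIntegrable (fun x => 1 / ε * Real.sin (ε * w t x)) volume a b := by
      rw [intervalIntegrable_iff_integrableOn_Ioc_of_le hab.le] at hw ⊢
      refine Integrable.const_mul ?_ _
      refine Integrable.of_bound (C := 1) ?_ (ae_of_all _ fun x => ?_)
      · exact Real.continuous_sin.comp_aestronglyMeasurable (hw.aestronglyMeasurable.const_mul ε)
      · exact Real.abs_sin_le_one _
    have hfun : ∀ᵐ x ∂volume.restrict (Set.Ioc a b),
        w t x = (series a b (fourierCoef a b fun x => (w t x : ℂ)) x).re := by
      filter_upwards [ae_eq_series hab (h.memH1 t ht).1 hsum] with x hx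
      rw [← hx, Complex.ofReal_re]
    have hF : nonlinCoef a b ε (fourierCoef a b fun x => (w t x : ℂ)) l =
        fourierCoef a b (fun x => ((1 / ε * Real.sin (ε * w t x) : ℝ) : ℂ)) l -
          fourierCoef a b (fun x => (w t x : ℂ)) l := by
      rw [← fourierCoef_sub (intervalIntegrable_ofReal hs) (intervalIntegrable_ofReal hw), nonlinCoef]
      refine congrFun (fourierCoef_congr_ae hab ?_) l
      filter_upwards [hfun] with x hx
      rw [← hx, nonlin]; push_cast; ring
    -- The `-y` in the nonlinearity is the mass term: it moves the `1` of `δ² = 1 + μ²` to the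
    -- linear part.
    have hval : -(delta a b l : ℂ) ^ 2 * fourierCoef a b (fun x => (w t x : ℂ)) l -
        nonlinCoef a b ε (fourierCoef a b fun x => (w t x : ℂ)) l =
        -(mu a b l : ℂ) ^ 2 * fourierCoef a b (fun x => (w t x : ℂ)) l -
          fourierCoef a b (fun x => ((1 / ε * Real.sin (ε * w t x) : ℝ) : ℂ)) l := by
      rw [hF, ← Complex.ofReal_pow, delta_sq]; push_cast; ring
    rw [hval, fourierCoef_ofReal hw, fourierCoef_ofReal hs]
    have h4 : HasDerivWithinAt (fun s => fourierCoef a b (fun x => (v s x : ℂ)) l) _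
        (Set.Icc 0 S) t :=
      h3.congr (fun s hs => by rw [fourierCoef_ofReal (hv s hs)]; rfl)
        (by rw [fourierCoef_ofReal (hv t ht)]; rfl)
    refine h4.congr_deriv ?_
    have e1 : ∀ x, w t x * deriv (deriv (cosMode a b l)) x =
        -mu a b l ^ 2 * (w t x * cosMode a b l x) := fun x => by
      rw [deriv_deriv_cosMode]; ring
    have e2 : ∀ x, w t x * deriv (deriv (sinMode a b l)) x =
        -mu a b l ^ 2 * (w t x * sinMode a b l x) := fun x => by
      rw [deriv_deriv_sinMode]; ring
    simp only [e1, e2, intervalIntegral.integral_const_mul]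
    push_cast
    ring

end SineGordon

/-! ### Slow motion of the twisted variable, and free waves. -/

namespace SineGordon

open MeasureTheory Filter Topology
open scoped ENNReal NNReal

variable {a b : ℝ}

/-! ### The twisted variable -/

/-- The phase factor `e^{iθt}`. -/
noncomputable def phase (θ t : ℝ) : ℂ := Complex.exp (Complex.I * ((θ * t : ℝ) : ℂ))

lemma norm_phase (θ t : ℝ) : ‖phase θ t‖ = 1 := by
  rw [phase, mul_comm, Complex.norm_exp_ofReal_mul_I]

lemma phase_add (θ η t : ℝ) : phase (θ + η) t = phase θ t * phase η t := by
  rw [phase, phase, phase, ← Complex.exp_add]; congr 1; push_cast; ring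

lemma phase_add_right (θ s t : ℝ) : phase θ (s + t) = phase θ s * phase θ t := by
  rw [phase, phase, phase, ← Complex.exp_add]; congr 1; push_cast; ring

lemma phase_zero_right (θ : ℝ) : phase θ 0 = 1 := by simp [phase]

lemma phase_zero_left (t : ℝ) : phase 0 t = 1 := by simp [phase]

lemma conj_phase (θ t : ℝ) : (starRingEnd ℂ) (phase θ t) = phase (-θ) t := by
  rw [phase, phase, ← Complex.exp_conj]; simp

lemma phase_neg_mul (θ t : ℝ) : phase (-θ) t * phase θ t = 1 := by
  rw [← phase_add, neg_add_cancel, phase_zero_left]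

lemma hasDerivAt_phase (θ t : ℝ) :
    HasDerivAt (phase θ) (Complex.I * θ * phase θ t) t := by
  have h1 : HasDerivAt (fun s : ℝ => Complex.I * ((θ * s : ℝ) : ℂ)) (Complex.I * θ) t := by
    have := (((hasDerivAt_id t).const_mul θ).ofReal_comp).const_mul Complex.I
    simpa using this
  have := h1.cexp
  rw [mul_comm] at this
  exact this

lemma norm_phase_sub_le (θ s t : ℝ) : ‖phase θ t - phase θ s‖ ≤ |θ| * |t - s| := by
  have e : phase θ t - phase θ s = phase θ s * (phase θ (t - s) - 1) := by
    rw [mul_sub, ← phase_add_right, mul_one]; congr 2; ring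
  rw [e, norm_mul, norm_phase, one_mul, ← abs_mul]
  exact Real.norm_exp_I_mul_ofReal_sub_one_le

lemma nrm_phase_mul (θ : ℤ → ℝ) (t : ℝ) (c : ℤ → ℂ) :
    nrm (fun l => phase (θ l) t * c l) = nrm c :=
  nrm_congr_norm fun l => by rw [norm_mul, norm_phase, one_mul]

lemma enorm_I : ‖Complex.I‖ₑ = 1 := by rw [← ofReal_norm]; simp

/-- The complex variable `ψ = w - i⟨∇⟩⁻¹∂_t w`. -/
noncomputable def psiCoef (a b : ℝ) (c d : ℝ → ℤ → ℂ) (t : ℝ) (l : ℤ) : ℂ :=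
  c t l - Complex.I * d t l / delta a b l

/-- The twisted variable `e^{-it⟨∇⟩}ψ(t)`. -/
noncomputable def twisted (a b : ℝ) (c d : ℝ → ℤ → ℂ) (t : ℝ) (l : ℤ) : ℂ :=
  phase (-delta a b l) t * psiCoef a b c d t l

variable {ε S K : ℝ} {m : ℕ} {c d : ℝ → ℤ → ℂ}

lemma psiCoef_eq_phase_mul (t : ℝ) (l : ℤ) :
    psiCoef a b c d t l = phase (delta a b l) t * twisted a b c d t l := by
  rw [twisted, ← mul_assoc, mul_comm (phase _ _), phase_neg_mul, one_mul]

namespace FourierSolution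

/-- Since `w` and `∂_t w` are real, conjugating `ψ` only flips the sign of its imaginary part; hence
both are recovered from `ψ` and its conjugate. -/
lemma conj_psiCoef_neg (h : FourierSolution a b ε S m K c d) (t : ℝ) (l : ℤ) :
    (starRingEnd ℂ) (psiCoef a b c d t (-l)) = c t l + Complex.I * d t l / delta a b l := by
  simp only [psiCoef, h.conj_c, h.conj_d, delta_neg, map_sub, map_div₀, map_mul, Complex.conj_conj,
    Complex.conj_I, Complex.conj_ofReal]
  ring

lemma c_eq (h : FourierSolution a b ε S m K c d) (t : ℝ) (l : ℤ) :
    c t l = (1 / 2) * (psiCoef a b c d t l + (starRingEnd ℂ) (psiCoef a b c d t (-l))) := by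
  rw [h.conj_psiCoef_neg, psiCoef]; ring

lemma d_eq (h : FourierSolution a b ε S m K c d) (t : ℝ) (l : ℤ) :
    d t l = Complex.I / 2 * delta a b l *
      (psiCoef a b c d t l - (starRingEnd ℂ) (psiCoef a b c d t (-l))) := by
  rw [h.conj_psiCoef_neg, psiCoef]
  have := delta_ne (a := a) (b := b) l
  field_simp
  ring_nf
  simp [Complex.I_sq]

lemma c_eq_twisted (h : FourierSolution a b ε S m K c d) (t : ℝ) (l : ℤ) :
    c t l = (1 / 2) * (phase (delta a b l) t * twisted a b c d t l +
      phase (-delta a b l) t * (starRingEnd ℂ) (twisted a b c d t (-l))) := by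
  rw [h.c_eq, psiCoef_eq_phase_mul, psiCoef_eq_phase_mul, map_mul, conj_phase, delta_neg]

lemma nrm_psiCoef_le (h : FourierSolution a b ε S m K c d) {t : ℝ}
    (ht : t ∈ Set.Icc 0 S) :
    nrm (fun l => (delta a b l : ℂ) ^ (m + 1) * psiCoef a b c d t l) ≤ ENNReal.ofReal (2 * K) := by
  have e : (fun l => (delta a b l : ℂ) ^ (m + 1) * psiCoef a b c d t l) = fun l =>
      (delta a b l : ℂ) ^ (m + 1) * c t l - Complex.I * ((delta a b l : ℂ) ^ m * d t l) := by
    funext l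
    have := delta_ne (a := a) (b := b) l
    rw [psiCoef, pow_succ]; field_simp
  rw [e]
  refine (nrm_sub_le _ _).trans ?_
  rw [nrm_const_mul, two_mul]
  -- The sign of `K` is not assumed; for `K ≤ 0` both sides are zero.
  have hK : ∀ K : ℝ, ENNReal.ofReal K + ENNReal.ofReal K = ENNReal.ofReal (K + K) := fun K => by
    rcases le_total 0 K with h | h
    · rw [ENNReal.ofReal_add h h]
    · rw [ENNReal.ofReal_of_nonpos h, ENNReal.ofReal_of_nonpos (by linarith), add_zero]
  rw [← hK]
  refine add_le_add (h.bound_c t ht) ?_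
  rw [enorm_I, one_mul]; exact h.bound_d t ht

lemma nrm_twisted_le (h : FourierSolution a b ε S m K c d) {t : ℝ}
    (ht : t ∈ Set.Icc 0 S) :
    nrm (fun l => (delta a b l : ℂ) ^ (m + 1) * twisted a b c d t l) ≤ ENNReal.ofReal (2 * K) := by
  refine le_trans (nrm_mono fun l => ?_) (h.nrm_psiCoef_le ht)
  rw [twisted, norm_mul, norm_mul, norm_mul, norm_phase, one_mul]

/-- From `ψ' = iδψ + iF/δ`: the phase factor cancels the linear flow, and the factor `δ` on the left
cancels the one in the denominator. -/
lemma hasDeriv_twisted (h : FourierSolution a b ε S m K c d) (l : ℤ) {t : ℝ}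
    (ht : t ∈ Set.Icc 0 S) :
    HasDerivWithinAt (fun s => (delta a b l : ℂ) * twisted a b c d s l)
      (Complex.I * (phase (-delta a b l) t * nonlinCoef a b ε (c t) l)) (Set.Icc 0 S) t := by
  have h1 := (h.deriv_c l t ht).sub (((h.deriv_d l t ht).const_mul Complex.I).div_const
    (delta a b l : ℂ))
  have h2 := (((hasDerivAt_phase (-delta a b l) t).hasDerivWithinAt (s := Set.Icc 0 S)).mul
    h1).const_mul (delta a b l : ℂ)
  refine (h2.congr_deriv ?_)
  have := delta_ne (a := a) (b := b) l
  push_cast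
  simp only [Pi.sub_apply]
  field_simp
  ring_nf
  simp only [Complex.I_sq]
  ring

lemma summable_c (h : FourierSolution a b ε S m K c d) (hab : a < b) {t : ℝ}
    (ht : t ∈ Set.Icc 0 S) : Summable fun l => ‖c t l‖ :=
  summable_norm_of_nrm hab (delta_mul_le_pow (by omega) (h.bound_c t ht))

lemma norm_series_c_le (h : FourierSolution a b ε S m K c d) (hab : a < b) (hK : 0 ≤ K) {t : ℝ}
    (ht : t ∈ Set.Icc 0 S) (x : ℝ) : ‖series a b (c t) x‖ ≤ embConst a b * K :=
  (norm_series_le (h.summable_c hab ht) x).trans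
    (tsum_norm_le_of_nrm hab hK (delta_mul_le_pow (by omega) (h.bound_c t ht)))

lemma bound_c_one (h : FourierSolution a b ε S m K c d) {t : ℝ} (ht : t ∈ Set.Icc 0 S) :
    nrm (fun l => (delta a b l : ℂ) ^ 1 * c t l) ≤ ENNReal.ofReal K := by
  simp only [pow_one]
  exact delta_mul_le_pow (by omega) (h.bound_c t ht)

lemma nrm_nonlinCoef_le (h : FourierSolution a b ε S m K c d) (hab : a < b) (hK : 0 ≤ K)
    (hε : 0 < ε) (hε1 : ε ≤ 1) {t : ℝ} (ht : t ∈ Set.Icc 0 S) :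
    nrm (nonlinCoef a b ε (c t)) ≤ ENNReal.ofReal (ε ^ 2 * compConst a b 1 K) :=
  nrm_le_of_pow (s := 1) (c := nonlinCoef a b ε (c t))
    (nrm_nonlin_le hab le_rfl (h.conj_c t) hK (h.bound_c_one ht) hε hε1)

lemma nrm_c_sub_le (h : FourierSolution a b ε S m K c d) (hK : 0 ≤ K) {s t : ℝ}
    (hs : 0 ≤ s) (hst : s ≤ t) (ht : t ≤ S) :
    nrm (fun l => c t l - c s l) ≤ ENNReal.ofReal (K * (t - s)) := by
  have hsub : Set.Icc s t ⊆ Set.Icc 0 S := Set.Icc_subset_Icc hs ht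
  exact nrm_sub_le_of_hasDeriv hst hK (fun r hr l => (h.deriv_c l r (hsub hr)).mono hsub)
    fun r hr => nrm_le_of_pow (h.bound_d r (hsub hr))

/-- The twisted variable moves in `H¹` at speed `O(ε²)`. This makes the frozen free wave accurate
and bounds the variation of the amplitudes up to time `T/ε²`. -/
lemma nrm_twisted_sub_le (h : FourierSolution a b ε S m K c d) (hab : a < b) (hK : 0 ≤ K)
    (hε : 0 < ε) (hε1 : ε ≤ 1) {s t : ℝ} (hs : 0 ≤ s) (hst : s ≤ t) (ht : t ≤ S) :
    nrm (fun l => (delta a b l : ℂ) * (twisted a b c d t l - twisted a b c d s l)) ≤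
      ENNReal.ofReal (ε ^ 2 * compConst a b 1 K * (t - s)) := by
  have hsub : Set.Icc s t ⊆ Set.Icc 0 S := Set.Icc_subset_Icc hs ht
  have e : (fun l => (delta a b l : ℂ) * (twisted a b c d t l - twisted a b c d s l)) = fun l =>
      (delta a b l : ℂ) * twisted a b c d t l - (delta a b l : ℂ) * twisted a b c d s l := by
    funext l; ring
  rw [e]
  refine nrm_sub_le_of_hasDeriv (y := fun t l => (delta a b l : ℂ) * twisted a b c d t l)
    (y' := fun t l => Complex.I * (phase (-delta a b l) t * nonlinCoef a b ε (c t) l)) hst (mul_nonneg (sq_nonneg ε) (compConst_nonneg hK))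
    (fun r hr l => (h.hasDeriv_twisted l (hsub hr)).mono hsub) fun r hr => ?_
  rw [nrm_const_mul, nrm_phase_mul, enorm_I, one_mul]
  exact h.nrm_nonlinCoef_le hab hK hε hε1 (hsub hr)

end FourierSolution

/-! ### The cubic part of the nonlinearity -/

/-- The Fourier coefficients of the cube of a function. -/
noncomputable def cubeCoef (a b : ℝ) (u : ℝ → ℂ) : ℤ → ℂ := fourierCoef a b fun x => u x ^ 3

/-- The Fourier coefficients of the remainder of the nonlinearity after the cubic term. -/
noncomputable def quintCoef (a b ε : ℝ) (c : ℤ → ℂ) : ℤ → ℂ :=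
  fourierCoef a b fun x => (quint ε (series a b c x).re : ℂ)

lemma nonlinCoef_eq {c : ℤ → ℂ} (hc : Summable fun l => ‖c l‖)
    (hs : ∀ l, c (-l) = (starRingEnd ℂ) (c l)) (l : ℤ) :
    nonlinCoef a b ε c l =
      quintCoef a b ε c l - (ε : ℂ) ^ 2 / 6 * cubeCoef a b (series a b c) l := by
  have hcont := continuous_series (a := a) (b := b) hc
  have h1 : Continuous fun x => (quint ε (series a b c x).re : ℂ) :=
    Complex.continuous_ofReal.comp ((continuous_quint ε).comp (Complex.continuous_re.comp hcont))
  have h2 : Continuous fun x => (ε : ℂ) ^ 2 / 6 * series a b c x ^ 3 := by fun_prop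
  rw [quintCoef, cubeCoef, ← fourierCoef_const_mul, ← fourierCoef_sub
    (h1.intervalIntegrable _ _) (h2.intervalIntegrable _ _), nonlinCoef]
  congr 1
  funext x
  nth_rewrite 3 [← series_eq_ofReal_re hs]
  rw [quint]; push_cast; ring

lemma norm_cube_sub_le {z w : ℂ} {B : ℝ} (hz : ‖z‖ ≤ B) (hw : ‖w‖ ≤ B) :
    ‖z ^ 3 - w ^ 3‖ ≤ 3 * B ^ 2 * ‖z - w‖ := by
  have e : z ^ 3 - w ^ 3 = (z ^ 2 + z * w + w ^ 2) * (z - w) := by ring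
  have hB : 0 ≤ B := (norm_nonneg z).trans hz
  rw [e, norm_mul]
  gcongr
  calc _ ≤ ‖z ^ 2‖ + ‖z * w‖ + ‖w ^ 2‖ := norm_add₃_le
    _ ≤ B ^ 2 + B * B + B ^ 2 := by
      rw [norm_pow, norm_pow, norm_mul]; gcongr
    _ = _ := by ring

lemma nrm_cubeCoef_sub_le (hab : a < b) {u v : ℝ → ℂ} (hu : Continuous u) (hv : Continuous v)
    {B : ℝ} (huB : ∀ x, ‖u x‖ ≤ B) (hvB : ∀ x, ‖v x‖ ≤ B) :
    nrm (fun l => cubeCoef a b u l - cubeCoef a b v l) ≤ ENNReal.ofReal (3 * B ^ 2) *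
      nrm (fun l => fourierCoef a b u l - fourierCoef a b v l) := by
  have e1 : (fun l => cubeCoef a b u l - cubeCoef a b v l) =
      fourierCoef a b (fun x => u x ^ 3 - v x ^ 3) := by
    funext l
    rw [fourierCoef_sub (u := fun x => u x ^ 3) (v := fun x => v x ^ 3) ((hu.pow 3).intervalIntegrable _ _) ((hv.pow 3).intervalIntegrable _ _)]
    rfl
  have e2 : (fun l => fourierCoef a b u l - fourierCoef a b v l) =
      fourierCoef a b (fun x => u x - v x) := by
    funext l
    rw [fourierCoef_sub (hu.intervalIntegrable _ _) (hv.intervalIntegrable _ _)]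
  rw [e1, e2]
  exact nrm_fourierCoef_le hab (by positivity)
    (memLp_of_continuousOn ((hu.pow 3).sub (hv.pow 3)).continuousOn)
    (memLp_of_continuousOn (hu.sub hv).continuousOn)
    fun x _ => norm_cube_sub_le (huB x) (hvB x)

/-- The pointwise Lipschitz bound carries over to coefficients by Parseval, so only the `L²` size of
the difference enters. -/
lemma nrm_quintCoef_sub_le (hab : a < b) (hε : 0 < ε) {c c' : ℤ → ℂ}
    (hc : Summable fun l => ‖c l‖) (hc' : Summable fun l => ‖c' l‖)
    {B : ℝ} (hcB : ∀ x, ‖series a b c x‖ ≤ B) (hcB' : ∀ x, ‖series a b c' x‖ ≤ B) :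
    nrm (fun l => quintCoef a b ε c l - quintCoef a b ε c' l) ≤
      ENNReal.ofReal (ε ^ 4 * B ^ 4) * nrm (fun l => c l - c' l) := by
  have h1 := continuous_series (a := a) (b := b) hc
  have h2 := continuous_series (a := a) (b := b) hc'
  have h3 : ∀ {c : ℤ → ℂ}, Continuous (series a b c) →
      Continuous fun x => (quint ε (series a b c x).re : ℂ) := fun hcont =>
    Complex.continuous_ofReal.comp ((continuous_quint ε).comp (Complex.continuous_re.comp hcont))
  have e1 : (fun l => quintCoef a b ε c l - quintCoef a b ε c' l) =
      fourierCoef a b (fun x => (quint ε (series a b c x).re : ℂ) -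
        (quint ε (series a b c' x).re : ℂ)) := by
    funext l
    rw [fourierCoef_sub ((h3 h1).intervalIntegrable _ _) ((h3 h2).intervalIntegrable _ _)]
    rfl
  have e2 : (fun l => c l - c' l) =
      fourierCoef a b (fun x => series a b c x - series a b c' x) := by
    funext l
    rw [fourierCoef_sub (h1.intervalIntegrable _ _) (h2.intervalIntegrable _ _),
      fourierCoef_series hab hc, fourierCoef_series hab hc']
  rw [e1, e2]
  refine nrm_fourierCoef_le hab (by positivity)
    (memLp_of_continuousOn ((h3 h1).sub (h3 h2)).continuousOn)
    (memLp_of_continuousOn (h1.sub h2).continuousOn) fun x _ => ?_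
  rw [← Complex.ofReal_sub, Complex.norm_real, Real.norm_eq_abs]
  refine (abs_quint_sub_le hε ((Complex.abs_re_le_norm _).trans (hcB x))
    ((Complex.abs_re_le_norm _).trans (hcB' x))).trans ?_
  gcongr
  rw [← Complex.sub_re]
  exact Complex.abs_re_le_norm _

/-! ### Truncated free waves and the interaction of three modes -/

/-- The amplitude of the wave with index `(σ, l)` in the free solution with twisted variable
`Ψ`. -/
noncomputable def amp (Ψ : ℤ → ℂ) (p : Bool × ℤ) : ℂ :=
  if p.1 then 1 / 2 * Ψ p.2 else 1 / 2 * (starRingEnd ℂ) (Ψ (-p.2))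

/-- The time frequency of the wave with index `(σ, l)`. -/
noncomputable def freqOf (a b : ℝ) (p : Bool × ℤ) : ℝ :=
  if p.1 then delta a b p.2 else -delta a b p.2

lemma abs_freqOf (p : Bool × ℤ) : |freqOf a b p| = delta a b p.2 := by
  rw [freqOf]
  split_ifs
  · exact abs_of_pos (delta_pos _)
  · rw [abs_neg]; exact abs_of_pos (delta_pos _)

/-- The indices of the waves with space frequencies in `L`. -/
def waveIdx (L : Finset ℤ) : Finset (Bool × ℤ) := Finset.univ ×ˢ L

lemma sum_waveIdx {β : Type*} [AddCommMonoid β] (L : Finset ℤ) (f : Bool × ℤ → β) :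
    ∑ p ∈ waveIdx L, f p = ∑ l ∈ L, (f (true, l) + f (false, l)) := by
  rw [waveIdx, Finset.sum_product, Fintype.sum_bool, ← Finset.sum_add_distrib]

lemma amp_sub (Ψ Ψ' : ℤ → ℂ) (p : Bool × ℤ) :
    amp Ψ p - amp Ψ' p = amp (fun l => Ψ l - Ψ' l) p := by
  simp only [amp]
  split_ifs
  · ring
  · rw [map_sub]; ring

lemma sum_norm_amp_le (L : Finset ℤ) {Ψ : ℤ → ℂ} (hΨ : Summable fun l => ‖Ψ l‖) :
    ∑ p ∈ waveIdx L, ‖amp Ψ p‖ ≤ ∑' l, ‖Ψ l‖ := by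
  have h1 : ∑ l ∈ L, ‖Ψ l‖ ≤ ∑' l, ‖Ψ l‖ := hΨ.sum_le_tsum _ fun _ _ => norm_nonneg _
  have h2 : ∑ l ∈ L, ‖Ψ (-l)‖ ≤ ∑' l, ‖Ψ l‖ := by
    rw [← (Equiv.neg ℤ).tsum_eq fun l => ‖Ψ l‖]
    exact ((Equiv.neg ℤ).summable_iff.2 hΨ).sum_le_tsum _ fun _ _ => norm_nonneg _
  rw [sum_waveIdx, Finset.sum_add_distrib]
  simp only [amp, if_true, Bool.false_eq_true, if_false, norm_mul, RCLike.norm_conj,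
    ← Finset.mul_sum]
  norm_num
  linarith

/-- The nonnegative amplitudes `x` summed over the waves with a given space frequency. -/
noncomputable def collect (L : Finset ℤ) (x : Bool × ℤ → ℝ) (l : ℤ) : ℂ :=
  ∑ p ∈ waveIdx L, if p.2 = l then (x p : ℂ) else 0

/-- At frequency `l` the two time directions contribute `½|Ψ_l|` and `½|Ψ_{-l}|`, and reflection
preserves the norm. -/
lemma nrm_collect_amp_le (L : Finset ℤ) (Ψ : ℤ → ℂ) :
    nrm (collect L fun p => ‖amp Ψ p‖) ≤ nrm Ψ := by
  have h : ∀ l, ‖collect L (fun p => ‖amp Ψ p‖) l‖ ≤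
      ‖((1 / 2 * ‖Ψ l‖ : ℝ) : ℂ) + ((1 / 2 * ‖Ψ (-l)‖ : ℝ) : ℂ)‖ := fun l => by
    rw [← Complex.ofReal_add, Complex.norm_real, Real.norm_of_nonneg (by positivity), collect,
      sum_waveIdx]
    simp only [amp, if_true, Bool.false_eq_true, if_false, norm_mul, RCLike.norm_conj]
    have e : ∀ k ∈ L, ((if k = l then ((‖(1 / 2 : ℂ)‖ * ‖Ψ k‖ : ℝ) : ℂ) else 0) +
        if k = l then ((‖(1 / 2 : ℂ)‖ * ‖Ψ (-k)‖ : ℝ) : ℂ) else 0) =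
        if k = l then ((1 / 2 * ‖Ψ l‖ + 1 / 2 * ‖Ψ (-l)‖ : ℝ) : ℂ) else 0 := fun k _ => by
      split_ifs with hk
      · subst hk; push_cast; norm_num
      · simp
    rw [Finset.sum_congr rfl e, Finset.sum_ite_eq']
    split_ifs
    · rw [Complex.norm_real, Real.norm_of_nonneg (by positivity)]
    · rw [norm_zero]; positivity
  refine (nrm_mono h).trans ((nrm_add_le _ _).trans ?_)
  have h1 : nrm (fun l => ((1 / 2 * ‖Ψ l‖ : ℝ) : ℂ)) = ENNReal.ofReal (1 / 2) * nrm Ψ := by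
    have : ENNReal.ofReal (1 / 2) = ‖(1 / 2 : ℂ)‖ₑ := by rw [← ofReal_norm]; norm_num
    rw [this, ← nrm_const_mul]
    exact nrm_congr_norm fun l => by
      rw [Complex.norm_real, Real.norm_of_nonneg (by positivity), norm_mul]; norm_num
  have h2 := nrm_comp_equiv (Equiv.neg ℤ) fun l => ((1 / 2 * ‖Ψ l‖ : ℝ) : ℂ)
  simp only [Equiv.neg_apply] at h2
  rw [h2, h1, ← add_mul, ← ENNReal.ofReal_add (by norm_num) (by norm_num)]
  norm_num

/-- The trilinear interaction of the waves with space frequencies in `L`. -/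
noncomputable def tri (L : Finset ℤ) (x y z : Bool × ℤ → ℝ) (l : ℤ) : ℂ :=
  ∑ p ∈ waveIdx L, ∑ q ∈ waveIdx L, ∑ r ∈ waveIdx L,
    if p.2 + q.2 + r.2 = l then ((x p * y q * z r : ℝ) : ℂ) else 0

/-- With `tri_swap_right`, this lets any of the three factors be the one measured in `ℓ²`. -/
lemma tri_swap (L : Finset ℤ) (x y z : Bool × ℤ → ℝ) : tri L x y z = tri L y x z := by
  funext l
  rw [tri, Finset.sum_comm, tri]
  refine Finset.sum_congr rfl fun p _ => Finset.sum_congr rfl fun q _ =>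
    Finset.sum_congr rfl fun r _ => ?_
  rw [add_comm q.2, mul_comm (x q)]

lemma tri_swap_right (L : Finset ℤ) (x y z : Bool × ℤ → ℝ) : tri L x y z = tri L x z y := by
  funext l
  rw [tri, tri]
  refine Finset.sum_congr rfl fun p _ => ?_
  rw [Finset.sum_comm]
  refine Finset.sum_congr rfl fun q _ => Finset.sum_congr rfl fun r _ => ?_
  rw [add_right_comm, mul_right_comm]

/-- Young's inequality `ℓ² * ℓ¹ * ℓ¹ ⊂ ℓ²`: the interaction is a combination of translates of
`collect L x` with weights `y q * z r`. -/
lemma nrm_tri_le (L : Finset ℤ) (x : Bool × ℤ → ℝ) {y z : Bool × ℤ → ℝ} (hy : ∀ p, 0 ≤ y p)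
    (hz : ∀ p, 0 ≤ z p) {X Y Z : ℝ} (hY0 : 0 ≤ Y)
    (hX : nrm (collect L x) ≤ ENNReal.ofReal X)
    (hY : ∑ p ∈ waveIdx L, y p ≤ Y) (hZ : ∑ p ∈ waveIdx L, z p ≤ Z) :
    nrm (tri L x y z) ≤ ENNReal.ofReal (Y * Z * X) := by
  have e : tri L x y z = fun l => ∑ q ∈ waveIdx L, ∑ r ∈ waveIdx L,
      ((y q * z r : ℝ) : ℂ) * collect L x (l - (q.2 + r.2)) := by
    funext l
    rw [tri, Finset.sum_comm]
    refine Finset.sum_congr rfl fun q _ => ?_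
    rw [Finset.sum_comm]
    refine Finset.sum_congr rfl fun r _ => ?_
    rw [collect, Finset.mul_sum]
    refine Finset.sum_congr rfl fun p _ => ?_
    by_cases h : p.2 + q.2 + r.2 = l
    · rw [if_pos h, if_pos (by omega)]; push_cast; ring
    · rw [if_neg h, if_neg (by omega), mul_zero]
  have hZ0 : 0 ≤ Z := (Finset.sum_nonneg fun p _ => hz p).trans hZ
  have hterm : ∀ q r : Bool × ℤ,
      nrm (fun l => ((y q * z r : ℝ) : ℂ) * collect L x (l - (q.2 + r.2))) ≤
        ENNReal.ofReal (y q * z r) * ENNReal.ofReal X := fun q r => by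
    have h0 := mul_nonneg (hy q) (hz r)
    rw [nrm_const_mul, ← ofReal_norm, Complex.norm_real, Real.norm_of_nonneg h0]
    have := nrm_comp_equiv (Equiv.subRight (q.2 + r.2)) (collect L x)
    simp only [Equiv.subRight_apply] at this
    rw [this]
    gcongr
  rw [e]
  refine (nrm_sum_le _ _).trans ?_
  refine (Finset.sum_le_sum fun q _ => (nrm_sum_le _ _).trans
    (Finset.sum_le_sum fun r _ => hterm q r)).trans ?_
  simp only [← Finset.sum_mul]
  rw [ENNReal.ofReal_mul (mul_nonneg hY0 hZ0)]
  gcongr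
  have : ∀ q ∈ waveIdx L, ∑ r ∈ waveIdx L, ENNReal.ofReal (y q * z r) =
      ENNReal.ofReal (∑ r ∈ waveIdx L, y q * z r) := fun q _ =>
    (ENNReal.ofReal_sum_of_nonneg fun r _ => mul_nonneg (hy q) (hz r)).symm
  rw [Finset.sum_congr rfl this, ← ENNReal.ofReal_sum_of_nonneg fun q _ =>
    Finset.sum_nonneg fun r _ => mul_nonneg (hy q) (hz r)]
  apply ENNReal.ofReal_le_ofReal
  simp only [← Finset.mul_sum, ← Finset.sum_mul]
  exact mul_le_mul hY hZ (Finset.sum_nonneg fun p _ => hz p) hY0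

/-- The truncated free wave with twisted variable `Ψ`. -/
noncomputable def wave (a b : ℝ) (L : Finset ℤ) (Ψ : ℤ → ℂ) (t x : ℝ) : ℂ :=
  ∑ p ∈ waveIdx L, amp Ψ p * phase (freqOf a b p) t * mode a b p.2 x

lemma continuous_wave (L : Finset ℤ) (Ψ : ℤ → ℂ) (t : ℝ) : Continuous (wave a b L Ψ t) := by
  unfold wave; fun_prop

lemma norm_wave_le (L : Finset ℤ) {Ψ : ℤ → ℂ} (hΨ : Summable fun l => ‖Ψ l‖) (t x : ℝ) :
    ‖wave a b L Ψ t x‖ ≤ ∑' l, ‖Ψ l‖ := by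
  refine (norm_sum_le _ _).trans (le_trans (le_of_eq ?_) (sum_norm_amp_le L hΨ))
  simp only [norm_mul_mode]
  simp only [norm_mul, norm_phase, mul_one]

lemma fourierCoef_wave (hab : a < b) (L : Finset ℤ) (Ψ : ℤ → ℂ) (t : ℝ) (l : ℤ) :
    fourierCoef a b (wave a b L Ψ t) l = if l ∈ L then
      (1 / 2) * (phase (delta a b l) t * Ψ l +
        phase (-delta a b l) t * (starRingEnd ℂ) (Ψ (-l))) else 0 := by
  have : fourierCoef a b (wave a b L Ψ t) l =
      ∑ p ∈ waveIdx L, amp Ψ p * phase (freqOf a b p) t * if p.2 = l then 1 else 0 := by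
    unfold wave
    rw [fourierCoef_sum _ fun p _ => (continuous_const.mul
      (continuous_mode p.2)).intervalIntegrable _ _]
    simp only [fourierCoef_const_mul, fourierCoef_mode hab]
  rw [this, sum_waveIdx]
  simp only [amp, freqOf, if_true, Bool.false_eq_true, if_false]
  simp only [mul_ite, mul_one, mul_zero]
  rw [Finset.sum_add_distrib, Finset.sum_ite_eq', Finset.sum_ite_eq']
  split_ifs
  · ring
  · simp

/-- The time frequency of the interaction of three waves. -/
noncomputable def freqSum (a b : ℝ) (p q r : Bool × ℤ) : ℝ :=
  freqOf a b p + freqOf a b q + freqOf a b r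

lemma cubeCoef_wave (hab : a < b) (L : Finset ℤ) (Ψ : ℤ → ℂ) (t : ℝ) (l : ℤ) :
    cubeCoef a b (wave a b L Ψ t) l =
      ∑ p ∈ waveIdx L, ∑ q ∈ waveIdx L, ∑ r ∈ waveIdx L, if p.2 + q.2 + r.2 = l then
        amp Ψ p * amp Ψ q * amp Ψ r * phase (freqSum a b p q r) t else 0 := by
  have e : (fun x => wave a b L Ψ t x ^ 3) = fun x =>
      ∑ p ∈ waveIdx L, ∑ q ∈ waveIdx L, ∑ r ∈ waveIdx L,
        (amp Ψ p * amp Ψ q * amp Ψ r * phase (freqSum a b p q r) t) *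
          mode a b (p.2 + q.2 + r.2) x := by
    funext x
    rw [pow_succ, pow_two, wave, Finset.sum_mul_sum, Finset.sum_mul]
    refine Finset.sum_congr rfl fun p _ => ?_
    rw [Finset.sum_mul]
    refine Finset.sum_congr rfl fun q _ => ?_
    rw [Finset.mul_sum]
    refine Finset.sum_congr rfl fun r _ => ?_
    rw [freqSum, phase_add, phase_add, mode_add, mode_add]; ring
  have hi : ∀ (z : ℂ) (k : ℤ), IntervalIntegrable (fun x => z * mode a b k x) volume a b :=
    fun z k => (continuous_const.mul (continuous_mode k)).intervalIntegrable _ _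
  have hc : ∀ (s : Finset (Bool × ℤ)) (z : Bool × ℤ → ℂ) (k : Bool × ℤ → ℤ),
      Continuous (fun x => ∑ p ∈ s, z p * mode a b (k p) x) := fun s z k => by fun_prop
  rw [cubeCoef, e, fourierCoef_sum _ fun p _ => Continuous.intervalIntegrable (by fun_prop) _ _]
  refine Finset.sum_congr rfl fun p _ => ?_
  rw [fourierCoef_sum _ fun p _ => Continuous.intervalIntegrable (by fun_prop) _ _]
  refine Finset.sum_congr rfl fun q _ => ?_
  rw [fourierCoef_sum _ fun p _ => hi _ _]
  refine Finset.sum_congr rfl fun r _ => ?_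
  rw [fourierCoef_const_mul, fourierCoef_mode hab]
  split_ifs <;> simp

end SineGordon

/-! ### Time quadrature: cancellation between steps. -/

namespace SineGordon

open MeasureTheory Filter Topology
open scoped ENNReal NNReal

variable {a b : ℝ}

/-! ### Oscillatory sums -/

/-- The quadrature error `∫₀ˢ (e^{iθr} - 1) dr` of a single oscillation. -/
noncomputable def kap (θ s : ℝ) : ℂ :=
  if θ = 0 then 0 else (phase θ s - 1) / (Complex.I * θ) - s

lemma kap_zero_right (θ : ℝ) : kap θ 0 = 0 := by
  simp [kap, phase_zero_right]

lemma hasDerivAt_kap (θ s : ℝ) : HasDerivAt (kap θ) (phase θ s - 1) s := by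
  by_cases h : θ = 0
  · subst h
    have : kap 0 = fun _ => 0 := by funext s; simp [kap]
    rw [this, phase_zero_left, sub_self]
    exact hasDerivAt_const _ _
  · have e : kap θ = fun s : ℝ => (phase θ s - 1) / (Complex.I * θ) - s := by
      funext s; simp [kap, h]
    rw [e]
    have h' : Complex.I * (θ : ℂ) ≠ 0 :=
      mul_ne_zero Complex.I_ne_zero (Complex.ofReal_ne_zero.2 h)
    have h1 := (((hasDerivAt_phase θ s).sub_const 1).div_const (Complex.I * θ)).sub
      (hasDerivAt_id s).ofReal_comp
    refine h1.congr_deriv ?_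
    rw [mul_div_cancel_left₀ _ h']
    simp

lemma norm_phase_sub_one_sub_le {θ τ : ℝ} (h : |θ| * τ ≤ 1 / 2) (hτ : 0 ≤ τ) :
    ‖phase θ τ - 1 - Complex.I * (θ * τ : ℝ)‖ ≤ (|θ| * τ) ^ 2 := by
  have e : ‖Complex.I * ((θ * τ : ℝ) : ℂ)‖ = |θ| * τ := by
    rw [norm_mul, Complex.norm_I, one_mul, Complex.norm_real, Real.norm_eq_abs, abs_mul,
      abs_of_nonneg hτ]
  have := Complex.norm_exp_sub_one_sub_id_le (x := Complex.I * ((θ * τ : ℝ) : ℂ))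
    (by rw [e]; linarith)
  rwa [e] at this

/-- The factor `|θ|` is kept: it compensates the small divisor in the summation by parts. -/
lemma norm_kap_le {θ τ : ℝ} (h : |θ| * τ ≤ 1 / 2) (hτ : 0 ≤ τ) :
    ‖kap θ τ‖ ≤ |θ| * τ ^ 2 := by
  by_cases h0 : θ = 0
  · simp [kap, h0]
  · have h' : Complex.I * (θ : ℂ) ≠ 0 :=
      mul_ne_zero Complex.I_ne_zero (Complex.ofReal_ne_zero.2 h0)
    have e : kap θ τ = (phase θ τ - 1 - Complex.I * (θ * τ : ℝ)) / (Complex.I * θ) := by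
      rw [kap, if_neg h0, eq_div_iff h', sub_mul, div_mul_cancel₀ _ h']
      push_cast; ring
    have hθ : 0 < |θ| := abs_pos.2 h0
    rw [e, norm_div, norm_mul, Complex.norm_I, one_mul, Complex.norm_real, Real.norm_eq_abs,
      div_le_iff₀ hθ]
    refine (norm_phase_sub_one_sub_le h hτ).trans (le_of_eq ?_)
    ring

lemma le_norm_phase_sub_one {θ τ : ℝ} (h : |θ| * τ ≤ 1 / 2) (hτ : 0 ≤ τ) :
    |θ| * τ / 2 ≤ ‖phase θ τ - 1‖ := by
  have h1 := norm_phase_sub_one_sub_le h hτ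
  have h2 := norm_sub_norm_le (Complex.I * ((θ * τ : ℝ) : ℂ))
    (Complex.I * (θ * τ : ℝ) - (phase θ τ - 1))
  rw [norm_sub_rev (Complex.I * ((θ * τ : ℝ) : ℂ)) (phase θ τ - 1), sub_sub_cancel, norm_mul,
    Complex.norm_I, one_mul, Complex.norm_real, Real.norm_eq_abs, abs_mul, abs_of_nonneg hτ] at h2
  nlinarith [mul_nonneg (abs_nonneg θ) hτ]

lemma sum_mul_sub_eq (A E : ℕ → ℂ) (n : ℕ) :
    ∑ k ∈ Finset.range n, A k * (E (k + 1) - E k) =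
      A n * E n - A 0 * E 0 - ∑ k ∈ Finset.range n, (A (k + 1) - A k) * E (k + 1) := by
  induction n with
  | zero => simp
  | succ n ih => rw [Finset.sum_range_succ, Finset.sum_range_succ, ih]; ring

/-- Summation by parts for the accumulated quadrature errors of an oscillation with slowly varying
amplitude. -/
lemma norm_sum_kap_le {θ τ : ℝ} (h : |θ| * τ ≤ 1 / 2) (hτ : 0 ≤ τ) (A : ℕ → ℂ) (n : ℕ) :
    ‖∑ k ∈ Finset.range n, A k * phase θ (k * τ) * kap θ τ‖ ≤
      2 * τ * (‖A n‖ + ‖A 0‖ + ∑ k ∈ Finset.range n, ‖A (k + 1) - A k‖) := by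
  have hR : 0 ≤ ‖A n‖ + ‖A 0‖ + ∑ k ∈ Finset.range n, ‖A (k + 1) - A k‖ := by positivity
  -- In the resonant case there is no oscillation to exploit, but the quadrature error itself
  -- vanishes.
  by_cases h0 : |θ| * τ = 0
  · have : kap θ τ = 0 := by
      have h1 := norm_kap_le h hτ
      rw [pow_two, ← mul_assoc, h0, zero_mul] at h1
      exact norm_le_zero_iff.1 h1
    simp only [this, mul_zero, Finset.sum_const_zero, norm_zero]
    positivity
  · have hpos : 0 < |θ| * τ := lt_of_le_of_ne (mul_nonneg (abs_nonneg _) hτ) (Ne.symm h0)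
    have hD := le_norm_phase_sub_one h hτ
    have hD0 : 0 < ‖phase θ τ - 1‖ := lt_of_lt_of_le (by positivity) hD
    have hDne : phase θ τ - 1 ≠ 0 := norm_pos_iff.1 hD0
    -- The numerator is at most `|θ|τ²` and the denominator at least `|θ|τ/2`; `θ` drops out of the
    -- quotient.
    have hq : ‖kap θ τ / (phase θ τ - 1)‖ ≤ 2 * τ := by
      rw [norm_div, div_le_iff₀ hD0]
      refine (norm_kap_le h hτ).trans ?_
      nlinarith
    have e : ∑ k ∈ Finset.range n, A k * phase θ (k * τ) * kap θ τ =
        kap θ τ / (phase θ τ - 1) *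
          ∑ k ∈ Finset.range n, A k * (phase θ ((k + 1 : ℕ) * τ) - phase θ (k * τ)) := by
      rw [Finset.mul_sum]
      refine Finset.sum_congr rfl fun k _ => ?_
      have : phase θ ((k + 1 : ℕ) * τ) = phase θ (k * τ) * phase θ τ := by
        rw [← phase_add_right]; congr 1; push_cast; ring
      rw [this]
      field_simp
    rw [e, norm_mul, sum_mul_sub_eq A fun k : ℕ => phase θ (k * τ)]
    refine mul_le_mul hq ?_ (norm_nonneg _) (by positivity)
    refine (norm_sub_le _ _).trans (add_le_add ((norm_sub_le _ _).trans ?_)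
      ((norm_sum_le _ _).trans ?_))
    · rw [norm_mul, norm_mul, norm_phase, norm_phase, mul_one, mul_one]
    · simp only [norm_mul, norm_phase, mul_one, le_refl]

/-! ### The local error -/

/-- The quadrature error of the cubic interaction of a truncated free wave. -/
noncomputable def corr (a b : ℝ) (L : Finset ℤ) (Ψ : ℤ → ℂ) (t₀ s : ℝ) (l : ℤ) : ℂ :=
  ∑ p ∈ waveIdx L, ∑ q ∈ waveIdx L, ∑ r ∈ waveIdx L, if p.2 + q.2 + r.2 = l then
    amp Ψ p * amp Ψ q * amp Ψ r * phase (freqSum a b p q r - delta a b l) t₀ *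
      kap (freqSum a b p q r - delta a b l) s else 0

lemma corr_zero (L : Finset ℤ) (Ψ : ℤ → ℂ) (t₀ : ℝ) (l : ℤ) : corr a b L Ψ t₀ 0 l = 0 := by
  simp [corr, kap_zero_right]

/-- With `corr_zero`, this identifies `corr` as the left-endpoint quadrature error of the twisted
cube of the free wave. -/
lemma hasDerivAt_corr (hab : a < b) (L : Finset ℤ) (Ψ : ℤ → ℂ) (t₀ t : ℝ) (l : ℤ) :
    HasDerivAt (fun s => corr a b L Ψ t₀ (s - t₀) l)
      (phase (-delta a b l) t * cubeCoef a b (wave a b L Ψ t) l -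
        phase (-delta a b l) t₀ * cubeCoef a b (wave a b L Ψ t₀) l) t := by
  rw [cubeCoef_wave hab, cubeCoef_wave hab]
  simp only [Finset.mul_sum, ← Finset.sum_sub_distrib]
  unfold corr
  refine HasDerivAt.fun_sum fun p _ => HasDerivAt.fun_sum fun q _ =>
    HasDerivAt.fun_sum fun r _ => ?_
  split_ifs with h
  · have h1 := ((hasDerivAt_kap (freqSum a b p q r - delta a b l) (t - t₀)).comp_sub_const t
      t₀).const_mul (amp Ψ p * amp Ψ q * amp Ψ r * phase (freqSum a b p q r - delta a b l) t₀)
    refine h1.congr_deriv ?_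
    have e1 : ∀ s, phase (-delta a b l) s * phase (freqSum a b p q r) s =
        phase (freqSum a b p q r - delta a b l) s := fun s => by
      rw [← phase_add]; congr 1; ring
    have e2 : phase (freqSum a b p q r - delta a b l) t =
        phase (freqSum a b p q r - delta a b l) t₀ *
          phase (freqSum a b p q r - delta a b l) (t - t₀) := by
      rw [← phase_add_right]; congr 1; ring
    have e3 : phase (-delta a b l) t * (amp Ψ p * amp Ψ q * amp Ψ r *
        phase (freqSum a b p q r) t) - phase (-delta a b l) t₀ * (amp Ψ p * amp Ψ q * amp Ψ r *
        phase (freqSum a b p q r) t₀) = amp Ψ p * amp Ψ q * amp Ψ r *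
        (phase (freqSum a b p q r - delta a b l) t -
          phase (freqSum a b p q r - delta a b l) t₀) := by
      rw [← e1, ← e1]; ring
    rw [e3, e2]; ring
  · simpa using hasDerivAt_const t (0 : ℂ)

variable {ε S K : ℝ} {m : ℕ} {c d : ℝ → ℤ → ℂ}

lemma nrm_le_add₃ {u x y z : ℤ → ℂ} (h : ∀ l, ‖u l‖ ≤ ‖x l‖ + ‖y l‖ + ‖z l‖) :
    nrm u ≤ nrm x + nrm y + nrm z := by
  have e : ∀ c : ℤ → ℂ, nrm (fun l => ((‖c l‖ : ℝ) : ℂ)) = nrm c := fun c =>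
    nrm_congr_norm fun l => by rw [Complex.norm_real, norm_norm]
  have h1 : nrm u ≤ nrm (fun l => ((‖x l‖ : ℝ) : ℂ) + ((‖y l‖ : ℝ) : ℂ) + ((‖z l‖ : ℝ) : ℂ)) :=
    nrm_mono fun l => by
      rw [← Complex.ofReal_add, ← Complex.ofReal_add, Complex.norm_real,
        Real.norm_of_nonneg (by positivity)]
      exact h l
  refine h1.trans ((nrm_add_le (fun l => ((‖x l‖ : ℝ) : ℂ) + ((‖y l‖ : ℝ) : ℂ)) _).trans ?_)
  rw [e z]
  gcongr
  refine (nrm_add_le _ _).trans ?_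
  rw [e x, e y]

namespace FourierSolution

lemma nrm_twisted_sub_le' (h : FourierSolution a b ε S m K c d) (hab : a < b) (hK : 0 ≤ K)
    (hε : 0 < ε) (hε1 : ε ≤ 1) {s t : ℝ} (hs : 0 ≤ s) (hst : s ≤ t) (ht : t ≤ S) :
    nrm (fun l => twisted a b c d t l - twisted a b c d s l) ≤
      ENNReal.ofReal (ε ^ 2 * compConst a b 1 K * (t - s)) := by
  refine nrm_le_of_pow (a := a) (b := b) (s := 1) ?_
  simp only [pow_one]
  exact h.nrm_twisted_sub_le hab hK hε hε1 hs hst ht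

lemma summable_twisted (h : FourierSolution a b ε S m K c d) (hab : a < b) {t : ℝ}
    (ht : t ∈ Set.Icc 0 S) : Summable fun l => ‖twisted a b c d t l‖ :=
  summable_norm_of_nrm hab (delta_mul_le_pow (by omega) (h.nrm_twisted_le ht))

lemma tsum_twisted_le (h : FourierSolution a b ε S m K c d) (hab : a < b) (hK : 0 ≤ K) {t : ℝ}
    (ht : t ∈ Set.Icc 0 S) : ∑' l, ‖twisted a b c d t l‖ ≤ embConst a b * (2 * K) :=
  tsum_norm_le_of_nrm hab (by positivity) (delta_mul_le_pow (by omega) (h.nrm_twisted_le ht))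

/-- Two errors: for `δ ≤ Λ` the twisted variable has moved by `O(ε²(t - s))` since time `s`; for `δ
> Λ` the `H^{m+1}` bound gives `Λ^{-(m+1)}`. -/
lemma nrm_sub_wave_le (h : FourierSolution a b ε S m K c d) (hab : a < b) (hK : 0 ≤ K)
    (hε : 0 < ε) (hε1 : ε ≤ 1) {Λ : ℝ} (hΛ : 0 < Λ) {L : Finset ℤ}
    (hL : ∀ l, l ∈ L ↔ delta a b l ≤ Λ) {s t : ℝ} (hs : 0 ≤ s) (hst : s ≤ t) (ht : t ≤ S) :
    nrm (fun l => c t l - fourierCoef a b (wave a b L (twisted a b c d s) t) l) ≤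
      ENNReal.ofReal (ε ^ 2 * compConst a b 1 K * (t - s) + Λ⁻¹ ^ (m + 1) * K) := by
  set z : ℤ → ℂ := fun l => twisted a b c d t l - twisted a b c d s l with hz
  have hz1 := h.nrm_twisted_sub_le' hab hK hε hε1 hs hst ht
  have hpt : ∀ l, ‖c t l - fourierCoef a b (wave a b L (twisted a b c d s) t) l‖ ≤
      ‖(1 / 2 : ℂ) * z l‖ + ‖(1 / 2 : ℂ) * z (-l)‖ + ‖if l ∈ L then 0 else c t l‖ := fun l => by
    rw [fourierCoef_wave hab]
    split_ifs with hl
    · rw [h.c_eq_twisted t l, norm_zero, add_zero]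
      have e : (1 / 2 : ℂ) * (phase (delta a b l) t * twisted a b c d t l +
          phase (-delta a b l) t * (starRingEnd ℂ) (twisted a b c d t (-l))) -
          1 / 2 * (phase (delta a b l) t * twisted a b c d s l +
          phase (-delta a b l) t * (starRingEnd ℂ) (twisted a b c d s (-l))) =
          phase (delta a b l) t * (1 / 2 * z l) +
            phase (-delta a b l) t * (1 / 2 * (starRingEnd ℂ) (z (-l))) := by
        simp only [hz, map_sub]; ring
      rw [e]
      refine (norm_add_le _ _).trans (le_of_eq ?_)
      simp only [norm_mul, norm_phase, one_mul, RCLike.norm_conj]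
    · rw [sub_zero]
      have := norm_nonneg ((1 / 2 : ℂ) * z l)
      have := norm_nonneg ((1 / 2 : ℂ) * z (-l))
      linarith
  have h3 : nrm (fun l => if l ∈ L then 0 else c t l) ≤ ENNReal.ofReal (Λ⁻¹ ^ (m + 1) * K) := by
    rw [ENNReal.ofReal_mul (by positivity)]
    refine le_trans (nrm_le_mul fun l => ?_) (mul_le_mul_right (h.bound_c t ⟨hs.trans hst, ht⟩) _)
    split_ifs with hl
    · rw [norm_zero]; positivity
    · rw [norm_mul, norm_delta_pow, ← mul_assoc, ← mul_pow]
      refine le_mul_of_one_le_left (norm_nonneg _) (one_le_pow₀ ?_)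
      rw [hL, not_le] at hl
      rw [inv_mul_eq_div, one_le_div hΛ]
      exact hl.le
  have h2 := nrm_comp_equiv (Equiv.neg ℤ) fun l => (1 / 2 : ℂ) * z l
  simp only [Equiv.neg_apply] at h2
  have ht0 : 0 ≤ t - s := sub_nonneg.2 hst
  have hC := compConst_nonneg (a := a) (b := b) (s := 1) hK
  refine (nrm_le_add₃ hpt).trans ?_
  rw [h2, nrm_const_mul, ← add_mul, ENNReal.ofReal_add (by positivity) (by positivity)]
  have e12 : ‖(1 / 2 : ℂ)‖ₑ + ‖(1 / 2 : ℂ)‖ₑ = 1 := by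
    rw [← ofReal_norm, ← ENNReal.ofReal_add (norm_nonneg _) (norm_nonneg _)]; norm_num
  rw [e12, one_mul]
  exact add_le_add hz1 h3

lemma nrm_cube_sub_wave_le (h : FourierSolution a b ε S m K c d) (hab : a < b) (hK : 0 ≤ K)
    (hε : 0 < ε) (hε1 : ε ≤ 1) {Λ : ℝ} (hΛ : 0 < Λ) {L : Finset ℤ}
    (hL : ∀ l, l ∈ L ↔ delta a b l ≤ Λ) {s t : ℝ} (hs : 0 ≤ s) (hst : s ≤ t) (ht : t ≤ S) :
    nrm (fun l => cubeCoef a b (series a b (c t)) l -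
      cubeCoef a b (wave a b L (twisted a b c d s) t) l) ≤
      ENNReal.ofReal (3 * (embConst a b * (2 * K)) ^ 2 *
        (ε ^ 2 * compConst a b 1 K * (t - s) + Λ⁻¹ ^ (m + 1) * K)) := by
  have htS : t ∈ Set.Icc 0 S := ⟨hs.trans hst, ht⟩
  have hsS : s ∈ Set.Icc 0 S := ⟨hs, hst.trans ht⟩
  have hsum := h.summable_c hab htS
  rw [ENNReal.ofReal_mul (by positivity)]
  refine (nrm_cubeCoef_sub_le hab (continuous_series hsum) (continuous_wave _ _ _)
    (B := embConst a b * (2 * K)) (fun x => ?_) fun x => ?_).trans ?_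
  · refine (h.norm_series_c_le hab hK htS x).trans ?_
    have := mul_nonneg (embConst_nonneg (a := a) (b := b)) hK
    linarith
  · exact (norm_wave_le L (h.summable_twisted hab hsS) t x).trans (h.tsum_twisted_le hab hK hsS)
  · rw [fourierCoef_series hab hsum]
    exact mul_le_mul_right (h.nrm_sub_wave_le hab hK hε hε1 hΛ hL hs hst ht) _

/-- The change of the phase costs a factor `δ(t - s)`, paid by the `H¹` bound of the remainder; the
change of `w` is controlled by the Lipschitz bound. -/
lemma nrm_phase_quint_sub_le (h : FourierSolution a b ε S m K c d) (hab : a < b) (hK : 0 ≤ K)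
    (hε : 0 < ε) (hε1 : ε ≤ 1) {s t : ℝ} (hs : 0 ≤ s) (hst : s ≤ t) (ht : t ≤ S) :
    nrm (fun l => phase (-delta a b l) t * quintCoef a b ε (c t) l -
      phase (-delta a b l) s * quintCoef a b ε (c s) l) ≤
      ENNReal.ofReal (ε ^ 4 * ((embConst a b * (2 * K)) ^ 4 * K + compConst a b 1 K) *
        (t - s)) := by
  have htS : t ∈ Set.Icc 0 S := ⟨hs.trans hst, ht⟩
  have hsS : s ∈ Set.Icc 0 S := ⟨hs, hst.trans ht⟩
  have ht0 : 0 ≤ t - s := sub_nonneg.2 hst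
  have hC := compConst_nonneg (a := a) (b := b) (s := 1) hK
  have hE := mul_nonneg (embConst_nonneg (a := a) (b := b)) hK
  have e : (fun l => phase (-delta a b l) t * quintCoef a b ε (c t) l -
      phase (-delta a b l) s * quintCoef a b ε (c s) l) = fun l =>
      phase (-delta a b l) t * (quintCoef a b ε (c t) l - quintCoef a b ε (c s) l) +
        (phase (-delta a b l) t - phase (-delta a b l) s) * quintCoef a b ε (c s) l := by
    funext l; ring
  rw [e]
  refine (nrm_add_le _ _).trans ?_
  rw [nrm_phase_mul (fun l => -delta a b l) t]
  have h1 : nrm (fun l => quintCoef a b ε (c t) l - quintCoef a b ε (c s) l) ≤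
      ENNReal.ofReal (ε ^ 4 * (embConst a b * (2 * K)) ^ 4 * (K * (t - s))) := by
    rw [ENNReal.ofReal_mul (by positivity)]
    refine (nrm_quintCoef_sub_le (B := embConst a b * (2 * K)) hab hε (h.summable_c hab htS) (h.summable_c hab hsS)
      (fun x => (h.norm_series_c_le hab hK htS x).trans (by linarith))
      (fun x => (h.norm_series_c_le hab hK hsS x).trans (by linarith))).trans ?_
    exact mul_le_mul_right (h.nrm_c_sub_le hK hs hst ht) _
  have h2 : nrm (fun l => (phase (-delta a b l) t - phase (-delta a b l) s) *
      quintCoef a b ε (c s) l) ≤ ENNReal.ofReal ((t - s) * (ε ^ 4 * compConst a b 1 K)) := by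
    rw [ENNReal.ofReal_mul ht0]
    have h3 := nrm_quint_le hab le_rfl (h.conj_c s) hK (h.bound_c_one hsS) hε hε1
    refine le_trans (nrm_le_mul fun l => ?_) (mul_le_mul_right h3 _)
    rw [norm_mul, norm_mul, norm_delta_pow, pow_one, ← mul_assoc]
    refine mul_le_mul_of_nonneg_right ?_ (norm_nonneg _)
    refine (norm_phase_sub_le _ _ _).trans (le_of_eq ?_)
    rw [abs_neg, abs_of_pos (delta_pos l), abs_of_nonneg ht0, mul_comm]
  refine (add_le_add h1 h2).trans (le_of_eq ?_)
  rw [← ENNReal.ofReal_add (by positivity) (by positivity)]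
  congr 1; ring

end FourierSolution

/-- The constant in the local error bound. -/
noncomputable def locConst (a b K : ℝ) : ℝ :=
  (embConst a b * (2 * K)) ^ 4 * K + compConst a b 1 K +
    (embConst a b * (2 * K)) ^ 2 * (compConst a b 1 K + K)

lemma locConst_nonneg (hK : 0 ≤ K) : 0 ≤ locConst a b K := by
  have hC := compConst_nonneg (a := a) (b := b) (s := 1) hK
  have hE := mul_nonneg (embConst_nonneg (a := a) (b := b)) hK
  rw [locConst]; positivity

namespace FourierSolution

/-- The local error, up to the quadrature error of the truncated cubic interaction. -/
lemma nrm_local_error_le (h : FourierSolution a b ε S m K c d) (hab : a < b) (hK : 0 ≤ K)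
    (hε : 0 < ε) (hε1 : ε ≤ 1) {Λ : ℝ} (hΛ : 0 < Λ) {L : Finset ℤ}
    (hL : ∀ l, l ∈ L ↔ delta a b l ≤ Λ) {s t : ℝ} (hs : 0 ≤ s) (hst : s ≤ t) (ht : t ≤ S) :
    nrm (fun l => (delta a b l : ℂ) * (twisted a b c d t l - twisted a b c d s l) -
      ((t - s : ℝ) : ℂ) * (Complex.I * (phase (-delta a b l) s * nonlinCoef a b ε (c s) l)) +
      Complex.I * ε ^ 2 / 6 * corr a b L (twisted a b c d s) s (t - s) l) ≤
      ENNReal.ofReal (locConst a b K * (ε ^ 4 * (t - s) + ε ^ 2 * Λ⁻¹ ^ (m + 1)) * (t - s)) := by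
  have hsub : Set.Icc s t ⊆ Set.Icc 0 S := Set.Icc_subset_Icc hs ht
  have ht0 : 0 ≤ t - s := sub_nonneg.2 hst
  have hC := compConst_nonneg (a := a) (b := b) (s := 1) hK
  have hE := mul_nonneg (embConst_nonneg (a := a) (b := b)) hK
  have hloc := locConst_nonneg (a := a) (b := b) hK
  set N : ℝ → ℤ → ℂ := fun r l => phase (-delta a b l) r * nonlinCoef a b ε (c r) l with hN
  set W : ℝ → ℤ → ℂ := fun r l => phase (-delta a b l) r *
    cubeCoef a b (wave a b L (twisted a b c d s) r) l with hW
  set U : ℝ → ℤ → ℂ := fun r l => phase (-delta a b l) r *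
    cubeCoef a b (series a b (c r)) l with hU
  set Q : ℝ → ℤ → ℂ := fun r l => phase (-delta a b l) r * quintCoef a b ε (c r) l with hQ
  -- The local error is the increment over `[s, t]` of this curve, so it is enough to bound its
  -- derivative.
  let y : ℝ → ℤ → ℂ := fun r l => (delta a b l : ℂ) * twisted a b c d r l -
    (r : ℂ) * (Complex.I * N s l) +
    Complex.I * ε ^ 2 / 6 * corr a b L (twisted a b c d s) s (r - s) l
  let y' : ℝ → ℤ → ℂ := fun r l => Complex.I * N r l - Complex.I * N s l +
    Complex.I * ε ^ 2 / 6 * (W r l - W s l)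
  have e : (fun l => (delta a b l : ℂ) * (twisted a b c d t l - twisted a b c d s l) -
      ((t - s : ℝ) : ℂ) * (Complex.I * N s l) +
      Complex.I * ε ^ 2 / 6 * corr a b L (twisted a b c d s) s (t - s) l) =
      fun l => y t l - y s l := by
    funext l
    simp only [y, sub_self, corr_zero]
    push_cast; ring
  have hNQ : ∀ r ∈ Set.Icc 0 S, ∀ l, N r l = Q r l - (ε : ℂ) ^ 2 / 6 * U r l := fun r hr l => by
    simp only [hN, hQ, hU]
    rw [nonlinCoef_eq (h.summable_c hab hr) (h.conj_c r)]
    ring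
  have hsS : s ∈ Set.Icc 0 S := ⟨hs, hst.trans ht⟩
  rw [e]
  refine nrm_sub_le_of_hasDeriv (y' := y') hst (by positivity) (fun r hr l => ?_) fun r hr => ?_
  · have h1 := (h.hasDeriv_twisted l (hsub hr)).mono hsub
    have h2 := (((hasDerivAt_id r).ofReal_comp).mul_const (Complex.I * N s l)).hasDerivWithinAt
      (s := Set.Icc s t)
    have h3 := ((hasDerivAt_corr hab L (twisted a b c d s) s r l).const_mul
      (Complex.I * ε ^ 2 / 6)).hasDerivWithinAt (s := Set.Icc s t)
    refine ((h1.sub h2).add h3).congr_deriv ?_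
    simp only [y', hN, hW, Complex.ofReal_one, one_mul]
  · have hrS := hsub hr
    have hr0 : 0 ≤ r - s := sub_nonneg.2 hr.1
    -- `corr` cancels the free-wave cube. There remain the increment of the remainder and the gap
    -- between the exact and the free-wave cube, at both times `r` and `s`.
    have e2 : ∀ l, y' r l = Complex.I * (Q r l - Q s l) +
        (-(Complex.I * ε ^ 2 / 6) * (U r l - W r l) +
          Complex.I * ε ^ 2 / 6 * (U s l - W s l)) := fun l => by
      simp only [y', hNQ r hrS, hNQ s hsS]; ring
    have hUW : ∀ r ∈ Set.Icc s t, nrm (fun l => U r l - W r l) ≤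
        ENNReal.ofReal (3 * (embConst a b * (2 * K)) ^ 2 *
          (ε ^ 2 * compConst a b 1 K * (t - s) + Λ⁻¹ ^ (m + 1) * K)) := fun r hr => by
      simp only [hU, hW, ← mul_sub]
      rw [nrm_phase_mul (fun l => -delta a b l)]
      refine (h.nrm_cube_sub_wave_le hab hK hε hε1 hΛ hL hs hr.1 (hr.2.trans ht)).trans ?_
      apply ENNReal.ofReal_le_ofReal
      gcongr
      exact hr.2
    have hQ' : nrm (fun l => Q r l - Q s l) ≤ ENNReal.ofReal
        (ε ^ 4 * ((embConst a b * (2 * K)) ^ 4 * K + compConst a b 1 K) * (t - s)) := by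
      refine (h.nrm_phase_quint_sub_le hab hK hε hε1 hs hr.1 (hr.2.trans ht)).trans ?_
      apply ENNReal.ofReal_le_ofReal
      gcongr
      exact hr.2
    have hn : ‖Complex.I * (ε : ℂ) ^ 2 / 6‖ₑ = ENNReal.ofReal (ε ^ 2 / 6) := by
      rw [← ofReal_norm, norm_div, norm_mul, Complex.norm_I, norm_pow, Complex.norm_real,
        Real.norm_of_nonneg hε.le, one_mul]
      norm_num
    have hn' : ‖-(Complex.I * (ε : ℂ) ^ 2 / 6)‖ₑ = ENNReal.ofReal (ε ^ 2 / 6) := by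
      rw [enorm_neg, hn]
    have e3 : y' r = fun l => Complex.I * (Q r l - Q s l) +
        (-(Complex.I * ε ^ 2 / 6) * (U r l - W r l) +
          Complex.I * ε ^ 2 / 6 * (U s l - W s l)) := funext e2
    rw [e3]
    refine (nrm_add_le _ _).trans ((add_le_add_right (nrm_add_le _ _) _).trans ?_)
    rw [nrm_const_mul, nrm_const_mul, nrm_const_mul, enorm_I, one_mul, hn, hn']
    refine (add_le_add hQ' (add_le_add (mul_le_mul_right (hUW r hr) _)
      (mul_le_mul_right (hUW s (Set.left_mem_Icc.2 hst)) _))).trans ?_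
    rw [← ENNReal.ofReal_mul (by positivity), ← ENNReal.ofReal_add (by positivity) (by positivity),
      ← ENNReal.ofReal_add (by positivity) (by positivity)]
    apply ENNReal.ofReal_le_ofReal
    rw [locConst]
    have hρ : 0 ≤ ε ^ 2 * Λ⁻¹ ^ (m + 1) := by positivity
    have h5 : 0 ≤ ε ^ 4 * (t - s) := by positivity
    have hx1 : 0 ≤ (embConst a b * (2 * K)) ^ 4 * K + compConst a b 1 K := by positivity
    have hx2 : 0 ≤ (embConst a b * (2 * K)) ^ 2 * compConst a b 1 K := by positivity
    have hx3 : 0 ≤ (embConst a b * (2 * K)) ^ 2 * K := by positivity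
    nlinarith [mul_nonneg hx1 hρ, mul_nonneg hx2 hρ, mul_nonneg hx3 h5]

end FourierSolution

/-! ### The accumulated local errors -/

/-- The real form of the trilinear interaction. -/
noncomputable def triR (L : Finset ℤ) (x y z : Bool × ℤ → ℝ) (l : ℤ) : ℝ :=
  ∑ p ∈ waveIdx L, ∑ q ∈ waveIdx L, ∑ r ∈ waveIdx L,
    if p.2 + q.2 + r.2 = l then x p * y q * z r else 0

lemma ofReal_triR (L : Finset ℤ) (x y z : Bool × ℤ → ℝ) (l : ℤ) :
    ((triR L x y z l : ℝ) : ℂ) = tri L x y z l := by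
  rw [triR, tri]
  push_cast
  refine Finset.sum_congr rfl fun p _ => Finset.sum_congr rfl fun q _ =>
    Finset.sum_congr rfl fun r _ => ?_
  split_ifs <;> simp

/-- Three frequencies of size at most `Λ`, and a fourth of size at most `3Λ` by subadditivity. This
is the source of the condition `12Λτ ≤ 1`. -/
lemma abs_freqSum_sub_le {Λ : ℝ} {L : Finset ℤ} (hL : ∀ l, l ∈ L ↔ delta a b l ≤ Λ)
    {p q r : Bool × ℤ} (hp : p ∈ waveIdx L) (hq : q ∈ waveIdx L) (hr : r ∈ waveIdx L) :
    |freqSum a b p q r - delta a b (p.2 + q.2 + r.2)| ≤ 6 * Λ := by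
  simp only [waveIdx, Finset.mem_product, Finset.mem_univ, true_and, hL] at hp hq hr
  have h1 := abs_freqOf (a := a) (b := b) p
  have h2 := abs_freqOf (a := a) (b := b) q
  have h3 := abs_freqOf (a := a) (b := b) r
  have h4 := delta_add_le (a := a) (b := b) (p.2 + q.2) r.2
  have h5 := delta_add_le (a := a) (b := b) p.2 q.2
  have h6 := delta_pos (a := a) (b := b) (p.2 + q.2 + r.2)
  have h7 := abs_le.1 h1.le
  have h8 := abs_le.1 h2.le
  have h9 := abs_le.1 h3.le
  rw [freqSum, abs_le]
  constructor <;> linarith [h7.1, h7.2, h8.1, h8.2, h9.1, h9.2]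

lemma norm_mul₃_sub_le (x y z x' y' z' : ℂ) :
    ‖x' * y' * z' - x * y * z‖ ≤
      ‖x' - x‖ * ‖y'‖ * ‖z'‖ + ‖x‖ * ‖y' - y‖ * ‖z'‖ + ‖x‖ * ‖y‖ * ‖z' - z‖ := by
  have e : x' * y' * z' - x * y * z =
      (x' - x) * y' * z' + x * (y' - y) * z' + x * y * (z' - z) := by ring
  rw [e]
  refine norm_add₃_le.trans (le_of_eq ?_)
  simp only [norm_mul]

/-- Pointwise summation by parts for the cubic interaction. -/
lemma norm_sum_corr_le {Λ τ : ℝ} {L : Finset ℤ} (hL : ∀ l, l ∈ L ↔ delta a b l ≤ Λ)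
    (hτ : 0 ≤ τ) (hΛτ : 12 * Λ * τ ≤ 1) (Ψ : ℕ → ℤ → ℂ) (n : ℕ) (l : ℤ) :
    ‖∑ k ∈ Finset.range n, corr a b L (Ψ k) (k * τ) τ l‖ ≤
      2 * τ * (triR L (fun p => ‖amp (Ψ n) p‖) (fun p => ‖amp (Ψ n) p‖)
          (fun p => ‖amp (Ψ n) p‖) l +
        triR L (fun p => ‖amp (Ψ 0) p‖) (fun p => ‖amp (Ψ 0) p‖) (fun p => ‖amp (Ψ 0) p‖) l +
        ∑ k ∈ Finset.range n,
          (triR L (fun p => ‖amp (fun l => Ψ (k + 1) l - Ψ k l) p‖)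
            (fun p => ‖amp (Ψ (k + 1)) p‖) (fun p => ‖amp (Ψ (k + 1)) p‖) l +
          triR L (fun p => ‖amp (Ψ k) p‖) (fun p => ‖amp (fun l => Ψ (k + 1) l - Ψ k l) p‖)
            (fun p => ‖amp (Ψ (k + 1)) p‖) l +
          triR L (fun p => ‖amp (Ψ k) p‖) (fun p => ‖amp (Ψ k) p‖)
            (fun p => ‖amp (fun l => Ψ (k + 1) l - Ψ k l) p‖) l)) := by
  have e : ∑ k ∈ Finset.range n, corr a b L (Ψ k) (k * τ) τ l =
      ∑ p ∈ waveIdx L, ∑ q ∈ waveIdx L, ∑ r ∈ waveIdx L, if p.2 + q.2 + r.2 = l then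
        ∑ k ∈ Finset.range n, (amp (Ψ k) p * amp (Ψ k) q * amp (Ψ k) r) *
          phase (freqSum a b p q r - delta a b l) (k * τ) *
            kap (freqSum a b p q r - delta a b l) τ else 0 := by
    unfold corr
    rw [Finset.sum_comm]
    refine Finset.sum_congr rfl fun p _ => ?_
    rw [Finset.sum_comm]
    refine Finset.sum_congr rfl fun q _ => ?_
    rw [Finset.sum_comm]
    refine Finset.sum_congr rfl fun r _ => ?_
    split_ifs
    · rfl
    · simp
  rw [e]
  have hpt : ∀ p ∈ waveIdx L, ∀ q ∈ waveIdx L, ∀ r ∈ waveIdx L,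
      ‖if p.2 + q.2 + r.2 = l then ∑ k ∈ Finset.range n, (amp (Ψ k) p * amp (Ψ k) q *
        amp (Ψ k) r) * phase (freqSum a b p q r - delta a b l) (k * τ) *
          kap (freqSum a b p q r - delta a b l) τ else 0‖ ≤
      2 * τ * ((if p.2 + q.2 + r.2 = l then
          ‖amp (Ψ n) p‖ * ‖amp (Ψ n) q‖ * ‖amp (Ψ n) r‖ else 0) +
        (if p.2 + q.2 + r.2 = l then ‖amp (Ψ 0) p‖ * ‖amp (Ψ 0) q‖ * ‖amp (Ψ 0) r‖ else 0) +
        ∑ k ∈ Finset.range n,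
          ((if p.2 + q.2 + r.2 = l then ‖amp (fun l => Ψ (k + 1) l - Ψ k l) p‖ *
            ‖amp (Ψ (k + 1)) q‖ * ‖amp (Ψ (k + 1)) r‖ else 0) +
          (if p.2 + q.2 + r.2 = l then ‖amp (Ψ k) p‖ *
            ‖amp (fun l => Ψ (k + 1) l - Ψ k l) q‖ * ‖amp (Ψ (k + 1)) r‖ else 0) +
          (if p.2 + q.2 + r.2 = l then ‖amp (Ψ k) p‖ * ‖amp (Ψ k) q‖ *
            ‖amp (fun l => Ψ (k + 1) l - Ψ k l) r‖ else 0))) := by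
    intro p hp q hq r hr
    split_ifs with hl
    · subst hl
      have hfreq : |freqSum a b p q r - delta a b (p.2 + q.2 + r.2)| * τ ≤ 1 / 2 := by
        have := mul_le_mul_of_nonneg_right (abs_freqSum_sub_le hL hp hq hr) hτ
        linarith
      refine (norm_sum_kap_le hfreq hτ
        (fun k => amp (Ψ k) p * amp (Ψ k) q * amp (Ψ k) r) n).trans ?_
      refine mul_le_mul_of_nonneg_left ?_ (by positivity)
      simp only [norm_mul]
      gcongr with k _
      rw [← amp_sub, ← amp_sub, ← amp_sub]
      exact norm_mul₃_sub_le _ _ _ _ _ _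
    · simp
  refine (norm_sum_le _ _).trans ((Finset.sum_le_sum fun p hp => (norm_sum_le _ _).trans
    (Finset.sum_le_sum fun q hq => (norm_sum_le _ _).trans
      (Finset.sum_le_sum fun r hr => hpt p hp q hq r hr))).trans (le_of_eq ?_))
  simp only [← Finset.mul_sum, Finset.sum_add_distrib]
  congr 1
  simp only [triR]
  have sw : ∀ f : Bool × ℤ → Bool × ℤ → Bool × ℤ → ℕ → ℝ,
      ∑ p ∈ waveIdx L, ∑ q ∈ waveIdx L, ∑ r ∈ waveIdx L, ∑ k ∈ Finset.range n, f p q r k =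
      ∑ k ∈ Finset.range n, ∑ p ∈ waveIdx L, ∑ q ∈ waveIdx L, ∑ r ∈ waveIdx L, f p q r k := by
    intro f
    symm
    rw [Finset.sum_comm]
    refine Finset.sum_congr rfl fun p _ => ?_
    rw [Finset.sum_comm]
    refine Finset.sum_congr rfl fun q _ => ?_
    rw [Finset.sum_comm]
  rw [sw, sw, sw]

/-- The constant in the bound for the accumulated local errors. -/
noncomputable def tempConst (a b T K : ℝ) : ℝ :=
  T * locConst a b K + (embConst a b * (2 * K)) ^ 2 * (2 * K + T * compConst a b 1 K)

namespace FourierSolution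

/-- Two boundary terms of size `O(1)` and `n` increments of size `O(ε²τ)`, all multiplied by `2τ`.
As `nτ ≤ T/ε²`, the increments add up to `O(1)`. -/
lemma nrm_sum_corr_le {τ : ℝ} (h : FourierSolution a b ε S m K c d) (hab : a < b) (hK : 0 ≤ K)
    (hε : 0 < ε) (hε1 : ε ≤ 1) {Λ : ℝ} {L : Finset ℤ}
    (hL : ∀ l, l ∈ L ↔ delta a b l ≤ Λ) (hτ : 0 ≤ τ) (hΛτ : 12 * Λ * τ ≤ 1) {n : ℕ}
    (hn : n * τ ≤ S) :
    nrm (fun l => ∑ k ∈ Finset.range n,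
      corr a b L (twisted a b c d (k * τ)) (k * τ) τ l) ≤
      ENNReal.ofReal (2 * τ * ((embConst a b * (2 * K)) ^ 2 * (4 * K) +
        n * (3 * (embConst a b * (2 * K)) ^ 2 * (ε ^ 2 * compConst a b 1 K * τ)))) := by
  set B := embConst a b * (2 * K) with hB
  have hB0 : 0 ≤ B := mul_nonneg embConst_nonneg (by positivity)
  have hC := compConst_nonneg (a := a) (b := b) (s := 1) hK
  set Ψ : ℕ → ℤ → ℂ := fun k => twisted a b c d (k * τ) with hΨ
  have hmem : ∀ k ≤ n, (k : ℝ) * τ ∈ Set.Icc 0 S := fun k hk => by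
    refine ⟨by positivity, le_trans ?_ hn⟩
    gcongr
  have hsum : ∀ k ≤ n, ∑ p ∈ waveIdx L, ‖amp (Ψ k) p‖ ≤ B := fun k hk =>
    (sum_norm_amp_le L (h.summable_twisted hab (hmem k hk))).trans
      (h.tsum_twisted_le hab hK (hmem k hk))
  have hcol : ∀ k ≤ n, nrm (collect L fun p => ‖amp (Ψ k) p‖) ≤ ENNReal.ofReal (2 * K) :=
    fun k hk => (nrm_collect_amp_le L _).trans (nrm_le_of_pow (h.nrm_twisted_le (hmem k hk)))
  have hdiff : ∀ k < n, nrm (collect L fun p => ‖amp (fun l => Ψ (k + 1) l - Ψ k l) p‖) ≤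
      ENNReal.ofReal (ε ^ 2 * compConst a b 1 K * τ) := fun k hk => by
    refine (nrm_collect_amp_le L _).trans ?_
    have := h.nrm_twisted_sub_le' hab hK hε hε1 (hmem k hk.le).1
      (t := ((k + 1 : ℕ) : ℝ) * τ) (by gcongr; simp) (hmem (k + 1) hk).2
    refine this.trans (ENNReal.ofReal_le_ofReal (le_of_eq ?_))
    push_cast; ring
  have hnn : ∀ (Φ : ℤ → ℂ) (p : Bool × ℤ), 0 ≤ ‖amp Φ p‖ := fun _ _ => norm_nonneg _
  have hcube : ∀ k ≤ n, nrm (tri L (fun p => ‖amp (Ψ k) p‖) (fun p => ‖amp (Ψ k) p‖)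
      fun p => ‖amp (Ψ k) p‖) ≤ ENNReal.ofReal (B * B * (2 * K)) := fun k hk =>
    nrm_tri_le L _ (hnn _) (hnn _) hB0 (hcol k hk) (hsum k hk) (hsum k hk)
  set E := ε ^ 2 * compConst a b 1 K * τ with hE
  have hE0 : 0 ≤ E := by positivity
  have hd1 : ∀ k < n, nrm (tri L (fun p => ‖amp (fun l => Ψ (k + 1) l - Ψ k l) p‖)
      (fun p => ‖amp (Ψ (k + 1)) p‖) fun p => ‖amp (Ψ (k + 1)) p‖) ≤
        ENNReal.ofReal (B * B * E) := fun k hk =>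
    nrm_tri_le L _ (hnn _) (hnn _) hB0 (hdiff k hk) (hsum _ hk) (hsum _ hk)
  have hd2 : ∀ k < n, nrm (tri L (fun p => ‖amp (Ψ k) p‖)
      (fun p => ‖amp (fun l => Ψ (k + 1) l - Ψ k l) p‖) fun p => ‖amp (Ψ (k + 1)) p‖) ≤
        ENNReal.ofReal (B * B * E) := fun k hk => by
    -- The increment is moved to the slot measured in `ℓ²`; the other two factors are bounded in
    -- `ℓ¹`.
    rw [tri_swap]
    exact nrm_tri_le L _ (hnn _) (hnn _) hB0 (hdiff k hk) (hsum _ hk.le) (hsum _ hk)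
  have hd3 : ∀ k < n, nrm (tri L (fun p => ‖amp (Ψ k) p‖) (fun p => ‖amp (Ψ k) p‖)
      (fun p => ‖amp (fun l => Ψ (k + 1) l - Ψ k l) p‖)) ≤
        ENNReal.ofReal (B * B * E) := fun k hk => by
    rw [tri_swap_right, tri_swap]
    exact nrm_tri_le L _ (hnn _) (hnn _) hB0 (hdiff k hk) (hsum _ hk.le) (hsum _ hk.le)
  refine le_trans (nrm_le_mul (B := 2 * τ) (d := fun l =>
    tri L (fun p => ‖amp (Ψ n) p‖) (fun p => ‖amp (Ψ n) p‖) (fun p => ‖amp (Ψ n) p‖) l +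
    tri L (fun p => ‖amp (Ψ 0) p‖) (fun p => ‖amp (Ψ 0) p‖) (fun p => ‖amp (Ψ 0) p‖) l +
    ∑ k ∈ Finset.range n,
      (tri L (fun p => ‖amp (fun l => Ψ (k + 1) l - Ψ k l) p‖)
        (fun p => ‖amp (Ψ (k + 1)) p‖) (fun p => ‖amp (Ψ (k + 1)) p‖) l +
      tri L (fun p => ‖amp (Ψ k) p‖) (fun p => ‖amp (fun l => Ψ (k + 1) l - Ψ k l) p‖)
        (fun p => ‖amp (Ψ (k + 1)) p‖) l +
      tri L (fun p => ‖amp (Ψ k) p‖) (fun p => ‖amp (Ψ k) p‖)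
        (fun p => ‖amp (fun l => Ψ (k + 1) l - Ψ k l) p‖) l)) fun l => ?_) ?_
  · have hb := norm_sum_corr_le hL hτ hΛτ Ψ n l
    refine hb.trans (mul_le_mul_of_nonneg_left (le_trans (le_abs_self _) ?_) (by positivity))
    rw [← Real.norm_eq_abs, ← Complex.norm_real]
    push_cast
    simp only [ofReal_triR, le_refl]
  · rw [ENNReal.ofReal_mul (p := 2 * τ) (by positivity)]
    refine mul_le_mul_right ?_ _
    rw [ENNReal.ofReal_add (by positivity) (by positivity)]
    refine (nrm_add_le _ _).trans (add_le_add ((nrm_add_le _ _).trans ?_)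
      ((nrm_sum_le _ _).trans ?_))
    · refine (add_le_add (hcube n le_rfl) (hcube 0 (Nat.zero_le _))).trans (le_of_eq ?_)
      rw [← ENNReal.ofReal_add (by positivity) (by positivity)]
      congr 1; ring
    · refine (Finset.sum_le_sum fun k hk => ?_).trans (le_of_eq (a := ∑ k ∈ Finset.range n,
        ENNReal.ofReal (3 * B ^ 2 * E)) ?_)
      · have hk' := Finset.mem_range.1 hk
        refine (nrm_add_le _ _).trans ((add_le_add ((nrm_add_le _ _).trans
          (add_le_add (hd1 k hk') (hd2 k hk'))) (hd3 k hk')).trans (le_of_eq ?_))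
        rw [← ENNReal.ofReal_add (by positivity) (by positivity),
          ← ENNReal.ofReal_add (by positivity) (by positivity)]
        congr 1; ring
      · rw [Finset.sum_const, Finset.card_range, nsmul_eq_mul, ENNReal.ofReal_mul (p := (n : ℝ)) (by positivity),
          ENNReal.ofReal_natCast]

/-- The accumulated local errors of the exponential integrator are small uniformly in `ε`. -/
theorem nrm_sum_local_error_le {T τ : ℝ} (h : FourierSolution a b ε (T / ε ^ 2) m K c d)
    (hab : a < b) (hK : 0 ≤ K) (hT : 0 < T)
    (hε : 0 < ε) (hε1 : ε ≤ 1) {Λ : ℝ} (hΛ : 0 < Λ) (hτ : 0 < τ) (hΛτ : 12 * Λ * τ ≤ 1) {n : ℕ}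
    (hn : n * τ ≤ T / ε ^ 2) :
    nrm (fun l => ∑ k ∈ Finset.range n,
      ((delta a b l : ℂ) * (twisted a b c d ((k + 1 : ℕ) * τ) l - twisted a b c d (k * τ) l) -
        (τ : ℂ) * (Complex.I * (phase (-delta a b l) (k * τ) *
          nonlinCoef a b ε (c (k * τ)) l)))) ≤
      ENNReal.ofReal (tempConst a b T K * (ε ^ 2 * τ + Λ⁻¹ ^ (m + 1))) := by
  obtain ⟨L, hL⟩ : ∃ L : Finset ℤ, ∀ l, l ∈ L ↔ delta a b l ≤ Λ :=
    ⟨(finite_delta_le hab Λ).toFinset, fun l => by simp⟩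
  have hC := compConst_nonneg (a := a) (b := b) (s := 1) hK
  have hloc := locConst_nonneg (a := a) (b := b) hK
  have hB0 : 0 ≤ embConst a b * (2 * K) := mul_nonneg embConst_nonneg (by positivity)
  have hnε : n * τ * ε ^ 2 ≤ T := by rwa [le_div_iff₀ (by positivity)] at hn
  set Y : ℕ → ℤ → ℂ := fun k l =>
    (delta a b l : ℂ) * (twisted a b c d ((k + 1 : ℕ) * τ) l - twisted a b c d (k * τ) l) -
        (τ : ℂ) * (Complex.I * (phase (-delta a b l) (k * τ) *
          nonlinCoef a b ε (c (k * τ)) l)) +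
      Complex.I * ε ^ 2 / 6 * corr a b L (twisted a b c d (k * τ)) (k * τ) τ l with hY
  have hYk : ∀ k < n, nrm (Y k) ≤
      ENNReal.ofReal (locConst a b K * (ε ^ 4 * τ + ε ^ 2 * Λ⁻¹ ^ (m + 1)) * τ) := fun k hk => by
    have hst : (k : ℝ) * τ ≤ ((k + 1 : ℕ) : ℝ) * τ := by gcongr; simp
    have e : ((k + 1 : ℕ) : ℝ) * τ - k * τ = τ := by push_cast; ring
    have := h.nrm_local_error_le hab hK hε hε1 hΛ hL (s := k * τ) (t := (k + 1 : ℕ) * τ)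
      (by positivity) hst (le_trans (by gcongr; exact hk) hn)
    rw [e] at this
    exact this
  have e : (fun l => ∑ k ∈ Finset.range n,
      ((delta a b l : ℂ) * (twisted a b c d ((k + 1 : ℕ) * τ) l - twisted a b c d (k * τ) l) -
        (τ : ℂ) * (Complex.I * (phase (-delta a b l) (k * τ) *
          nonlinCoef a b ε (c (k * τ)) l)))) = fun l => ∑ k ∈ Finset.range n, Y k l -
      Complex.I * ε ^ 2 / 6 * ∑ k ∈ Finset.range n,
        corr a b L (twisted a b c d (k * τ)) (k * τ) τ l := by
    funext l
    rw [Finset.mul_sum, ← Finset.sum_sub_distrib]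
    refine Finset.sum_congr rfl fun k _ => ?_
    simp only [hY]; ring
  have hn' : ‖Complex.I * (ε : ℂ) ^ 2 / 6‖ₑ = ENNReal.ofReal (ε ^ 2 / 6) := by
    rw [← ofReal_norm, norm_div, norm_mul, Complex.norm_I, norm_pow, Complex.norm_real,
      Real.norm_of_nonneg hε.le, one_mul]
    norm_num
  rw [e]
  refine (nrm_sub_le _ _).trans ?_
  rw [nrm_const_mul, hn']
  refine (add_le_add ((nrm_sum_le _ _).trans (Finset.sum_le_sum fun k hk =>
    hYk k (Finset.mem_range.1 hk))) (mul_le_mul_right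
      (h.nrm_sum_corr_le hab hK hε hε1 hL hτ.le hΛτ hn) _)).trans ?_
  rw [Finset.sum_const, Finset.card_range, nsmul_eq_mul, ← ENNReal.ofReal_natCast,
    ← ENNReal.ofReal_mul (by positivity), ← ENNReal.ofReal_mul (by positivity),
    ← ENNReal.ofReal_add (by positivity) (by positivity)]
  apply ENNReal.ofReal_le_ofReal
  rw [tempConst]
  set ρ := Λ⁻¹ ^ (m + 1)
  have hρ : 0 ≤ ρ := by positivity
  set B2 := (embConst a b * (2 * K)) ^ 2
  have hB2 : 0 ≤ B2 := by positivity
  set C1 := compConst a b 1 K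
  set D := locConst a b K
  -- The length `nτ ≤ T/ε²` of the time interval uses up one factor `ε²`.
  have i1 : (n : ℝ) * (D * (ε ^ 4 * τ + ε ^ 2 * ρ) * τ) ≤ T * D * (ε ^ 2 * τ + ρ) := by
    have : (n : ℝ) * (D * (ε ^ 4 * τ + ε ^ 2 * ρ) * τ) =
        (n * τ * ε ^ 2) * (D * (ε ^ 2 * τ + ρ)) := by ring
    rw [this, mul_assoc T]
    gcongr
  -- Summation by parts has already absorbed the length of the interval, so the prefactor `ε²` of
  -- the cubic term survives.
  have i2 : ε ^ 2 / 6 * (2 * τ * (B2 * (4 * K) + n * (3 * B2 * (ε ^ 2 * C1 * τ)))) ≤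
      B2 * (2 * K + T * C1) * (ε ^ 2 * τ) := by
    have e1 : ε ^ 2 / 6 * (2 * τ * (B2 * (4 * K) + n * (3 * B2 * (ε ^ 2 * C1 * τ)))) =
        (4 / 3 * (B2 * K) + B2 * C1 * (n * τ * ε ^ 2)) * (ε ^ 2 * τ) := by ring
    rw [e1]
    have h1 : B2 * C1 * (n * τ * ε ^ 2) ≤ B2 * C1 * T := by gcongr
    have h2 : 0 ≤ B2 * K := by positivity
    have h3 : 0 ≤ ε ^ 2 * τ := by positivity
    refine mul_le_mul_of_nonneg_right ?_ h3
    nlinarith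
  have i3 : 0 ≤ B2 * (2 * K + T * C1) * ρ := by positivity
  nlinarith

end FourierSolution

end SineGordon

/-! ### Error recursion and stability. -/

namespace SineGordon

open MeasureTheory Filter Topology
open scoped ENNReal NNReal

variable {a b ε τ T K : ℝ} {m M : ℕ} {φ γ : ℝ → ℝ} {c d : ℝ → ℤ → ℂ}

/-! ### The scheme in Fourier variables -/

lemma dft_psi_zero (hab : a < b) (hM : 0 < M) (hE : Even M) {l : ℤ} (hl : l ∈ freq M) :
    dft a b M (psi a b ε τ φ γ M 0) l = dft a b M (fun j => (φ (grid a b M j) : ℂ)) l -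
      Complex.I * dft a b M (fun j => (γ (grid a b M j) : ℂ)) l / delta a b l := by
  have : psi a b ε τ φ γ M 0 = fun j => (φ (grid a b M j) : ℂ) - Complex.I *
      ∑ l ∈ freq M, dft a b M (fun k => (γ (grid a b M k) : ℂ)) l / (delta a b l : ℂ) *
        mode a b l (grid a b M j) := rfl
  rw [this, dft_sub, dft_const_mul, dft_sum_mode hab hM hE (fun l =>
    dft a b M (fun k => (γ (grid a b M k) : ℂ)) l / (delta a b l : ℂ)) hl]
  ring

lemma dft_psi_succ (hab : a < b) (hM : 0 < M) (hE : Even M) (n : ℕ) {l : ℤ} (hl : l ∈ freq M) :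
    dft a b M (psi a b ε τ φ γ M (n + 1)) l = phase (delta a b l) τ *
      (dft a b M (psi a b ε τ φ γ M n) l + τ * (Complex.I / delta a b l *
        dft a b M (fun k => (nonlin ε (psi a b ε τ φ γ M n k).re : ℂ)) l)) := by
  have : psi a b ε τ φ γ M (n + 1) = fun j => ∑ l ∈ freq M,
      (Complex.exp (Complex.I * ((τ * delta a b l : ℝ) : ℂ)) *
          dft a b M (psi a b ε τ φ γ M n) l +
        (τ : ℂ) * Complex.exp (Complex.I * ((τ * delta a b l : ℝ) : ℂ)) *
          (Complex.I / (delta a b l : ℂ) *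
            dft a b M (fun k => (nonlin ε (psi a b ε τ φ γ M n k).re : ℂ)) l)) *
      mode a b l (grid a b M j) := rfl
  rw [this, dft_sum_mode hab hM hE (fun l =>
    (Complex.exp (Complex.I * ((τ * delta a b l : ℝ) : ℂ)) *
      dft a b M (psi a b ε τ φ γ M n) l +
      (τ : ℂ) * Complex.exp (Complex.I * ((τ * delta a b l : ℝ) : ℂ)) *
        (Complex.I / (delta a b l : ℂ) *
          dft a b M (fun k => (nonlin ε (psi a b ε τ φ γ M n k).re : ℂ)) l))) hl]
  rw [phase, mul_comm τ]
  ring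

/-- `T_M` fails to be symmetric only at `l = -M/2`, where periodicity identifies the coefficients at
`l` and `-l`. -/
lemma dft_neg_of_mem_freq (hab : a < b) (hM : 0 < M) (hE : Even M) (u : Fin (M + 1) → ℂ) {l : ℤ}
    (hl : l ∈ freq M) : -l ∈ freq M ∨ (2 * |l| = M ∧ dft a b M u (-l) = dft a b M u l) := by
  by_cases h : 2 * l = -(M : ℤ)
  · refine Or.inr ⟨?_, ?_⟩
    · rcases abs_cases l with h' | h' <;> omega
    · rw [← dft_period hab hM u l]
      congr 1
      omega
  · left
    rw [mem_freq_iff hE] at hl ⊢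
    omega

lemma dft_ofReal_neg (u : Fin (M + 1) → ℝ) (l : ℤ) :
    (starRingEnd ℂ) (dft a b M (fun j => (u j : ℂ)) (-l)) = dft a b M (fun j => (u j : ℂ)) l := by
  rw [← dft_conj]
  simp only [Complex.conj_ofReal]

lemma conj_dft_psi_zero_neg (hab : a < b) (hM : 0 < M) (hE : Even M) {l : ℤ} (hl : l ∈ freq M) :
    (starRingEnd ℂ) (dft a b M (psi a b ε τ φ γ M 0) (-l)) =
      dft a b M (fun j => (φ (grid a b M j) : ℂ)) l +
        Complex.I * dft a b M (fun j => (γ (grid a b M j) : ℂ)) l / delta a b l := by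
  have key : dft a b M (psi a b ε τ φ γ M 0) (-l) =
      dft a b M (fun j => (φ (grid a b M j) : ℂ)) (-l) -
        Complex.I * dft a b M (fun j => (γ (grid a b M j) : ℂ)) (-l) / delta a b l := by
    rcases dft_neg_of_mem_freq hab hM hE (psi a b ε τ φ γ M 0) hl with h | ⟨h, h1⟩
    · rw [dft_psi_zero hab hM hE h, delta_neg]
    · have h2 := fun u => (dft_neg_of_mem_freq hab hM hE u hl).resolve_left fun h' => by
        rw [mem_freq_iff hE] at hl h'
        rcases abs_cases l with h'' | h'' <;> omega
      rw [h1, dft_psi_zero hab hM hE hl, (h2 _).2, (h2 _).2]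
  rw [key, map_sub, map_div₀, map_mul, Complex.conj_I, Complex.conj_ofReal,
    dft_ofReal_neg fun j => φ (grid a b M j), dft_ofReal_neg fun j => γ (grid a b M j)]
  ring

/-- The case `n = 0`, where the scheme prescribes the data directly, obeys the same formula; this
includes the unpaired frequency `-M/2`. -/
lemma dft_wNum (hab : a < b) (hM : 0 < M) (hE : Even M) (n : ℕ) {l : ℤ} (hl : l ∈ freq M) :
    dft a b M (wNum a b ε τ φ γ M n) l = (1 / 2) * (dft a b M (psi a b ε τ φ γ M n) l +
      (starRingEnd ℂ) (dft a b M (psi a b ε τ φ γ M n) (-l))) := by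
  cases n with
  | zero =>
    rw [conj_dft_psi_zero_neg hab hM hE hl, dft_psi_zero hab hM hE hl]
    have : wNum a b ε τ φ γ M 0 = fun j => (φ (grid a b M j) : ℂ) := rfl
    rw [this]; ring
  | succ n =>
    have : wNum a b ε τ φ γ M (n + 1) = fun j => (1 / 2 : ℂ) *
      (psi a b ε τ φ γ M (n + 1) j + (starRingEnd ℂ) (psi a b ε τ φ γ M (n + 1) j)) := rfl
    rw [this, dft_const_mul, dft_add, dft_conj]

lemma dft_zNum (hab : a < b) (hM : 0 < M) (hE : Even M) (n : ℕ) {l : ℤ} (hl : l ∈ freq M) :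
    dft a b M (zNum a b ε τ φ γ M n) l = Complex.I / 2 * delta a b l *
      (dft a b M (psi a b ε τ φ γ M n) l -
        (starRingEnd ℂ) (dft a b M (psi a b ε τ φ γ M n) (-l))) := by
  cases n with
  | zero =>
    rw [conj_dft_psi_zero_neg hab hM hE hl, dft_psi_zero hab hM hE hl]
    have : zNum a b ε τ φ γ M 0 = fun j => (γ (grid a b M j) : ℂ) := rfl
    have h := delta_ne (a := a) (b := b) l
    rw [this]
    field_simp
    ring_nf
    simp [Complex.I_sq]
  | succ n =>
    have : zNum a b ε τ φ γ M (n + 1) = fun j => Complex.I / 2 * ∑ l ∈ freq M, (delta a b l : ℂ) *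
      (dft a b M (psi a b ε τ φ γ M (n + 1)) l -
        dft a b M (fun k => (starRingEnd ℂ) (psi a b ε τ φ γ M (n + 1) k)) l) *
      mode a b l (grid a b M j) := rfl
    rw [this, dft_const_mul, dft_sum_mode hab hM hE (fun l => (delta a b l : ℂ) *
      (dft a b M (psi a b ε τ φ γ M (n + 1)) l -
        dft a b M (fun k => (starRingEnd ℂ) (psi a b ε τ φ γ M (n + 1) k)) l)) hl, dft_conj]
    ring

lemma mem_freq_of_lt (hE : Even M) {l : ℤ} (h : 2 * |l| < M) : l ∈ freq M := by
  rw [mem_freq_iff hE]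
  rcases abs_cases l with h' | h' <;> omega

/-- The error of the scheme in Fourier variables. -/
noncomputable def errCoef (a b ε τ : ℝ) (φ γ : ℝ → ℝ) (M : ℕ) (c d : ℝ → ℤ → ℂ) (n : ℕ) :
    ℤ → ℂ :=
  onFreq M fun l => dft a b M (psi a b ε τ φ γ M n) l - lowPass M (psiCoef a b c d (n * τ)) l

/-- The error of the evaluation of the nonlinearity. -/
noncomputable def nonlinErr (a b ε τ : ℝ) (φ γ : ℝ → ℝ) (M : ℕ) (c : ℝ → ℤ → ℂ) (n : ℕ) :
    ℤ → ℂ :=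
  onFreq M fun l => dft a b M (fun k => (nonlin ε (psi a b ε τ φ γ M n k).re : ℂ)) l -
    lowPass M (nonlinCoef a b ε (c (n * τ))) l

/-- The local error of the scheme at a given frequency, in the twisted variable. -/
noncomputable def locErr (a b ε τ : ℝ) (c d : ℝ → ℤ → ℂ) (k : ℕ) (l : ℤ) : ℂ :=
  (delta a b l : ℂ) * (twisted a b c d ((k + 1 : ℕ) * τ) l - twisted a b c d (k * τ) l) -
    (τ : ℂ) * (Complex.I * (phase (-delta a b l) (k * τ) * nonlinCoef a b ε (c (k * τ)) l))

/-- In the twisted variable the linear flow disappears and the recursion telescopes. The local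
errors are kept as one sum, since their cancellation would be lost in a step-by-step bound. -/
lemma errCoef_recursion (hab : a < b) (hM : 0 < M) (hE : Even M) (n : ℕ) (l : ℤ) :
    phase (-delta a b l) (n * τ) * (delta a b l * errCoef a b ε τ φ γ M c d n l) =
      delta a b l * errCoef a b ε τ φ γ M c d 0 l +
        ∑ k ∈ Finset.range n, (τ : ℂ) * (Complex.I * (phase (-delta a b l) (k * τ) *
          nonlinErr a b ε τ φ γ M c k l)) -
        lowPass M (fun l => ∑ k ∈ Finset.range n, locErr a b ε τ c d k l) l := by
  by_cases hl : l ∈ freq M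
  -- Outside `T_M` every term vanishes, because `lowPass` keeps only frequencies in `T_M`.
  swap
  · have h2 : ¬ 2 * |l| < (M : ℤ) := fun h => hl (mem_freq_of_lt hE h)
    simp [errCoef, nonlinErr, onFreq, lowPass, hl, h2]
  induction n with
  | zero => simp [lowPass, phase_zero_right]
  | succ n ih =>
    have hstep : phase (-delta a b l) ((n + 1 : ℕ) * τ) *
        (delta a b l * errCoef a b ε τ φ γ M c d (n + 1) l) =
        phase (-delta a b l) (n * τ) * (delta a b l * errCoef a b ε τ φ γ M c d n l) +
        (τ : ℂ) * (Complex.I * (phase (-delta a b l) (n * τ) *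
          nonlinErr a b ε τ φ γ M c n l)) - lowPass M (locErr a b ε τ c d n) l := by
      have hδ := delta_ne (a := a) (b := b) l
      have hp : phase (-delta a b l) ((n + 1 : ℕ) * τ) =
          phase (-delta a b l) (n * τ) * phase (-delta a b l) τ := by
        rw [← phase_add_right]; congr 1; push_cast; ring
      have hq := phase_neg_mul (delta a b l) τ
      simp only [errCoef, nonlinErr, onFreq, hl, if_true, lowPass, locErr, twisted]
      rw [dft_psi_succ hab hM hE n hl, hp]
      have h3 : phase (-delta a b l) (n * τ) * phase (-delta a b l) τ * (delta a b l *
          (phase (delta a b l) τ * (dft a b M (psi a b ε τ φ γ M n) l + τ * (Complex.I /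
            delta a b l * dft a b M (fun k => (nonlin ε (psi a b ε τ φ γ M n k).re : ℂ)) l)))) =
          phase (-delta a b l) (n * τ) * (phase (-delta a b l) τ * phase (delta a b l) τ) *
          (delta a b l * dft a b M (psi a b ε τ φ γ M n) l + τ * (Complex.I *
            dft a b M (fun k => (nonlin ε (psi a b ε τ φ γ M n k).re : ℂ)) l)) := by
        field_simp
      split_ifs
      · rw [mul_sub, mul_sub, h3, hq]; ring
      · rw [sub_zero, sub_zero, sub_zero, sub_zero, h3, hq]; ring
    rw [hstep, ih, Finset.sum_range_succ]
    simp only [lowPass]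
    split_ifs
    · rw [Finset.sum_range_succ]; ring
    · ring

lemma nrm_lowPass_le (u : ℤ → ℂ) : nrm (lowPass M u) ≤ nrm u :=
  nrm_mono fun l => by
    rw [lowPass]; split_ifs
    · exact le_rfl
    · simp

lemma nrm_errCoef_le (hab : a < b) (hM : 0 < M) (hE : Even M) (hτ : 0 ≤ τ) (n : ℕ) :
    nrm (fun l => delta a b l * errCoef a b ε τ φ γ M c d n l) ≤
      nrm (fun l => delta a b l * errCoef a b ε τ φ γ M c d 0 l) +
        ENNReal.ofReal τ * ∑ k ∈ Finset.range n, nrm (nonlinErr a b ε τ φ γ M c k) +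
        nrm (fun l => ∑ k ∈ Finset.range n, locErr a b ε τ c d k l) := by
  rw [← nrm_phase_mul (fun l => -delta a b l) (n * τ)]
  simp only [errCoef_recursion hab hM hE n]
  refine (nrm_sub_le _ _).trans (add_le_add ((nrm_add_le _ _).trans
    (add_le_add le_rfl ((nrm_sum_le _ _).trans ?_))) (nrm_lowPass_le _))
  rw [Finset.mul_sum]
  refine Finset.sum_le_sum fun k _ => ?_
  rw [nrm_const_mul, nrm_const_mul, nrm_phase_mul (fun l => -delta a b l), enorm_I, one_mul,
    ← ofReal_norm, Complex.norm_real, Real.norm_of_nonneg hτ]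

/-! ### Consistency and stability of the nonlinearity -/

lemma sum_lowPass_mode (hE : Even M) (u : ℤ → ℂ) (x : ℝ) :
    ∑ l ∈ freq M, lowPass M u l * mode a b l x = series a b (lowPass M u) x := by
  rw [series, tsum_eq_sum]
  intro l hl
  rw [lowPass, if_neg fun h => hl (mem_freq_of_lt hE h), zero_mul]

lemma summable_lowPass {u : ℤ → ℂ} (hu : Summable fun l => ‖u l‖) :
    Summable fun l => ‖lowPass M u l‖ :=
  hu.of_nonneg_of_le (fun _ => norm_nonneg _) fun l => by
    rw [lowPass]; split_ifs
    · exact le_rfl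
    · simp

lemma norm_series_lowPass_le {u : ℤ → ℂ} (hu : Summable fun l => ‖u l‖) (x : ℝ) :
    ‖series a b (lowPass M u) x‖ ≤ ∑' l, ‖u l‖ := by
  refine (norm_series_le (summable_lowPass hu) x).trans
    ((summable_lowPass hu).tsum_le_tsum (fun l => ?_) hu)
  rw [lowPass]; split_ifs
  · exact le_rfl
  · simp

lemma onFreq_congr {u v : ℤ → ℂ} (h : ∀ l ∈ freq M, u l = v l) : onFreq M u = onFreq M v := by
  funext l
  simp only [onFreq]
  split_ifs with hl
  · exact h l hl
  · rfl

lemma dft_series_lowPass (hab : a < b) (hM : 0 < M) (hE : Even M) (u : ℤ → ℂ) {l : ℤ}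
    (hl : l ∈ freq M) :
    dft a b M (fun j => series a b (lowPass M u) (grid a b M j)) l = lowPass M u l := by
  simp only [← sum_lowPass_mode hE]
  exact dft_sum_mode hab hM hE _ hl

/-- At `l = -M/2` both sides are zero, since `lowPass` drops that frequency. This symmetric cut-off
makes the statement compatible with conjugation. -/
lemma dft_series_lowPass_neg (hab : a < b) (hM : 0 < M) (hE : Even M) (u : ℤ → ℂ) {l : ℤ}
    (hl : l ∈ freq M) :
    dft a b M (fun j => series a b (lowPass M u) (grid a b M j)) (-l) = lowPass M u (-l) := by
  rcases dft_neg_of_mem_freq hab hM hE (fun j => series a b (lowPass M u) (grid a b M j)) hl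
    with h | ⟨h, h1⟩
  · exact dft_series_lowPass hab hM hE u h
  · rw [h1, dft_series_lowPass hab hM hE u hl, lowPass, lowPass, abs_neg,
      if_neg (by omega), if_neg (by omega)]

/-- The numerical solution is bounded as long as its error is. -/
lemma norm_psi_sub_le (hab : a < b) (hM : 0 < M) (hE : Even M) {n : ℕ} {B : ℝ} (hB : 0 ≤ B)
    (h : nrm (fun l => delta a b l * errCoef a b ε τ φ γ M c d n l) ≤ ENNReal.ofReal B)
    (j : Fin M) :
    ‖psi a b ε τ φ γ M n j.castSucc -
      series a b (lowPass M (psiCoef a b c d (n * τ))) (grid a b M j.castSucc)‖ ≤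
      embConst a b * B := by
  have hs := summable_norm_of_nrm hab h
  have e := sum_dft_mode hab hM hE (fun j => psi a b ε τ φ γ M n j -
    series a b (lowPass M (psiCoef a b c d (n * τ))) (grid a b M j)) j
  rw [← e]
  have e2 : ∀ l ∈ freq M, dft a b M (fun j => psi a b ε τ φ γ M n j -
      series a b (lowPass M (psiCoef a b c d (n * τ))) (grid a b M j)) l =
      errCoef a b ε τ φ γ M c d n l := fun l hl => by
    rw [dft_sub, dft_series_lowPass hab hM hE _ hl, errCoef, onFreq, if_pos hl]
  rw [Finset.sum_congr rfl fun l hl => by rw [e2 l hl]]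
  refine (norm_sum_le _ _).trans ?_
  simp only [norm_mul_mode]
  exact (hs.sum_le_tsum _ fun _ _ => norm_nonneg _).trans (tsum_norm_le_of_nrm hab hB h)

/-- The bound for the numerical solution in the stability estimate. -/
noncomputable def supConst (a b K : ℝ) : ℝ := embConst a b * (2 * K) + embConst a b

lemma supConst_nonneg (hK : 0 ≤ K) : 0 ≤ supConst a b K :=
  add_nonneg (mul_nonneg embConst_nonneg (by positivity)) embConst_nonneg

/-- The constant in the aliasing error of the nonlinearity. -/
noncomputable def spaceConst (a b K : ℝ) (m : ℕ) : ℝ :=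
  aliasConst * (supConst a b K ^ 2 * K + compConst a b (m + 1) K)

lemma spaceConst_nonneg (hK : 0 ≤ K) : 0 ≤ spaceConst a b K m :=
  mul_nonneg aliasConst_nonneg (add_nonneg (by positivity) (compConst_nonneg hK))

lemma norm_nonlin_sub_le (hε : 0 < ε) {B : ℝ} {x y : ℝ} (hx : |x| ≤ B) (hy : |y| ≤ B) :
    ‖(nonlin ε x : ℂ) - (nonlin ε y : ℂ)‖ ≤ ε ^ 2 * B ^ 2 * |x - y| := by
  rw [← Complex.ofReal_sub, Complex.norm_real, Real.norm_eq_abs]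
  exact abs_nonlin_sub_le hε hx hy

/-- Passes from the numerical `ψ` to the low-pass exact `ψ`, then to the exact `w`, then to the
low-pass exact nonlinearity. An error of at most `1` serves only to bound the numerical solution
pointwise. -/
lemma nrm_nonlinErr_le {S : ℝ} (h : FourierSolution a b ε S m K c d) (hab : a < b) (hK : 0 ≤ K)
    (hε : 0 < ε) (hε1 : ε ≤ 1) (hM : 0 < M) (hE : Even M) {n : ℕ} (ht : (n : ℝ) * τ ∈ Set.Icc 0 S)
    (herr : nrm (fun l => delta a b l * errCoef a b ε τ φ γ M c d n l) ≤ 1) :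
    nrm (nonlinErr a b ε τ φ γ M c n) ≤ ENNReal.ofReal (ε ^ 2 * supConst a b K ^ 2) *
        nrm (fun l => delta a b l * errCoef a b ε τ φ γ M c d n l) +
      ENNReal.ofReal (ε ^ 2 * spaceConst a b K m * mesh a b M ^ (m + 1)) := by
  set t := (n : ℝ) * τ with htdef
  set B := supConst a b K with hB
  have hB0 : 0 ≤ B := supConst_nonneg hK
  have hEK := mul_nonneg (embConst_nonneg (a := a) (b := b)) hK
  have hE0 := embConst_nonneg (a := a) (b := b)
  have hh := mesh_pos hab hM
  have hc := h.summable_c hab ht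
  have hψ1 : nrm (fun l => (delta a b l : ℂ) * psiCoef a b c d t l) ≤ ENNReal.ofReal (2 * K) :=
    delta_mul_le_pow (by omega) (h.nrm_psiCoef_le ht)
  have hψ : Summable fun l => ‖psiCoef a b c d t l‖ := summable_norm_of_nrm hab hψ1
  have herr' : nrm (fun l => delta a b l * errCoef a b ε τ φ γ M c d n l) ≤ ENNReal.ofReal 1 := by
    rwa [ENNReal.ofReal_one]
  set v : Fin (M + 1) → ℂ := fun j => series a b (lowPass M (psiCoef a b c d t)) (grid a b M j)
    with hv
  set W : Fin (M + 1) → ℂ := fun j => series a b (c t) (grid a b M j) with hW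
  have hvB : ∀ j, ‖v j‖ ≤ embConst a b * (2 * K) := fun j =>
    (norm_series_lowPass_le hψ _).trans (tsum_norm_le_of_nrm hab (by positivity) hψ1)
  have hWB : ∀ j, ‖W j‖ ≤ B := fun j =>
    (h.norm_series_c_le hab hK ht _).trans (by rw [hB, supConst]; linarith)
  have huB : ∀ j : Fin M, ‖psi a b ε τ φ γ M n j.castSucc‖ ≤ B := fun j => by
    have h1 := norm_psi_sub_le hab hM hE zero_le_one herr' j
    have h2 := norm_le_norm_add_norm_sub' (psi a b ε τ φ γ M n j.castSucc) (v j.castSucc)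
    have h3 := hvB j.castSucc
    rw [hB, supConst]
    simp only [hv] at h2 h3
    linarith
  have hvB' : ∀ j, ‖v j‖ ≤ B := fun j => (hvB j).trans (by rw [hB, supConst]; linarith)
  have hre : ∀ {z : ℂ}, ‖z‖ ≤ B → |z.re| ≤ B := fun hz => (Complex.abs_re_le_norm _).trans hz
  set u := psi a b ε τ φ γ M n with hu
  let N : (Fin (M + 1) → ℂ) → Fin (M + 1) → ℂ := fun u j => (nonlin ε (u j).re : ℂ)
  have h1 : nrm (onFreq M (dft a b M fun j => N u j - N v j)) ≤
      ENNReal.ofReal (ε ^ 2 * B ^ 2) *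
        nrm (fun l => delta a b l * errCoef a b ε τ φ γ M c d n l) := by
    refine (nrm_dft_le_mul hab hM hE (v := fun j => u j - v j) (by positivity)
      fun j => ?_).trans (mul_le_mul_right ?_ _)
    · refine (norm_nonlin_sub_le hε (hre (huB j)) (hre (hvB' _))).trans ?_
      gcongr
      rw [← Complex.sub_re]
      exact Complex.abs_re_le_norm _
    · have e : onFreq M (dft a b M fun j => u j - v j) = errCoef a b ε τ φ γ M c d n := by
        refine onFreq_congr fun l hl => ?_
        rw [dft_sub, dft_series_lowPass hab hM hE _ hl]
      rw [e]
      refine nrm_le_of_pow (a := a) (b := b) (s := 1) ?_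
      simp only [pow_one, le_refl]
  -- The nonlinearity sees only real parts, and the real part of the low-pass `ψ` is the low-pass
  -- `w`. The difference is thus an aliasing error of `w ∈ H^{m+1}`.
  have h2 : nrm (onFreq M (dft a b M fun j => N v j - N W j)) ≤
      ENNReal.ofReal (ε ^ 2 * B ^ 2) *
        (ENNReal.ofReal (aliasConst * mesh a b M ^ (m + 1)) * ENNReal.ofReal K) := by
    refine (nrm_dft_le_mul hab hM hE
      (v := fun j => W j - (1 / 2) * (v j + (starRingEnd ℂ) (v j))) (by positivity)
      fun j => ?_).trans (mul_le_mul_right ?_ _)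
    · refine (norm_nonlin_sub_le hε (hre (hvB' _)) (hre (hWB _))).trans ?_
      gcongr
      have e : W j.castSucc - (1 / 2) * (v j.castSucc + (starRingEnd ℂ) (v j.castSucc)) =
          (((W j.castSucc).re - (v j.castSucc).re : ℝ) : ℂ) := by
        rw [Complex.add_conj, Complex.ofReal_sub, series_eq_ofReal_re (h.conj_c t)]
        push_cast; ring
      rw [e, Complex.norm_real, Real.norm_eq_abs, abs_sub_comm]
    · have e : onFreq M (dft a b M fun j => W j - (1 / 2) * (v j + (starRingEnd ℂ) (v j))) =
          onFreq M fun l => dft a b M W l - lowPass M (c t) l := by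
        refine onFreq_congr fun l hl => ?_
        rw [dft_sub, dft_const_mul, dft_add, dft_conj, dft_series_lowPass hab hM hE _ hl,
          dft_series_lowPass_neg hab hM hE _ hl]
        congr 1
        simp only [lowPass, abs_neg]
        split_ifs
        · rw [h.c_eq t l]
        · simp
      rw [e]
      exact (nrm_alias_le hab hM hE (by omega) hc).trans (mul_le_mul_right (h.bound_c t ht) _)
  have hF := nrm_nonlin_le hab (s := m + 1) (by omega) (h.conj_c t) hK (h.bound_c t ht) hε hε1
  have hFs : Summable fun l => ‖nonlinCoef a b ε (c t) l‖ :=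
    summable_norm_of_nrm hab (delta_mul_le_pow (by omega) hF)
  -- Aliasing error of the exact nonlinearity, which by the composition estimate is as smooth as
  -- `w`.
  have h3 : nrm (onFreq M fun l => dft a b M (N W) l - lowPass M (nonlinCoef a b ε (c t)) l) ≤
      ENNReal.ofReal (aliasConst * mesh a b M ^ (m + 1)) *
        ENNReal.ofReal (ε ^ 2 * compConst a b (m + 1) K) := by
    have hcont : Continuous fun x => (nonlin ε (series a b (c t) x).re : ℂ) :=
      Complex.continuous_ofReal.comp ((continuous_nonlin ε).comp
        (Complex.continuous_re.comp (continuous_series hc)))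
    have e : N W = fun j => series a b (nonlinCoef a b ε (c t)) (grid a b M j) := by
      funext j
      exact eq_series_of_continuousOn hab hcont.continuousOn hFs _ (grid_mem hab hM j)
    rw [e]
    exact (nrm_alias_le hab hM hE (by omega) hFs).trans (mul_le_mul_right hF _)
  have e : nonlinErr a b ε τ φ γ M c n = fun l =>
      onFreq M (dft a b M fun j => N u j - N v j) l +
        (onFreq M (dft a b M fun j => N v j - N W j) l +
          onFreq M (fun l => dft a b M (N W) l - lowPass M (nonlinCoef a b ε (c t)) l) l) := by
    funext l
    simp only [nonlinErr, onFreq]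
    split_ifs
    · rw [dft_sub, dft_sub]
      simp only [N]
      ring
    · simp
  rw [e]
  refine (nrm_add_le _ _).trans (add_le_add h1 ((nrm_add_le _ _).trans
    ((add_le_add h2 h3).trans (le_of_eq ?_))))
  have hA := aliasConst_nonneg
  have hCm := compConst_nonneg (a := a) (b := b) (s := m + 1) hK
  rw [← ENNReal.ofReal_mul (by positivity), ← ENNReal.ofReal_mul (by positivity),
    ← ENNReal.ofReal_mul (by positivity), ← ENNReal.ofReal_add (by positivity) (by positivity)]
  congr 1
  rw [spaceConst]; ring

/-! ### The discrete Gronwall argument -/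

/-- The recursive inequality is available only while all earlier errors are at most `1`. The
smallness of the final bound restores this at each step, and the geometric sum reproduces `A(1 +
θ)^n` exactly. -/
lemma gronwall_bootstrap {E : ℕ → ℝ≥0∞} {A θ : ℝ} {N : ℕ} (hA : 0 ≤ A) (hθ : 0 ≤ θ)
    (h : ∀ n ≤ N, (∀ k < n, E k ≤ 1) →
      E n ≤ ENNReal.ofReal A + ENNReal.ofReal θ * ∑ k ∈ Finset.range n, E k)
    (hsmall : A * (1 + θ) ^ N ≤ 1) : ∀ n ≤ N, E n ≤ ENNReal.ofReal (A * (1 + θ) ^ n) := by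
  intro n
  induction n using Nat.strong_induction_on with
  | _ n ih =>
    intro hn
    have hk : ∀ k < n, E k ≤ ENNReal.ofReal (A * (1 + θ) ^ k) := fun k hk => ih k hk (by omega)
    have hk1 : ∀ k < n, E k ≤ 1 := fun k hkn => by
      refine (hk k hkn).trans ?_
      rw [← ENNReal.ofReal_one]
      refine ENNReal.ofReal_le_ofReal (le_trans ?_ hsmall)
      gcongr
      · linarith
      · omega
    refine (h n hn hk1).trans ?_
    have hs : ∑ k ∈ Finset.range n, E k ≤
        ENNReal.ofReal (∑ k ∈ Finset.range n, A * (1 + θ) ^ k) := by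
      rw [ENNReal.ofReal_sum_of_nonneg fun k _ => by positivity]
      exact Finset.sum_le_sum fun k hkn => hk k (Finset.mem_range.1 hkn)
    refine (add_le_add le_rfl (mul_le_mul_right hs _)).trans (le_of_eq ?_)
    rw [← ENNReal.ofReal_mul hθ, ← ENNReal.ofReal_add hA (by positivity)]
    congr 1
    rw [← Finset.mul_sum]
    have := geom_sum_mul (1 + θ) n
    rw [add_sub_cancel_left] at this
    linear_combination A * this

/-- The error bound in Fourier variables, under a smallness condition. -/
lemma nrm_errCoef_le_of_small (h : FourierSolution a b ε (T / ε ^ 2) m K c d) (hab : a < b)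
    (hK : 0 ≤ K) (hT : 0 < T) (hε : 0 < ε) (hε1 : ε ≤ 1) (hM : 0 < M) (hE : Even M)
    (hτ : 0 < τ) {Λ : ℝ} (hΛ : 0 < Λ) (hΛτ : 12 * Λ * τ ≤ 1) {A₀ : ℝ} (hA₀ : 0 ≤ A₀)
    (h0 : nrm (fun l => delta a b l * errCoef a b ε τ φ γ M c d 0 l) ≤ ENNReal.ofReal A₀)
    (hsmall : (A₀ + T * spaceConst a b K m * mesh a b M ^ (m + 1) +
      tempConst a b T K * (ε ^ 2 * τ + Λ⁻¹ ^ (m + 1))) * Real.exp (T * supConst a b K ^ 2) ≤ 1)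
    {n : ℕ} (hn : n * τ ≤ T / ε ^ 2) :
    nrm (fun l => delta a b l * errCoef a b ε τ φ γ M c d n l) ≤
      ENNReal.ofReal ((A₀ + T * spaceConst a b K m * mesh a b M ^ (m + 1) +
        tempConst a b T K * (ε ^ 2 * τ + Λ⁻¹ ^ (m + 1))) *
          Real.exp (T * supConst a b K ^ 2)) := by
  have hh := mesh_pos hab hM
  have hSp := spaceConst_nonneg (a := a) (b := b) (m := m) hK
  have hB0 := supConst_nonneg (a := a) (b := b) hK
  have hTe : 0 ≤ tempConst a b T K := by
    have h1 := compConst_nonneg (a := a) (b := b) (s := 1) hK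
    have h2 := locConst_nonneg (a := a) (b := b) hK
    rw [tempConst]; positivity
  set A := A₀ + T * spaceConst a b K m * mesh a b M ^ (m + 1) +
    tempConst a b T K * (ε ^ 2 * τ + Λ⁻¹ ^ (m + 1)) with hA
  have hA0 : 0 ≤ A := by positivity
  set θ := τ * (ε ^ 2 * supConst a b K ^ 2) with hθ
  have hθ0 : 0 ≤ θ := by positivity
  have hnε : ∀ k ≤ n, (k : ℝ) * τ * ε ^ 2 ≤ T := fun k hk => by
    rw [le_div_iff₀ (by positivity)] at hn
    refine le_trans ?_ hn
    gcongr
  -- The growth per step is `O(ε²τ)`, so up to time `T/ε²` the total growth is independent of `ε`.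
  have hpow : ∀ k ≤ n, (1 + θ) ^ k ≤ Real.exp (T * supConst a b K ^ 2) := fun k hk => by
    have h1 : 1 + θ ≤ Real.exp θ := by linarith [Real.add_one_le_exp θ]
    calc (1 + θ) ^ k ≤ Real.exp θ ^ k := by gcongr
      _ = Real.exp (k * θ) := (Real.exp_nat_mul _ _).symm
      _ ≤ _ := by
        apply Real.exp_le_exp.2
        have : (k : ℝ) * θ = (k * τ * ε ^ 2) * supConst a b K ^ 2 := by rw [hθ]; ring
        rw [this]
        gcongr
        exact hnε k hk
  have hmem : ∀ k ≤ n, (k : ℝ) * τ ∈ Set.Icc 0 (T / ε ^ 2) := fun k hk =>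
    ⟨by positivity, le_trans (by gcongr) hn⟩
  refine (gronwall_bootstrap (N := n)
    (E := fun k => nrm fun l => (delta a b l : ℂ) * errCoef a b ε τ φ γ M c d k l) hA0 hθ0 (fun k hk hk1 => ?_) ?_ n le_rfl).trans
    (ENNReal.ofReal_le_ofReal (mul_le_mul_of_nonneg_left (hpow n le_rfl) hA0))
  · refine (nrm_errCoef_le hab hM hE hτ.le k).trans ?_
    have hloc : nrm (fun l => ∑ i ∈ Finset.range k, locErr a b ε τ c d i l) ≤
        ENNReal.ofReal (tempConst a b T K * (ε ^ 2 * τ + Λ⁻¹ ^ (m + 1))) :=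
      h.nrm_sum_local_error_le hab hK hT hε hε1 hΛ hτ hΛτ (hmem k hk).2
    have hnl : ∑ i ∈ Finset.range k, nrm (nonlinErr a b ε τ φ γ M c i) ≤
        ENNReal.ofReal (ε ^ 2 * supConst a b K ^ 2) * ∑ i ∈ Finset.range k,
          nrm (fun l => delta a b l * errCoef a b ε τ φ γ M c d i l) +
        ENNReal.ofReal (k * (ε ^ 2 * spaceConst a b K m * mesh a b M ^ (m + 1))) := by
      refine (Finset.sum_le_sum fun i hi => nrm_nonlinErr_le h hab hK hε hε1 hM hE
        (hmem i ((Finset.mem_range.1 hi).le.trans hk)) (hk1 i (Finset.mem_range.1 hi))).trans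
        (le_of_eq ?_)
      rw [Finset.sum_add_distrib, ← Finset.mul_sum, Finset.sum_const, Finset.card_range,
        nsmul_eq_mul, ENNReal.ofReal_mul (p := (k : ℝ)) (by positivity), ENNReal.ofReal_natCast]
    refine (add_le_add (add_le_add h0 (mul_le_mul_right hnl _)) hloc).trans ?_
    rw [mul_add, ← mul_assoc, ← ENNReal.ofReal_mul hτ.le, ← ENNReal.ofReal_mul hτ.le, ← hθ]
    have e : ∀ X : ℝ≥0∞, ENNReal.ofReal A₀ + (X + ENNReal.ofReal (τ * (k * (ε ^ 2 *
        spaceConst a b K m * mesh a b M ^ (m + 1))))) +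
        ENNReal.ofReal (tempConst a b T K * (ε ^ 2 * τ + Λ⁻¹ ^ (m + 1))) =
        ENNReal.ofReal (A₀ + τ * (k * (ε ^ 2 * spaceConst a b K m * mesh a b M ^ (m + 1))) +
          tempConst a b T K * (ε ^ 2 * τ + Λ⁻¹ ^ (m + 1))) + X := fun X => by
      rw [ENNReal.ofReal_add (by positivity) (by positivity), ENNReal.ofReal_add hA₀
        (by positivity)]
      ring
    rw [e]
    refine add_le_add (ENNReal.ofReal_le_ofReal ?_) le_rfl
    rw [hA]
    have h5 : τ * (k * (ε ^ 2 * spaceConst a b K m * mesh a b M ^ (m + 1))) ≤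
        T * spaceConst a b K m * mesh a b M ^ (m + 1) := by
      have : τ * (k * (ε ^ 2 * spaceConst a b K m * mesh a b M ^ (m + 1))) =
          (k * τ * ε ^ 2) * (spaceConst a b K m * mesh a b M ^ (m + 1)) := by ring
      rw [this, mul_assoc T]
      gcongr
      exact hnε k hk
    linarith
  · exact (mul_le_mul_of_nonneg_left (hpow n le_rfl) hA0).trans hsmall

end SineGordon

/-! ### Interpolation of the initial data. -/

namespace SineGordon

open MeasureTheory Filter Topology
open scoped ENNReal NNReal

variable {a b ε τ T K : ℝ} {m M : ℕ} {φ γ : ℝ → ℝ} {c d : ℝ → ℤ → ℂ}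

/-! ### The error of the initial data -/

lemma exists_mesh_forall_lt (hab : a < b) (s : Finset ℤ) :
    ∃ h₀ : ℝ, 0 < h₀ ∧ ∀ M : ℕ, 0 < M → mesh a b M ≤ h₀ → ∀ l ∈ s, 2 * |l| < M := by
  have hL : 0 < b - a := sub_pos.2 hab
  have hN : (0 : ℤ) ≤ ∑ l ∈ s, |l| := Finset.sum_nonneg fun _ _ => abs_nonneg _
  have hN' : (0 : ℝ) < 2 * ((∑ l ∈ s, |l| : ℤ) : ℝ) + 1 := by
    have : (0 : ℝ) ≤ ((∑ l ∈ s, |l| : ℤ) : ℝ) := by exact_mod_cast hN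
    linarith
  refine ⟨(b - a) / (2 * ((∑ l ∈ s, |l| : ℤ) : ℝ) + 1), by positivity, fun M hM hh l hl => ?_⟩
  rw [mesh, div_le_div_iff_of_pos_left hL (by exact_mod_cast hM) hN'] at hh
  have h1 : 2 * (∑ l ∈ s, |l|) + 1 ≤ (M : ℤ) := by exact_mod_cast hh
  have h2 := Finset.single_le_sum (f := fun l : ℤ => |l|) (fun _ _ => abs_nonneg _) hl
  omega

lemma mesh_mul_delta_le (hab : a < b) (hM : 0 < M) (hE : Even M) {l : ℤ} (hl : l ∈ freq M) :
    mesh a b M * delta a b l ≤ b - a + Real.pi := by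
  have hL : 0 < b - a := sub_pos.2 hab
  have hh := mesh_pos hab hM
  have hM' : (0 : ℝ) < M := by exact_mod_cast hM
  have h1 : 2 * |(l : ℝ)| ≤ M := by
    rw [mem_freq_iff hE] at hl
    have : 2 * |l| ≤ M := by rcases abs_cases l with h | h <;> omega
    exact_mod_cast this
  have h2 : mesh a b M * |mu a b l| ≤ Real.pi := by
    rw [abs_mu hab, mesh]
    have e : (b - a) / (M : ℝ) * (2 * Real.pi / (b - a) * |(l : ℝ)|) =
        Real.pi * ((2 * |(l : ℝ)|) / M) := by field_simp
    rw [e]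
    refine mul_le_of_le_one_right Real.pi_pos.le ?_
    rwa [div_le_one hM']
  calc mesh a b M * delta a b l ≤ mesh a b M * (1 + |mu a b l|) := by gcongr; exact delta_le l
    _ ≤ _ := by
      rw [mul_add, mul_one]
      exact add_le_add (mesh_le hab hM) h2

/-- The inverse inequality: on `T_M` one derivative costs a factor `1/h`. -/
lemma nrm_delta_mul_onFreq_le (hab : a < b) (hM : 0 < M) (hE : Even M) (u : ℤ → ℂ) :
    nrm (fun l => (delta a b l : ℂ) * onFreq M u l) ≤
      ENNReal.ofReal ((b - a + Real.pi) / mesh a b M) * nrm (onFreq M u) := by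
  have hh := mesh_pos hab hM
  refine nrm_le_mul fun l => ?_
  rw [norm_mul, norm_delta]
  by_cases hl : l ∈ freq M
  · gcongr
    rw [le_div_iff₀' hh]
    exact mesh_mul_delta_le hab hM hE hl
  · simp [onFreq, hl]

/-- The error of trigonometric interpolation in Fourier variables. -/
noncomputable def interpErr (a b : ℝ) (M : ℕ) (u : ℝ → ℂ) : ℤ → ℂ :=
  onFreq M fun l => dft a b M (fun j => u (grid a b M j)) l - lowPass M (fourierCoef a b u) l

lemma interpErr_eq_of_summable (hab : a < b) (hM : 0 < M) {u : ℝ → ℂ}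
    (hu : ContinuousOn u (Set.Icc a b)) (hs : Summable fun l => ‖fourierCoef a b u l‖) :
    interpErr a b M u = onFreq M fun l => dft a b M
      (fun j => series a b (fourierCoef a b u) (grid a b M j)) l -
        lowPass M (fourierCoef a b u) l := by
  unfold interpErr
  congr 1
  funext l
  rw [dft_congr (v := fun j => series a b (fourierCoef a b u) (grid a b M j)) fun j =>
    eq_series_of_continuousOn hab hu hs _ (grid_mem hab hM _)]

lemma nrm_interpErr_le (hab : a < b) (hM : 0 < M) (hE : Even M) {u : ℝ → ℂ} {s : ℕ} (hs : 1 ≤ s)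
    (hu : ContinuousOn u (Set.Icc a b))
    (hK : nrm (fun l => (delta a b l : ℂ) ^ s * fourierCoef a b u l) ≤ ENNReal.ofReal K) :
    nrm (interpErr a b M u) ≤ ENNReal.ofReal (aliasConst * mesh a b M ^ s * K) := by
  have hh := mesh_pos hab hM
  have h1 := summable_norm_of_nrm hab (delta_mul_le_pow hs hK)
  rw [interpErr_eq_of_summable hab hM hu h1, ENNReal.ofReal_mul
    (mul_nonneg aliasConst_nonneg (by positivity))]
  exact (nrm_alias_le hab hM hE hs h1).trans (mul_le_mul_right hK _)

/-- The low-pass part is reproduced exactly, so only the tail aliases. The factor `h` compensates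
the inverse inequality, and the tail supplies the smallness even without a rate. -/
lemma nrm_alias_le_tail (hab : a < b) (hM : 0 < M) (hE : Even M) {u : ℤ → ℂ}
    (hu : Summable fun l => ‖u l‖) :
    nrm (onFreq M fun l => dft a b M (fun j => series a b u (grid a b M j)) l - lowPass M u l) ≤
      ENNReal.ofReal (aliasConst * mesh a b M) *
        nrm (fun l => (delta a b l : ℂ) * (u l - lowPass M u l)) := by
  have hs : Summable fun l => ‖u l - lowPass M u l‖ :=
    hu.of_nonneg_of_le (fun _ => norm_nonneg _) fun l => by
      rw [lowPass]; split_ifs <;> simp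
  have h := nrm_alias_le hab hM hE le_rfl hs
  simp only [pow_one] at h
  refine le_of_eq_of_le ?_ h
  congr 1
  refine onFreq_congr fun l hl => ?_
  have e1 : ∀ x, series a b (fun l => u l - lowPass M u l) x =
      series a b u x - series a b (lowPass M u) x := fun x => by
    simp only [series, sub_mul]
    exact (summable_mul_mode hu x).tsum_sub (summable_mul_mode (summable_lowPass hu) x)
  have e2 : lowPass M (fun l => u l - lowPass M u l) l = 0 := by
    simp only [lowPass]; split_ifs <;> simp
  simp only [e1, e2]
  rw [dft_sub, dft_series_lowPass hab hM hE u hl, sub_zero]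

lemma exists_mesh_nrm_sub_lowPass_le (hab : a < b) {u : ℤ → ℂ} (hu : nrm u < ⊤) {η : ℝ}
    (hη : 0 < η) : ∃ h₀ : ℝ, 0 < h₀ ∧ ∀ M : ℕ, 0 < M → mesh a b M ≤ h₀ →
      nrm (fun l => u l - lowPass M u l) ≤ ENNReal.ofReal η := by
  have h1 : ∑' l, ‖u l‖ₑ ^ 2 ≠ ⊤ := by
    rw [← nrm_sq]; exact (ENNReal.pow_lt_top hu).ne
  obtain ⟨s, hs⟩ := ((tendsto_order.1 (ENNReal.tendsto_tsum_compl_atTop_zero h1)).2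
    (ENNReal.ofReal η ^ 2) (by positivity)).exists
  obtain ⟨h₀, h₀pos, H⟩ := exists_mesh_forall_lt hab s
  refine ⟨h₀, h₀pos, fun M hM hh => ?_⟩
  rw [← ENNReal.pow_le_pow_left_iff two_ne_zero, nrm_sq]
  refine le_trans ?_ hs.le
  have e : ∑' b : { x // x ∉ s }, ‖u b‖ₑ ^ 2 =
      ∑' l : ℤ, ({x | x ∉ s} : Set ℤ).indicator (fun l => ‖u l‖ₑ ^ 2) l :=
    tsum_subtype ({x | x ∉ s} : Set ℤ) fun l => ‖u l‖ₑ ^ 2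
  rw [e]
  refine ENNReal.tsum_le_tsum fun l => ?_
  by_cases hl : l ∈ s
  · rw [lowPass, if_pos (H M hM hh l hl)]; simp
  · rw [Set.indicator_of_mem (by exact hl)]
    rw [lowPass]; split_ifs <;> simp

/-- Interpolation converges in `H¹` for `H¹` data. The finiteness condition comes after the choice
of `h₀`, because for `u = φ` it is known only once a solution is given. -/
lemma exists_mesh_nrm_delta_interpErr_le (hab : a < b) {u : ℝ → ℂ}
    (hu : ContinuousOn u (Set.Icc a b)) {η : ℝ} (hη : 0 < η) :
    ∃ h₀ : ℝ, 0 < h₀ ∧ ∀ M : ℕ, 0 < M → Even M → mesh a b M ≤ h₀ →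
      nrm (fun l => (delta a b l : ℂ) * fourierCoef a b u l) < ⊤ →
      nrm (fun l => (delta a b l : ℂ) * interpErr a b M u l) ≤ ENNReal.ofReal η := by
  -- If the `H¹` norm is infinite the claim is vacuous and any `h₀` will do.
  by_cases hK : nrm (fun l => (delta a b l : ℂ) * fourierCoef a b u l) < ⊤
  swap
  · exact ⟨1, one_pos, fun M _ _ _ h => absurd h hK⟩
  have hL : 0 < b - a := sub_pos.2 hab
  have hpi := Real.pi_pos
  have hA := aliasConst_nonneg
  obtain ⟨h₀, h₀pos, H⟩ := exists_mesh_nrm_sub_lowPass_le hab hK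
    (η := η / ((b - a + Real.pi) * aliasConst + 1)) (by positivity)
  refine ⟨h₀, h₀pos, fun M hM hE hh _ => ?_⟩
  have hs : Summable fun l => ‖fourierCoef a b u l‖ := by
    refine summable_norm_of_nrm hab 
      (K := (nrm fun l => (delta a b l : ℂ) * fourierCoef a b u l).toReal) ?_
    rw [ENNReal.ofReal_toReal hK.ne]
  have hm := mesh_pos hab hM
  rw [interpErr_eq_of_summable hab hM hu hs]
  refine (nrm_delta_mul_onFreq_le hab hM hE _).trans ((mul_le_mul_right
    (nrm_alias_le_tail hab hM hE hs) _).trans ?_)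
  have e : (fun l => (delta a b l : ℂ) * (fourierCoef a b u l -
      lowPass M (fourierCoef a b u) l)) = fun l => (delta a b l : ℂ) * fourierCoef a b u l -
      lowPass M (fun l => (delta a b l : ℂ) * fourierCoef a b u l) l := by
    funext l
    simp only [lowPass]; split_ifs <;> simp
  rw [e]
  refine (mul_le_mul_right (mul_le_mul_right (H M hM hh) _) _).trans ?_
  rw [← ENNReal.ofReal_mul (by positivity), ← ENNReal.ofReal_mul (by positivity)]
  apply ENNReal.ofReal_le_ofReal
  have e2 : (b - a + Real.pi) / mesh a b M * (aliasConst * mesh a b M *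
      (η / ((b - a + Real.pi) * aliasConst + 1))) =
      η * (((b - a + Real.pi) * aliasConst) / ((b - a + Real.pi) * aliasConst + 1)) := by
    field_simp
  rw [e2]
  refine mul_le_of_le_one_right hη.le ?_
  rw [div_le_one (by positivity)]
  linarith

/-- Density of the trigonometric polynomials. -/
lemma exists_series_approx (hab : a < b) {u : ℝ → ℂ} (hu : ContinuousOn u (Set.Icc a b))
    (hp : u a = u b) {η : ℝ} (hη : 0 < η) :
    ∃ q : ℤ →₀ ℂ, ∀ x ∈ Set.Icc a b, ‖u x - series a b q x‖ ≤ η := by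
  have : Fact (0 < b - a) := ⟨sub_pos.2 hab⟩
  have eb : a + (b - a) = b := by ring
  let U : C(AddCircle (b - a), ℂ) := ⟨AddCircle.liftIco (b - a) a u,
    AddCircle.liftIco_continuous (by rw [eb, hp]) (by rwa [eb])⟩
  have hU : U ∈ (Submodule.span ℂ (Set.range <| @fourier (b - a))).topologicalClosure := by
    rw [span_fourier_closure_eq_top]; trivial
  obtain ⟨p, hpm, hpU⟩ := Metric.mem_closure_iff.1 hU η hη
  obtain ⟨q, rfl⟩ := Finsupp.mem_span_range_iff_exists_finsupp.1 hpm
  have hfm : ∀ (k : ℤ) (x : ℝ), fourier k (x : AddCircle (b - a)) =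
      fourier k (a : AddCircle (b - a)) * mode a b k x := fun k x => by
    rw [fourier_coe_apply, fourier_coe_apply, mode, ← Complex.exp_add]
    congr 1
    have : ((b - a : ℝ) : ℂ) ≠ 0 := by exact_mod_cast (sub_pos.2 hab).ne'
    rw [mu]; push_cast at this ⊢; field_simp; ring
  refine ⟨Finsupp.onFinset q.support (fun k => q k * fourier k (a : AddCircle (b - a)))
    (fun k hk => Finsupp.mem_support_iff.2 (left_ne_zero_of_mul hk)), ?_⟩
  have key : ∀ x ∈ Set.Ico a b, ‖u x - series a b (Finsupp.onFinset q.support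
      (fun k => q k * fourier k (a : AddCircle (b - a)))
      (fun k hk => Finsupp.mem_support_iff.2 (left_ne_zero_of_mul hk))) x‖ ≤ η := fun x hx => by
    have h1 := (ContinuousMap.dist_apply_le_dist (f := U)
      (g := q.sum fun i a => a • fourier i) (x : AddCircle (b - a))).trans hpU.le
    have h2 : U (x : AddCircle (b - a)) = u x :=
      AddCircle.liftIco_coe_apply (by rwa [eb])
    rw [h2, dist_eq_norm] at h1
    refine le_of_eq_of_le ?_ h1
    congr 2
    rw [series, tsum_eq_sum (s := q.support), Finsupp.sum, ContinuousMap.sum_apply]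
    · refine Finset.sum_congr rfl fun k _ => ?_
      rw [ContinuousMap.smul_apply, smul_eq_mul, hfm k x, Finsupp.onFinset_apply, mul_assoc]
    · intro k hk
      rw [Finsupp.onFinset_apply, Finsupp.notMem_support_iff.1 hk]
      simp
  intro x hx
  rcases hx.2.eq_or_lt with rfl | h
  -- At the right endpoint `u` and all modes take their values at `a`, which the half-open interval
  -- already covers.
  · have := key a ⟨le_rfl, hab⟩
    rw [hp] at this
    convert this using 3
    have hm : ∀ k : ℤ, mode a x k x = mode a x k a := fun k => by
      have h1 := hfm k x
      have h2 : ((x : ℝ) : AddCircle (x - a)) = (a : ℝ) := by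
        have := AddCircle.coe_add_period (x - a) a
        rwa [show a + (x - a) = x by ring] at this
      have h3 := hfm k a
      rw [h2] at h1
      have h4 : fourier k (a : AddCircle (x - a)) ≠ 0 := by
        rw [fourier_coe_apply]; exact Complex.exp_ne_zero _
      exact mul_left_cancel₀ h4 (h1.symm.trans h3)
    simp only [series, hm]
  · exact key x ⟨hx.1, h⟩

/-- A uniformly close trigonometric polynomial is interpolated exactly on fine grids, and the
remainder is small in both the discrete and the continuous norm. For `m = 0` this is all that is
available for `γ`, which is only continuous. -/
lemma exists_mesh_nrm_interpErr_le (hab : a < b) {u : ℝ → ℂ} (hu : ContinuousOn u (Set.Icc a b))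
    (hp : u a = u b) {η : ℝ} (hη : 0 < η) :
    ∃ h₀ : ℝ, 0 < h₀ ∧ ∀ M : ℕ, 0 < M → Even M → mesh a b M ≤ h₀ →
      nrm (interpErr a b M u) ≤ ENNReal.ofReal η := by
  obtain ⟨q, hq⟩ := exists_series_approx hab hu hp (half_pos hη)
  obtain ⟨h₀, h₀pos, H⟩ := exists_mesh_forall_lt hab q.support
  refine ⟨h₀, h₀pos, fun M hM hE hh => ?_⟩
  have hlow : lowPass M q = q := funext fun l => by
    rw [lowPass]; split_ifs with h
    · rfl
    · by_contra h'
      exact h (H M hM hh l (Finsupp.mem_support_iff.2 (Ne.symm h')))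
  have hqs : Summable fun l => ‖q l‖ := summable_of_ne_finset_zero (s := q.support) fun l hl => by
    rw [Finsupp.notMem_support_iff.1 hl, norm_zero]
  have hmem := memLp_of_continuousOn hu
  have hmq : MemLp (series a b q) 2 (volume.restrict (Set.Ioc a b)) :=
    memLp_of_continuousOn (continuous_series hqs).continuousOn
  have hf : ∀ l, fourierCoef a b (fun x => u x - series a b q x) l = fourierCoef a b u l - q l :=
    fun l => by
      rw [fourierCoef_sub (MemLp.intervalIntegrable_two hab hmem)
        (MemLp.intervalIntegrable_two hab hmq), fourierCoef_series hab hqs]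
  have e : interpErr a b M u = fun l =>
      onFreq M (dft a b M fun j => u (grid a b M j) - series a b q (grid a b M j)) l -
        onFreq M (lowPass M (fourierCoef a b fun x => u x - series a b q x)) l := by
    funext l
    simp only [interpErr, onFreq]
    split_ifs with hl
    · have h1 := dft_series_lowPass hab hM hE q hl
      rw [hlow] at h1
      rw [dft_sub, h1]
      simp only [lowPass, hf]
      have h2 := congrFun hlow l
      simp only [lowPass] at h2
      split_ifs at h2 ⊢ with h3
      · ring
      · rw [← h2]; ring
    · simp
  have hle : ∀ v : ℤ → ℂ, nrm (onFreq M (lowPass M v)) ≤ nrm v := fun v => nrm_mono fun l => by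
    simp only [onFreq, lowPass]; split_ifs <;> simp
  rw [e]
  refine (nrm_sub_le _ _).trans ((add_le_add
    (nrm_dft_le hab hM hE (half_pos hη).le fun j => hq _ (grid_mem hab hM _))
    ((hle _).trans (nrm_fourierCoef_le_of_bound hab (half_pos hη).le (hmem.sub hmq) hq))).trans
    (le_of_eq ?_))
  rw [← ENNReal.ofReal_add (half_pos hη).le (half_pos hη).le, add_halves]

/-- The factor `1/δ` in front of `γ` in `ψ⁰` cancels the weight `δ`, so `φ` is measured in `H¹` but
`γ` only in `L²`. -/
lemma nrm_errCoef_zero_le (hab : a < b) (hM : 0 < M) (hE : Even M)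
    (hc : c 0 = fourierCoef a b fun x => (φ x : ℂ)) (hd : d 0 = fourierCoef a b fun x => (γ x : ℂ)) :
    nrm (fun l => delta a b l * errCoef a b ε τ φ γ M c d 0 l) ≤
      nrm (fun l => delta a b l * interpErr a b M (fun x => (φ x : ℂ)) l) +
        nrm (interpErr a b M fun x => (γ x : ℂ)) := by
  have e : (fun l => delta a b l * errCoef a b ε τ φ γ M c d 0 l) = fun l =>
      delta a b l * interpErr a b M (fun x => (φ x : ℂ)) l -
        Complex.I * interpErr a b M (fun x => (γ x : ℂ)) l := by
    funext l
    have h := delta_ne (a := a) (b := b) l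
    simp only [errCoef, interpErr, onFreq]
    split_ifs with hl
    · rw [dft_psi_zero hab hM hE hl]
      simp only [lowPass, psiCoef, Nat.cast_zero, zero_mul, hc, hd]
      split_ifs <;> field_simp <;> ring
    · simp
  rw [e]
  refine (nrm_sub_le _ _).trans (add_le_add le_rfl ?_)
  rw [nrm_const_mul, enorm_I, one_mul]

end SineGordon

/-! ### Return to `w` and `∂_t w`. -/

namespace SineGordon

open MeasureTheory Filter Topology
open scoped ENNReal NNReal

variable {a b ε τ T K : ℝ} {m M : ℕ} {φ γ : ℝ → ℝ} {c d : ℝ → ℤ → ℂ}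

/-! ### The error of the scheme in physical variables -/

lemma continuous_interp (u : Fin (M + 1) → ℂ) : Continuous (interp a b M u) :=
  continuous_finsetSum _ fun l _ => continuous_const.mul (continuous_mode l)

lemma fourierCoef_interp (hab : a < b) (u : Fin (M + 1) → ℂ) :
    fourierCoef a b (interp a b M u) = onFreq M (dft a b M u) := by
  funext l
  have : interp a b M u = fun x => ∑ l ∈ freq M, dft a b M u l * mode a b l x := rfl
  rw [this, fourierCoef_sum _ (u := fun l x => dft a b M u l * mode a b l x) fun l _ =>
    (continuous_const.mul (continuous_mode l)).intervalIntegrable _ _]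
  simp only [fourierCoef_const_mul, fourierCoef_mode hab, mul_ite, mul_one, mul_zero,
    Finset.sum_ite_eq', onFreq]

lemma nrm_le_two_mul {x y : ℤ → ℂ} (h : ∀ l, ‖y l‖ ≤ ‖x l‖ + ‖x (-l)‖) :
    nrm y ≤ 2 * nrm x := by
  have h1 : nrm y ≤ nrm fun l => (‖x l‖ : ℂ) + (‖x (-l)‖ : ℂ) := nrm_mono fun l => by
    rw [← Complex.ofReal_add, Complex.norm_real, Real.norm_of_nonneg (by positivity)]
    exact h l
  have h2 : nrm (fun l => (‖x l‖ : ℂ)) = nrm x := nrm_congr_norm fun l => by simp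
  have h3 : nrm (fun l => (‖x (-l)‖ : ℂ)) = nrm x := by
    rw [← nrm_comp_equiv (Equiv.neg ℤ) x]
    exact nrm_congr_norm fun l => by simp
  refine h1.trans ((nrm_add_le _ _).trans (le_of_eq ?_))
  rw [h2, h3, two_mul]

/-- Recovering the real unknowns needs the error at `-l`, which may fall outside `T_M`; for `l =
-M/2` it equals the error at `l`. The sum on the right covers both cases. -/
lemma norm_delta_mul_dft_neg_sub_le (hab : a < b) (hM : 0 < M) (hE : Even M) (n : ℕ) {l : ℤ}
    (hl : l ∈ freq M) :
    delta a b l * ‖dft a b M (psi a b ε τ φ γ M n) (-l) -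
      lowPass M (psiCoef a b c d (n * τ)) (-l)‖ ≤
      ‖delta a b l * errCoef a b ε τ φ γ M c d n l‖ +
        ‖delta a b (-l) * errCoef a b ε τ φ γ M c d n (-l)‖ := by
  rcases dft_neg_of_mem_freq hab hM hE (psi a b ε τ φ γ M n) hl with h | ⟨h, h1⟩
  · refine le_add_of_nonneg_of_le (norm_nonneg _) ?_
    rw [norm_mul, norm_delta, delta_neg, errCoef, onFreq, if_pos h]
  · refine le_add_of_le_of_nonneg ?_ (norm_nonneg _)
    rw [norm_mul, norm_delta, errCoef, onFreq, if_pos hl, h1, lowPass, lowPass, abs_neg,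
      if_neg (by omega), if_neg (by omega)]

/-- Truncating `w ∈ H^{m+1}` in the `H¹` norm costs `h^m`, which fixes the spatial rate; the rest is
a combination of the errors of `ψ` at `l` and `-l`. -/
lemma nrm_sub_wNum_le {S : ℝ} (h : FourierSolution a b ε S m K c d) (hab : a < b) (hM : 0 < M)
    (hE : Even M) {n : ℕ} (ht : n * τ ∈ Set.Icc 0 S) :
    nrm (fun l => (delta a b l : ℂ) ^ 1 *
      (c (n * τ) l - onFreq M (dft a b M (wNum a b ε τ φ γ M n)) l)) ≤
      ENNReal.ofReal (mesh a b M ^ m) * ENNReal.ofReal K +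
        2 * nrm (fun l => delta a b l * errCoef a b ε τ φ γ M c d n l) := by
  have e : (fun l => (delta a b l : ℂ) ^ 1 *
      (c (n * τ) l - onFreq M (dft a b M (wNum a b ε τ φ γ M n)) l)) = fun l =>
      (delta a b l : ℂ) ^ 1 * (c (n * τ) l - lowPass M (c (n * τ)) l) +
      delta a b l * (lowPass M (c (n * τ)) l -
        onFreq M (dft a b M (wNum a b ε τ φ γ M n)) l) := by
    funext l; ring
  rw [e]
  refine (nrm_add_le _ _).trans (add_le_add ((nrm_sub_lowPass_le hab hM 1 m _).trans
    (mul_le_mul_right ?_ _)) (nrm_le_two_mul fun l => ?_))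
  · rw [add_comm 1 m]; exact h.bound_c _ ht
  · by_cases hl : l ∈ freq M
    · have h1 := norm_delta_mul_dft_neg_sub_le (ε := ε) (τ := τ) (φ := φ) (γ := γ) (c := c)
        (d := d) hab hM hE n hl
      set P := dft a b M (psi a b ε τ φ γ M n) with hP
      set Q := lowPass M (psiCoef a b c d (n * τ)) with hQ
      have e1 : lowPass M (c (n * τ)) l = (1 / 2) * (Q l + (starRingEnd ℂ) (Q (-l))) := by
        simp only [hQ, lowPass, abs_neg]
        split_ifs
        · exact h.c_eq _ l
        · simp
      have e2 : (delta a b l : ℂ) * errCoef a b ε τ φ γ M c d n l =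
          delta a b l * (P l - Q l) := by rw [errCoef, onFreq, if_pos hl]
      rw [e1, onFreq, if_pos hl, dft_wNum hab hM hE n hl]
      have e3 : (delta a b l : ℂ) * (1 / 2 * (Q l + (starRingEnd ℂ) (Q (-l))) -
          1 / 2 * (P l + (starRingEnd ℂ) (P (-l)))) =
          -(1 / 2 * (delta a b l * (P l - Q l))) -
            1 / 2 * (delta a b l * (starRingEnd ℂ) (P (-l) - Q (-l))) := by
        rw [map_sub]; ring
      rw [e3]
      refine (norm_sub_le _ _).trans ?_
      rw [e2] at h1 ⊢
      simp only [norm_neg, norm_mul, norm_delta, RCLike.norm_conj] at h1 ⊢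
      norm_num at h1 ⊢
      have := norm_nonneg (errCoef a b ε τ φ γ M c d n (-l))
      have := delta_pos (a := a) (b := b) (-l)
      nlinarith [mul_nonneg this.le (norm_nonneg (errCoef a b ε τ φ γ M c d n (-l)))]
    · rw [onFreq, if_neg hl, lowPass, if_neg fun h => hl (mem_freq_of_lt hE h)]
      simp; positivity

lemma nrm_sub_zNum_le {S : ℝ} (h : FourierSolution a b ε S m K c d) (hab : a < b) (hM : 0 < M)
    (hE : Even M) {n : ℕ} (ht : n * τ ∈ Set.Icc 0 S) :
    nrm (fun l => (delta a b l : ℂ) ^ 0 *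
      (d (n * τ) l - onFreq M (dft a b M (zNum a b ε τ φ γ M n)) l)) ≤
      ENNReal.ofReal (mesh a b M ^ m) * ENNReal.ofReal K +
        2 * nrm (fun l => delta a b l * errCoef a b ε τ φ γ M c d n l) := by
  have e : (fun l => (delta a b l : ℂ) ^ 0 *
      (d (n * τ) l - onFreq M (dft a b M (zNum a b ε τ φ γ M n)) l)) = fun l =>
      (delta a b l : ℂ) ^ 0 * (d (n * τ) l - lowPass M (d (n * τ)) l) +
      (lowPass M (d (n * τ)) l - onFreq M (dft a b M (zNum a b ε τ φ γ M n)) l) := by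
    funext l; ring
  rw [e]
  refine (nrm_add_le _ _).trans (add_le_add ((nrm_sub_lowPass_le hab hM 0 m _).trans
    (mul_le_mul_right ?_ _)) (nrm_le_two_mul fun l => ?_))
  · rw [zero_add]; exact h.bound_d _ ht
  · by_cases hl : l ∈ freq M
    · have h1 := norm_delta_mul_dft_neg_sub_le (ε := ε) (τ := τ) (φ := φ) (γ := γ) (c := c)
        (d := d) hab hM hE n hl
      set P := dft a b M (psi a b ε τ φ γ M n) with hP
      set Q := lowPass M (psiCoef a b c d (n * τ)) with hQ
      have e1 : lowPass M (d (n * τ)) l =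
          Complex.I / 2 * delta a b l * (Q l - (starRingEnd ℂ) (Q (-l))) := by
        simp only [hQ, lowPass, abs_neg]
        split_ifs
        · exact h.d_eq _ l
        · simp
      have e2 : (delta a b l : ℂ) * errCoef a b ε τ φ γ M c d n l =
          delta a b l * (P l - Q l) := by rw [errCoef, onFreq, if_pos hl]
      rw [e1, onFreq, if_pos hl, dft_zNum hab hM hE n hl]
      have e3 : Complex.I / 2 * delta a b l * (Q l - (starRingEnd ℂ) (Q (-l))) -
          Complex.I / 2 * delta a b l * (P l - (starRingEnd ℂ) (P (-l))) =
          Complex.I * (1 / 2 * (delta a b l * (starRingEnd ℂ) (P (-l) - Q (-l)))) -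
            Complex.I * (1 / 2 * (delta a b l * (P l - Q l))) := by
        rw [map_sub]; ring
      rw [e3]
      refine (norm_sub_le _ _).trans ?_
      rw [e2] at h1 ⊢
      simp only [norm_mul, norm_delta, RCLike.norm_conj, Complex.norm_I, one_mul] at h1 ⊢
      norm_num at h1 ⊢
      have := delta_pos (a := a) (b := b) (-l)
      nlinarith [mul_nonneg this.le (norm_nonneg (errCoef a b ε τ φ γ M c d n (-l)))]
    · rw [onFreq, if_neg hl, lowPass, if_neg fun h => hl (mem_freq_of_lt hE h)]
      simp; positivity

lemma errorLE_of_nrm_errCoef_le {w v : ℝ → ℝ → ℝ} {S : ℝ} (hab : a < b) (hK : 0 ≤ K)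
    (hs : IsSolution a b ε S φ γ w v) (hb : SobolevBound a b S m K w v) (hM : 0 < M) (hE : Even M)
    {n : ℕ} (ht : n * τ ∈ Set.Icc 0 S) {B : ℝ} (hB : 0 ≤ B)
    (h : nrm (fun l => delta a b l * errCoef a b ε τ φ γ M
      (fun t => fourierCoef a b fun x => (w t x : ℂ))
      (fun t => fourierCoef a b fun x => (v t x : ℂ)) n l) ≤ ENNReal.ofReal B) :
    ErrorLE a b ε τ φ γ M w v n (2 * (mesh a b M ^ m * K + 2 * B)) := by
  have hh := mesh_pos hab hM
  have hF := hs.fourierSolution hab hb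
  have hi : ∀ u : Fin (M + 1) → ℂ, MemLp (interp a b M u) 2 (volume.restrict (Set.Ioc a b)) :=
    fun u => memLp_of_continuousOn (continuous_interp u).continuousOn
  have hle : ∀ X : ℝ≥0∞, X ≤ ENNReal.ofReal B → ENNReal.ofReal (mesh a b M ^ m) *
      ENNReal.ofReal K + 2 * X ≤ ENNReal.ofReal (mesh a b M ^ m * K + 2 * B) := fun X hX => by
    rw [ENNReal.ofReal_add (by positivity) (by positivity), ENNReal.ofReal_mul (by positivity),
      ENNReal.ofReal_mul (by norm_num), ENNReal.ofReal_ofNat]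
    gcongr
  have hw := (hs.memH1 _ ht).1
  have hv := (hs.memL2 _ ht).1
  have h0 : 0 ≤ mesh a b M ^ m * K + 2 * B := by positivity
  have h1 := memSobolev_and_norm_le (s := 1) h0 (hw.sub (hi (wNum a b ε τ φ γ M n))) (by
    refine le_of_eq_of_le ?_ ((nrm_sub_wNum_le hF hab hM hE ht).trans (hle _ h))
    congr 1
    funext l
    congr 1
    refine (fourierCoef_sub (MemLp.intervalIntegrable_two hab hw)
      (MemLp.intervalIntegrable_two hab (hi _)) l).trans ?_
    rw [fourierCoef_interp hab])
  have h2 := memSobolev_and_norm_le (s := 0) h0 (hv.sub (hi (zNum a b ε τ φ γ M n))) (by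
    refine le_of_eq_of_le ?_ ((nrm_sub_zNum_le hF hab hM hE ht).trans (hle _ h))
    congr 1
    funext l
    congr 1
    refine (fourierCoef_sub (MemLp.intervalIntegrable_two hab hv)
      (MemLp.intervalIntegrable_two hab (hi _)) l).trans ?_
    rw [fourierCoef_interp hab])
  exact ⟨h1.1, h2.1, (add_le_add h1.2 h2.2).trans (by linarith)⟩

end SineGordon

/-! ### Choice of the parameters. -/

namespace SineGordon

open MeasureTheory Filter Topology
open scoped ENNReal NNReal

variable {a b ε τ T K : ℝ} {m M : ℕ} {φ γ : ℝ → ℝ} {c d : ℝ → ℤ → ℂ} {w v : ℝ → ℝ → ℝ}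

/-! ### The error bounds -/

lemma ErrorLE.mono {n : ℕ} {B B' : ℝ} (h : ErrorLE a b ε τ φ γ M w v n B) (hB : B ≤ B') :
    ErrorLE a b ε τ φ γ M w v n B' := ⟨h.1, h.2.1, h.2.2.trans hB⟩

/-- Two bounds at once: the prescribed smallness `η` starts the bootstrap, and `C₀ h^m` gives the
rate. -/
lemma exists_nrm_errCoef_zero_le (hab : a < b) (hφ : PeriodicContinuous a b φ)
    (hγ : PeriodicContinuous a b γ) (m : ℕ) (hK : 0 ≤ K) {η : ℝ} (hη : 0 < η) :
    ∃ h₀ : ℝ, 0 < h₀ ∧ ∃ C₀ : ℝ, 0 ≤ C₀ ∧ ∀ (M : ℕ) (ε τ S : ℝ) (c d : ℝ → ℤ → ℂ),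
      0 < M → Even M → mesh a b M ≤ h₀ → 0 ≤ S → FourierSolution a b ε S m K c d →
      (c 0 = fourierCoef a b fun x => (φ x : ℂ)) → (d 0 = fourierCoef a b fun x => (γ x : ℂ)) →
      nrm (fun l => delta a b l * errCoef a b ε τ φ γ M c d 0 l) ≤
        ENNReal.ofReal (min η (C₀ * mesh a b M ^ m)) := by
  have hL : 0 < b - a := sub_pos.2 hab
  have hpi := Real.pi_pos
  have hA := aliasConst_nonneg
  have hφ' : ContinuousOn (fun x => (φ x : ℂ)) (Set.Icc a b) :=
    Complex.continuous_ofReal.comp_continuousOn hφ.1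
  have hγ' : ContinuousOn (fun x => (γ x : ℂ)) (Set.Icc a b) :=
    Complex.continuous_ofReal.comp_continuousOn hγ.1
  obtain ⟨h₁, h₁pos, H₁⟩ := exists_mesh_nrm_delta_interpErr_le hab hφ' (half_pos hη)
  obtain ⟨h₂, h₂pos, H₂⟩ := exists_mesh_nrm_interpErr_le hab hγ' (by rw [hγ.2]) (half_pos hη)
  -- The summand `η` in `C₀` covers `m = 0`, where `h^m = 1` and only the smallness is known.
  refine ⟨min h₁ h₂, lt_min h₁pos h₂pos, (b - a + Real.pi + 1) * aliasConst * K + η,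
    by positivity, fun M ε τ S c d hM hE hh hS hF hc hd => ?_⟩
  have hm := mesh_pos hab hM
  have bc := hF.bound_c 0 ⟨le_rfl, hS⟩
  have bd := hF.bound_d 0 ⟨le_rfl, hS⟩
  rw [hc] at bc
  rw [hd] at bd
  have hsmall : nrm (fun l => delta a b l * errCoef a b ε τ φ γ M c d 0 l) ≤
      ENNReal.ofReal η := by
    refine (nrm_errCoef_zero_le hab hM hE hc hd).trans ((add_le_add
      (H₁ M hM hE (hh.trans (min_le_left _ _)) ?_)
      (H₂ M hM hE (hh.trans (min_le_right _ _)))).trans (le_of_eq ?_))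
    · exact (delta_mul_le_pow (by omega) bc).trans_lt ENNReal.ofReal_lt_top
    · rw [← ENNReal.ofReal_add (half_pos hη).le (half_pos hη).le, add_halves]
  rw [ENNReal.ofReal_min]
  refine le_min hsmall ?_
  rcases m.eq_zero_or_pos with rfl | hm1
  · refine hsmall.trans (ENNReal.ofReal_le_ofReal ?_)
    rw [pow_zero, mul_one]
    refine le_add_of_nonneg_left ?_
    positivity
  · refine (nrm_errCoef_zero_le hab hM hE hc hd).trans ((add_le_add
      ((nrm_delta_mul_onFreq_le hab hM hE _).trans (mul_le_mul_right
        (nrm_interpErr_le hab hM hE (by omega) hφ' bc) _))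
      (nrm_interpErr_le hab hM hE hm1 hγ' bd)).trans ?_)
    rw [← ENNReal.ofReal_mul (by positivity), ← ENNReal.ofReal_add (by positivity)
      (by positivity)]
    apply ENNReal.ofReal_le_ofReal
    have e : (b - a + Real.pi) / mesh a b M * (aliasConst * mesh a b M ^ (m + 1) * K) +
        aliasConst * mesh a b M ^ m * K =
        (b - a + Real.pi + 1) * aliasConst * K * mesh a b M ^ m := by
      rw [pow_succ]; field_simp
    rw [e]
    exact mul_le_mul_of_nonneg_right (le_add_of_nonneg_right hη.le) (by positivity)

lemma tempConst_nonneg (hT : 0 ≤ T) (hK : 0 ≤ K) : 0 ≤ tempConst a b T K := by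
  have h1 := compConst_nonneg (a := a) (b := b) (s := 1) hK
  have h2 := locConst_nonneg (a := a) (b := b) hK
  rw [tempConst]; positivity

lemma mul_div_add_one_le {x y : ℝ} (hx : 0 ≤ x) (hy : 0 ≤ y) : x * (y / (x + 1)) ≤ y := by
  rw [mul_div_assoc', div_le_iff₀ (by positivity)]
  nlinarith

lemma linear_comb_le {p q r x y z : ℝ} (hp : 0 ≤ p) (hq : 0 ≤ q) (hr : 0 ≤ r) (hx : 0 ≤ x)
    (hy : 0 ≤ y) (hz : 0 ≤ z) : p * x + q * y + r * z ≤ (p + q + r + 1) * (x + y + z) := by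
  have : 0 ≤ p * (y + z) + q * (x + z) + r * (x + y) + (x + y + z) := by positivity
  linarith

/-- The error bound with the additional time scale `τ₀`. -/
lemma exists_error_bound (hab : a < b) (hT : 0 < T) (m : ℕ) (hφ : PeriodicContinuous a b φ)
    (hγ : PeriodicContinuous a b γ) (K : ℝ) : ∃ h₀ : ℝ, 0 < h₀ ∧ h₀ ≤ 1 ∧ ∀ β : ℝ, 0 < β →
      ∃ τs : ℝ, 0 < τs ∧ τs < 1 ∧ ∃ C : ℝ, 0 < C ∧
        ∀ ε : ℝ, 0 < ε → ε ≤ 1 → ∀ w v : ℝ → ℝ → ℝ,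
          IsSolution a b ε (T / ε ^ 2) φ γ w v →
          SobolevBound a b (T / ε ^ 2) m K w v →
          ∀ τ₀ : ℝ, 0 < τ₀ → τ₀ ≤ τs →
          ∀ M : ℕ, 0 < M → Even M → mesh a b M ≤ h₀ →
          ∀ τ : ℝ, 0 < τ → τ < β * τ₀ →
          ∀ n : ℕ, (n : ℝ) ≤ T / ε ^ 2 / τ →
            ErrorLE a b ε τ φ γ M w v n
              (C * (mesh a b M ^ m + ε ^ 2 * τ + τ₀ ^ (m + 1))) := by
  -- For negative `K` no solution satisfies the bound.
  rcases lt_or_ge K 0 with hK | hK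
  · refine ⟨1, one_pos, le_rfl, fun β _ => ⟨1 / 2, by norm_num, by norm_num, 1, one_pos, ?_⟩⟩
    intro ε hε _ w v _ hb
    have := (hb 0 ⟨le_rfl, by positivity⟩).1.2
    exact absurd (this.trans_lt hK) (not_lt.2 (Real.sqrt_nonneg _))
  set G := Real.exp (T * supConst a b K ^ 2) with hG
  have hG0 : 0 < G := Real.exp_pos _
  have hSp := spaceConst_nonneg (a := a) (b := b) (m := m) hK
  have hTe := tempConst_nonneg (a := a) (b := b) hT.le hK
  -- The total error, including the Gronwall factor `G`, must stay below `1`; initial data, spatial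
  -- aliasing and time quadrature each get a third.
  obtain ⟨h₁, h₁pos, C₀, hC₀, H⟩ := exists_nrm_errCoef_zero_le hab hφ hγ m hK
    (η := 1 / 3 / G) (by positivity)
  -- Only the time quadrature involves `β`, so `h₀` can be fixed before `β`.
  refine ⟨min h₁ (min 1 (1 / 3 / (T * spaceConst a b K m * G + 1))), by positivity,
    (min_le_right _ _).trans (min_le_left _ _), fun β hβ => ?_⟩
  set D := tempConst a b T K * (β + (12 * β) ^ (m + 1)) * G with hD
  have hD0 : 0 ≤ D := by positivity
  set p := 2 * K + 4 * G * (C₀ + T * spaceConst a b K m) with hp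
  set q := 4 * G * tempConst a b T K with hq
  set r := 4 * G * (tempConst a b T K * (12 * β) ^ (m + 1)) with hr
  refine ⟨min (1 / 2) (1 / 3 / (D + 1)), by positivity, (min_le_left _ _).trans_lt (by norm_num),
    p + q + r + 1, by positivity, ?_⟩
  intro ε hε hε1 w v hs hb τ₀ hτ₀ hτs M hM hE hh τ hτ hτβ n hn
  have hm := mesh_pos hab hM
  have hh1 : mesh a b M ≤ 1 := hh.trans ((min_le_right _ _).trans (min_le_left _ _))
  have hτ1 : τ₀ ≤ 1 := hτs.trans ((min_le_left _ _).trans (by norm_num))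
  have hpow : mesh a b M ^ (m + 1) ≤ mesh a b M := pow_le_of_le_one hm.le hh1 (by omega)
  have hpow' : mesh a b M ^ (m + 1) ≤ mesh a b M ^ m :=
    pow_le_pow_of_le_one hm.le hh1 (by omega)
  have hF := hs.fourierSolution hab hb
  have hnτ : n * τ ≤ T / ε ^ 2 := (le_div_iff₀ hτ).1 hn
  have hΛ : (1 / (12 * β * τ₀))⁻¹ ^ (m + 1) = (12 * β) ^ (m + 1) * τ₀ ^ (m + 1) := by
    rw [one_div, inv_inv, mul_pow]
  have h0 := H M ε τ (T / ε ^ 2) _ _ hM hE (hh.trans (min_le_left _ _)) (by positivity) hF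
    (fourierCoef_congr_ae hab (hs.init_w.mono fun x hx => by simp only [hx]))
    (fourierCoef_congr_ae hab (hs.init_v.mono fun x hx => by simp only [hx]))
  have hετ : ε ^ 2 * τ ≤ β * τ₀ :=
    (mul_le_of_le_one_left hτ.le (pow_le_one₀ hε.le hε1)).trans hτβ.le
  have hsmall : (min (1 / 3 / G) (C₀ * mesh a b M ^ m) +
      T * spaceConst a b K m * mesh a b M ^ (m + 1) + tempConst a b T K *
        (ε ^ 2 * τ + (1 / (12 * β * τ₀))⁻¹ ^ (m + 1))) * G ≤ 1 := by
    have s1 : min (1 / 3 / G) (C₀ * mesh a b M ^ m) * G ≤ 1 / 3 :=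
      (mul_le_mul_of_nonneg_right (min_le_left _ _) hG0.le).trans
        (div_mul_cancel₀ _ hG0.ne').le
    have s2 : T * spaceConst a b K m * mesh a b M ^ (m + 1) * G ≤ 1 / 3 := by
      refine le_trans ?_ (mul_div_add_one_le (x := T * spaceConst a b K m * G) (by positivity)
        (by norm_num))
      rw [mul_right_comm]
      gcongr
      exact hpow.trans (hh.trans ((min_le_right _ _).trans (min_le_right _ _)))
    have s3 : tempConst a b T K * (ε ^ 2 * τ + (1 / (12 * β * τ₀))⁻¹ ^ (m + 1)) * G ≤ 1 / 3 := by
      refine le_trans ?_ (mul_div_add_one_le hD0 (by norm_num))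
      rw [hΛ]
      calc _ ≤ tempConst a b T K * (β * τ₀ + (12 * β) ^ (m + 1) * τ₀) * G := by
            gcongr
            exact pow_le_of_le_one hτ₀.le hτ1 (by omega)
        _ = D * τ₀ := by rw [hD]; ring
        _ ≤ _ := by
            gcongr
            exact hτs.trans (min_le_right _ _)
    linarith
  -- With this cut-off, `12Λτ ≤ 1` says exactly `τ ≤ βτ₀`.
  have key := nrm_errCoef_le_of_small hF hab hK hT hε hε1 hM hE hτ (Λ := 1 / (12 * β * τ₀))
    (by positivity) (by
      have e : 12 * (1 / (12 * β * τ₀)) * τ = τ / (β * τ₀) := by field_simp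
      rw [e, div_le_one (by positivity)]
      exact hτβ.le) (by positivity) h0 hsmall hnτ
  refine (errorLE_of_nrm_errCoef_le hab hK hs hb hM hE ⟨by positivity, hnτ⟩ (by positivity)
    key).mono (le_trans ?_ (linear_comb_le (by positivity) (by positivity) (by positivity)
      (by positivity) (by positivity) (by positivity)))
  rw [hΛ, ← hG]
  calc _ ≤ 2 * (mesh a b M ^ m * K + 2 * ((C₀ * mesh a b M ^ m +
        T * spaceConst a b K m * mesh a b M ^ m + tempConst a b T K *
          (ε ^ 2 * τ + (12 * β) ^ (m + 1) * τ₀ ^ (m + 1))) * G)) := by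
        gcongr
        exact min_le_right _ _
    _ = _ := by rw [hp, hq, hr]; ring

end SineGordon

theorem theorem3p2 (a b : ℝ) (hab : a < b) (T : ℝ) (hT : 0 < T) (m : ℕ)
    (φ γ : ℝ → ℝ) (hφ : SineGordon.PeriodicContinuous a b φ)
    (hγ : SineGordon.PeriodicContinuous a b γ) :
    -- the bound under the uniform `H^{m+1} × H^m` bound `K` on the solution
    (∀ K : ℝ, ∃ h₀ : ℝ, 0 < h₀ ∧ ∀ β : ℝ, 0 < β →
      ∃ τs : ℝ, 0 < τs ∧ τs < 1 ∧ ∃ C : ℝ, 0 < C ∧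
        ∀ ε : ℝ, 0 < ε → ε ≤ 1 → ∀ w v : ℝ → ℝ → ℝ,
          SineGordon.IsSolution a b ε (T / ε ^ 2) φ γ w v →
          SineGordon.SobolevBound a b (T / ε ^ 2) m K w v →
          ∀ τ₀ : ℝ, 0 < τ₀ → τ₀ ≤ τs →
          ∀ M : ℕ, 0 < M → Even M → SineGordon.mesh a b M ≤ h₀ →
          ∀ τ : ℝ, 0 < τ → τ < β * τ₀ →
          ∀ n : ℕ, (n : ℝ) ≤ T / ε ^ 2 / τ →
            SineGordon.ErrorLE a b ε τ φ γ M w v n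
              (C * (SineGordon.mesh a b M ^ m + ε ^ 2 * τ + τ₀ ^ (m + 1)))) ∧
    -- the bound for smooth solutions and sufficiently small time steps
    (∀ K : ℕ → ℝ, ∀ σ : ℝ, 0 < σ →
      ∃ h₀ : ℝ, 0 < h₀ ∧ ∃ τ₁ : ℝ, 0 < τ₁ ∧ ∃ C : ℝ, 0 < C ∧
        ∀ ε : ℝ, 0 < ε → ε ≤ 1 → ∀ w v : ℝ → ℝ → ℝ,
          SineGordon.IsSolution a b ε (T / ε ^ 2) φ γ w v →
          (∀ r : ℕ, SineGordon.SobolevBound a b (T / ε ^ 2) r (K r) w v) →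
          ∀ M : ℕ, 0 < M → Even M → SineGordon.mesh a b M ≤ h₀ →
          ∀ τ : ℝ, 0 < τ → τ < τ₁ * ε ^ σ →
          ∀ n : ℕ, (n : ℝ) ≤ T / ε ^ 2 / τ →
            SineGordon.ErrorLE a b ε τ φ γ M w v n
              (C * (SineGordon.mesh a b M ^ m + ε ^ 2 * τ))) := by
  refine ⟨fun K => ?_, fun K σ hσ => ?_⟩
  · obtain ⟨h₀, h1, _, h2⟩ := SineGordon.exists_error_bound hab hT m hφ hγ K
    exact ⟨h₀, h1, h2⟩
  -- The regularity index is chosen with `σr ≥ 2`, so that `τ ≤ ε^σ` implies `τ^r ≤ ε²`; `r ≥ m`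
  -- keeps the spatial rate.
  set r := max m ⌈2 / σ⌉₊ with hr
  obtain ⟨h₀, h₀pos, h₀1, H⟩ := SineGordon.exists_error_bound hab hT r hφ hγ (K r)
  obtain ⟨τs, τspos, τs1, C, hC, H⟩ := H 1 one_pos
  -- The first part is used with `β = 1` and `τ₀ = 2τ`, because it requires `τ < βτ₀` strictly. This
  -- explains the half in `τ₁` and the power of two in the constant.
  refine ⟨h₀, h₀pos, τs / 2, by positivity, C * (1 + 2 ^ (r + 1)), by positivity, ?_⟩
  intro ε hε hε1 w v hs hb M hM hE hh τ hτ hτσ n hn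
  have hεσ : ε ^ σ ≤ 1 := Real.rpow_le_one hε.le hε1 hσ.le
  have hεσ0 : 0 < ε ^ σ := Real.rpow_pos_of_pos hε σ
  have hτ1 : τ ≤ τs / 2 := hτσ.le.trans (mul_le_of_le_one_right (by positivity) hεσ)
  have hτε : τ ≤ ε ^ σ := hτσ.le.trans (mul_le_of_le_one_left hεσ0.le (by linarith))
  refine (H ε hε hε1 w v hs (hb r) (2 * τ) (by positivity) (by linarith) M hM hE hh τ hτ
    (by linarith) n hn).mono ?_
  have hm := SineGordon.mesh_pos hab hM
  have h1 : SineGordon.mesh a b M ^ r ≤ SineGordon.mesh a b M ^ m :=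
    pow_le_pow_of_le_one hm.le (hh.trans h₀1) (le_max_left _ _)
  have h2 : τ ^ r ≤ ε ^ 2 := by
    have h3 : 2 ≤ σ * r := by
      have : 2 / σ ≤ r := (Nat.le_ceil _).trans (by exact_mod_cast le_max_right _ _)
      rwa [div_le_iff₀' hσ] at this
    calc τ ^ r ≤ (ε ^ σ) ^ r := by gcongr
      _ = ε ^ (σ * r) := by rw [← Real.rpow_natCast, ← Real.rpow_mul hε.le]
      _ ≤ ε ^ (2 : ℝ) := Real.rpow_le_rpow_of_exponent_ge hε hε1 h3
      _ = ε ^ 2 := by norm_cast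
  have h4 : (2 * τ) ^ (r + 1) ≤ 2 ^ (r + 1) * (ε ^ 2 * τ) := by
    rw [mul_pow, pow_succ τ]; gcongr
  rw [mul_assoc C]
  refine mul_le_mul_of_nonneg_left ?_ hC.le
  have h5 : 0 ≤ 2 ^ (r + 1) * SineGordon.mesh a b M ^ m := by positivity
  linarith
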